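/- Let $\alpha\in(0,\frac12)$. For $\theta\in L^1(\mathbb R^2)\cap L^\infty(\mathbb R^2)$ and $x\in\mathbb R^2$ let $$u(\theta;x):=c_\alpha\int_{\mathbb R^2}\frac{(x-y)^\perp}{|x-y|^{2+2\alpha}}\,\theta(y)\,dy,\qquad (x_1,x_2)^\perp:=(-x_2,x_1),\qquad c_\alpha:=\frac{2\alpha\,\Gamma(\alpha)}{4^{1-\alpha}\pi\,\Gamma(1-\alpha)},$$ that is, $u(\theta)=-\nabla^\perp(-\Delta)^{-1+\alpha}\theta$, and consider the g-SQG equation $\partial_t\theta+u(\theta)\cdot\nabla\theta=0$. *Representations.* Let $\mathcal L$ be a measurable space, let $\mu$ be a $\sigma$-finite signed measure on $\mathcal L$ with total variation $|\mu|$, and let $\Theta\subseteq\mathbb R^2\times\mathcal L$ belong to the product $\sigma$-algebra and have finite measure with respect to the product of the Lebesgue measure and $|\mu|$. Put $\Theta^\lambda:=\{x:(x,\lambda)\in\Theta\}$. Then $(\Theta,\mu)$ is a *generalized layer cake representation* of $\theta:\mathbb R^2\to\mathbb R$ if $\theta(x)=\int_{\mathcal L}\mathbf 1_{\Theta^\lambda}(x)\,d\mu(\lambda)$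 for every $x\in\mathbb R^2$ (the integrand being $|\mu|$-integrable). Let $$L_\mu(\Theta):=\sup_{x\in\mathbb R^2}\int_{\mathcal L}\frac{d|\mu|(\lambda)}{d(x,\partial\Theta^\lambda)^{2\alpha}}\in[0,\infty],\qquad \tfrac10:=\infty,\quad d(x,\emptyset):=\infty,\quad \tfrac1\infty:=0,$$ and $\Phi_*\Theta:=\{(\Phi(x),\lambda):(x,\lambda)\in\Theta\}$ for $\Phi:\mathbb R^2\to\mathbb R^2$. *Solutions.* Let $I\ni0$ be an open interval. A *Lagrangian solution* on $I$ with initial datum $\theta^0$ and flow map $\Phi$ is a family $\theta^t=\theta^0\circ(\Phi^t)^{-1}\in L^1(\mathbb R^2)\cap L^\infty(\mathbb R^2)$, $t\in I$, where each $\Phi^t$ is a measure-preserving homeomorphism of $\mathbb R^2$, the map $t\mapsto\Phi^t$ is continuous on $I$ in the uniform metric $\|\Phi^s-\Phi^t\|_{L^\infty}$, $\Phi^0=\mathrm{Id}$, and $\partial_t\Phi^t(x)=u(\theta^t;\Phi^t(x))$ for all $t\in I$ and $x\in\mathbb R^2$. It is *controlled by* $(\Theta,\mu)$ if $\sup_{t\in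 J}L_\mu(\Phi^t_*\Theta)<\infty$ for every compact interval $J\subseteq I$. **Theorem 1.2.** Let $\theta^0\in L^1(\mathbb R^2)\cap L^\infty(\mathbb R^2)$ have a generalized layer cake representation $(\Theta,\mu)$ with $L_\mu(\Theta)<\infty$. Then there are an open interval $I\ni0$ and a Lagrangian solution $\theta$ on $I$ with initial datum $\theta^0$ and flow map $\Phi$ such that: 1. $\theta$ is controlled by $(\Theta,\mu)$. If $\theta'$, with flow map $\Phi'$, is any Lagrangian solution with initial datum $\theta^0$ on an open interval $I'\ni0$ that is controlled by $(\Theta,\mu)$, then $I'\subseteq I$, and $\theta'^t=\theta^t$ and $\Phi'^t=\Phi^t$ for all $t\in I'$. So $I$ is the maximal such interval and the solution is unique. 2. $I$, $\theta$ and $\Phi$ do not depend on the representation: for every generalized layer cake representation $(\Theta',\mu')$ of $\theta^0$ with $L_{\mu'}(\Theta')<\infty$, statement 1 holds, with the same $I$, $\theta$ and $\Phi$, for $(\Theta',\mu')$ in place of $(\Theta,\mu)$. 3. For every compact interval $J\subseteq I$ there is $K<\infty$ such that $\Phi^t$ and $(\Phi^t)^{-1}$ are $K$-Lipschitz for all $t\in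 J$. 4. If $T$ is an endpoint of $I$ and $|T|<\infty$, then $\lim_{t\to T}L_\mu(\Phi^t_*\Theta)=\infty$, the limit being taken over $t\in I$. -/

import Mathlib

open MeasureTheory Set Filter Topology
open scoped ENNReal NNReal

noncomputable section

namespace GSQG

/-- The Euclidean plane `ℝ²`. -/
abbrev Plane : Type := EuclideanSpace ℝ (Fin 2)

/-- Rotation by a right angle, `(x₁, x₂)^⊥ = (-x₂, x₁)`. -/
def perp (x : Plane) : Plane := !₂[-(x 1), x 0]

/-- The constant `c_α` for which
`-∇^⊥ (-Δ)^{-1+α} θ (x) = c_α ∫ (x - y)^⊥ / |x - y|^{2+2α} θ(y) dy`. The Riesz potential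
`(-Δ)^{-1+α}` on `ℝ²` has the kernel `Γ(α) / (4^{1-α} π Γ(1-α)) |x|^{-2α}`, and
`-∇^⊥ |x|^{-2α} = 2α x^⊥ / |x|^{2+2α}`. -/
def velocityConst (α : ℝ) : ℝ :=
  2 * α * Real.Gamma α / ((4 : ℝ) ^ (1 - α) * Real.pi * Real.Gamma (1 - α))

/-- The velocity `u(θ; x) = c_α ∫ (x - y)^⊥ / |x - y|^{2+2α} θ(y) dy`. For `0 < α < 1/2` and
`θ ∈ L¹ ∩ L^∞` the integrand is integrable for every `x`. -/
def velocity (α : ℝ) (θ : Plane → ℝ) (x : Plane) : Plane :=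
  velocityConst α • ∫ y : Plane, (θ y / ‖x - y‖ ^ (2 + 2 * α)) • perp (x - y)

/-- A `σ`-finite signed measure, given by its Jordan decomposition `μ = μ⁺ - μ⁻` into mutually
singular `σ`-finite measures. (Mathlib's `SignedMeasure` has only finite values. Here `μ⁺` and
`μ⁻` may be infinite.) -/
structure SigmaFiniteSignedMeasure (L : Type*) [MeasurableSpace L] where
  /-- The positive part `μ⁺`. -/
  pos : Measure L
  /-- The negative part `μ⁻`. -/
  neg : Measure L
  sigmaFinite_pos : SigmaFinite pos
  sigmaFinite_neg : SigmaFinite neg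
  mutuallySingular : pos ⟂ₘ neg

namespace SigmaFiniteSignedMeasure

variable {L : Type*} [MeasurableSpace L]

/-- The total variation measure `|μ| = μ⁺ + μ⁻`. -/
def totalVariation (μ : SigmaFiniteSignedMeasure L) : Measure L := μ.pos + μ.neg

/-- `∫ f dμ = ∫ f dμ⁺ - ∫ f dμ⁻`, meaningful for `f` integrable with respect to `|μ|`. -/
def integral (μ : SigmaFiniteSignedMeasure L) (f : L → ℝ) : ℝ :=
  (∫ l, f l ∂μ.pos) - ∫ l, f l ∂μ.neg

end SigmaFiniteSignedMeasure

/-- The section `Θ^λ = {x | (x, λ) ∈ Θ}`. -/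
def slice {L : Type*} (Θ : Set (Plane × L)) (l : L) : Set Plane := {x | (x, l) ∈ Θ}

/-- `(Θ, μ)` is a generalized layer cake representation of `θ`: `Θ` lies in the product
`σ`-algebra, has finite measure with respect to the product of the Lebesgue measure and `|μ|`, and
`θ(x) = ∫ 1_{Θ^λ}(x) dμ(λ)` for every `x`. -/
structure IsLayerCake {L : Type*} [MeasurableSpace L] (θ : Plane → ℝ) (Θ : Set (Plane × L))
    (μ : SigmaFiniteSignedMeasure L) : Prop where
  measurableSet : MeasurableSet Θ
  measure_lt_top : ((volume : Measure Plane).prod μ.totalVariation) Θ < ∞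
  integrable : ∀ x : Plane,
    Integrable (fun l => (slice Θ l).indicator (fun _ => (1 : ℝ)) x) μ.totalVariation
  eq_integral : ∀ x : Plane,
    θ x = μ.integral (fun l => (slice Θ l).indicator (fun _ => (1 : ℝ)) x)

/-- `L_μ(Θ) = sup_x ∫ d|μ|(λ) / d(x, ∂Θ^λ)^{2α} ∈ [0, ∞]`, where the distance takes values in
`[0, ∞]` (it is `∞` if `∂Θ^λ` is empty), `1/0 = ∞` and `1/∞ = 0`. -/
def layerCakeL {L : Type*} [MeasurableSpace L] (α : ℝ) (Θ : Set (Plane × L))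
    (μ : SigmaFiniteSignedMeasure L) : ℝ≥0∞ :=
  ⨆ x : Plane,
    ∫⁻ l, ((Metric.infEDist x (frontier (slice Θ l))) ^ (2 * α))⁻¹ ∂μ.totalVariation

/-- `Φ_* Θ = {(Φ(x), λ) | (x, λ) ∈ Θ}`. -/
def push {L : Type*} (Φ : Plane → Plane) (Θ : Set (Plane × L)) : Set (Plane × L) :=
  (fun p : Plane × L => (Φ p.1, p.2)) '' Θ

/-- `θ` is a Lagrangian solution of the g-SQG equation with initial datum `θ₀` on the open interval
`I ∋ 0`, with flow map `Φ`: each `Φ^t` is a measure-preserving homeomorphism, `t ↦ Φ^t` is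
continuous on `I` in the uniform metric, `∂_t Φ^t = u(θ^t) ∘ Φ^t`, `Φ^0 = Id`, and
`θ^t = θ₀ ∘ (Φ^t)⁻¹`. The values of `θ` and `Φ` at times outside `I` are irrelevant. -/
structure IsLagrangianSolution (α : ℝ) (θ₀ : Plane → ℝ) (I : Set ℝ) (θ : ℝ → Plane → ℝ)
    (Φ : ℝ → Plane ≃ₜ Plane) : Prop where
  isOpen : IsOpen I
  ordConnected : I.OrdConnected
  zero_mem : (0 : ℝ) ∈ I
  memLp_one : ∀ t ∈ I, MemLp (θ t) 1 volume
  memLp_top : ∀ t ∈ I, MemLp (θ t) ∞ volume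
  eq_comp : ∀ t ∈ I, ∀ x : Plane, θ t x = θ₀ ((Φ t).symm x)
  measurePreserving : ∀ t ∈ I, MeasurePreserving (Φ t) volume volume
  continuous_in_time : ∀ t ∈ I, TendstoUniformly (fun s x => Φ s x) (fun x => Φ t x) (𝓝[I] t)
  flow_zero : ∀ x : Plane, Φ 0 x = x
  hasDerivAt : ∀ t ∈ I, ∀ x : Plane,
    HasDerivAt (fun s => Φ s x) (velocity α (θ t) (Φ t x)) t

/-- A Lagrangian solution on `I` such that `sup_{t ∈ J} L_μ(Φ^t_* Θ) < ∞` for every compact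
interval `J ⊆ I`. -/
structure IsControlledSolution {L : Type*} [MeasurableSpace L] (α : ℝ) (θ₀ : Plane → ℝ)
    (Θ : Set (Plane × L)) (μ : SigmaFiniteSignedMeasure L) (I : Set ℝ) (θ : ℝ → Plane → ℝ)
    (Φ : ℝ → Plane ≃ₜ Plane) : Prop extends IsLagrangianSolution α θ₀ I θ Φ where
  bounded : ∀ a b : ℝ, Icc a b ⊆ I → (⨆ t ∈ Icc a b, layerCakeL α (push (Φ t) Θ) μ) < ∞

end GSQG

end

open scoped BoundedContinuousFunction

namespace GSQG

/-! ### The regularized kernel -/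

/-! Everything is governed by the seminorm `dini`, N(θ) = sup_x ∫ |θ(x) - θ(y)| |x - y|^{-2-2α} dy,
which does not see the representation. A slice contributes to θ(x) - θ(y) only if its boundary comes
within |x - y| of x, so Tonelli gives N(θ) ≤ (π/α) L_μ(Θ) (`dini_le_layerCakeL`). Transport by a
measure-preserving map Φ multiplies N and L_μ by at most a power of the Lipschitz constant of Φ⁻¹
(`dini_comp_symm_le`, `layerCakeL_push_le`).

The kernel K is odd, so K∘a - K∘b has integral zero whenever a and b preserve measure and stay at
bounded distance (`integral_kernel_sub`). The constant θ(x) can therefore be subtracted from the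
density before estimating. This makes the velocity Lipschitz (`enorm_kernelIntegral_sub_le`), and it
bounds the difference of the velocities of one particle in two flows by the uniform distance of the
flows (`enorm_kernelIntegral_flow_sub_le`). In Lagrangian variables the equation is thus an ordinary
differential equation whose right side is Lipschitz as long as the flow maps have Lipschitz
inverses.

Local existence: with |x|² replaced by |x|² + ε² the equation for the displacement has a globally
Lipschitz right side on bounded continuous maps. Its flow preserves measure by Liouville's theorem
(`measurePreserving_flow`). A bootstrap keeps the displacement 1/2-Lipschitz for a time depending
only on N (`IsRegularizedSolution.lipschitzWith`), and Gronwall makes the solutions Cauchy as ε → 0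
(`exists_displacement`).

Uniqueness and independence of the representation: a controlled solution has a bounded L_μ, hence a
velocity Lipschitz in space uniformly on compact time intervals, hence bi-Lipschitz flow maps
(`IsControlledSolution.isLipschitzFlow`). Conversely, a locally bi-Lipschitz flow keeps L_μ bounded
for every representation for which it is finite initially (`IsLipschitzFlow.layerCake_bounded`). So
controlled solutions are exactly the locally bi-Lipschitz flows that start at the identity, a notion
in which no representation occurs. These flows are unique (`IsLipschitzFlow.eq_of_eq`), and their
union is the maximal one. The local existence time depends only on a bound for L_μ at the starting
time, so L_μ must tend to infinity at a finite endpoint (`exists_Ioo_subset_of_maximal`). -/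

theorem perp_add (x y : Plane) : perp (x + y) = perp x + perp y := by
  ext i; fin_cases i <;> simp [perp]; ring

theorem perp_smul (c : ℝ) (x : Plane) : perp (c • x) = c • perp x := by
  ext i; fin_cases i <;> simp [perp]

/-- The rotation by a right angle as a continuous linear map. -/
noncomputable def perpL : Plane →L[ℝ] Plane :=
  LinearMap.toContinuousLinearMap
    { toFun := perp, map_add' := perp_add, map_smul' := perp_smul }

theorem perpL_apply (x : Plane) : perpL x = perp x := rfl

theorem norm_perp (x : Plane) : ‖perp x‖ = ‖x‖ := by
  simp [EuclideanSpace.norm_eq, perp, add_comm]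

theorem perp_sub (x y : Plane) : perp (x - y) = perp x - perp y := perpL.map_sub x y

theorem perp_neg (x : Plane) : perp (-x) = -perp x := perpL.map_neg x

theorem perp_zero : perp 0 = 0 := perpL.map_zero

/-- The kernel `x^⊥ / (|x|² + ε²)^{1+α}`. It is smooth for `ε ≠ 0`, and `ε = 0` gives the kernel of
the velocity. -/
noncomputable def kernel (α ε : ℝ) (x : Plane) : Plane :=
  (‖x‖ ^ 2 + ε ^ 2) ^ (-(1 + α)) • perp x

theorem kernel_neg (α ε : ℝ) (x : Plane) : kernel α ε (-x) = -kernel α ε x := by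
  simp [kernel, perp_neg]

theorem kernel_zero_right (α ε : ℝ) : kernel α ε 0 = 0 := by
  simp [kernel, perp_zero]

theorem measurable_kernel (α ε : ℝ) : Measurable (kernel α ε) := by
  have : Measurable fun x : Plane => (‖x‖ ^ 2 + ε ^ 2) ^ (-(1 + α)) := by fun_prop
  exact this.smul perpL.continuous.measurable

theorem sq_rpow_neg {r : ℝ} (hr : 0 ≤ r) (s : ℝ) : (r ^ 2) ^ (-s) = r ^ (-(2 * s)) := by
  rw [← Real.rpow_natCast, ← Real.rpow_mul hr]; norm_num

theorem profile_le {α : ℝ} (hα : 0 < α) (ε : ℝ) {m r : ℝ} (hm : 0 < m) (hr : m ≤ r) :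
    (r ^ 2 + ε ^ 2) ^ (-(1 + α)) ≤ m ^ (-(2 + 2 * α)) := by
  have h1 : m ^ (-(2 + 2 * α)) = (m ^ 2) ^ (-(1 + α)) := by
    rw [sq_rpow_neg hm.le]; ring_nf
  rw [h1]
  apply Real.rpow_le_rpow_of_nonpos (by positivity) (by nlinarith [sq_nonneg ε]) (by linarith)

theorem norm_kernel_le {α : ℝ} (hα : 0 < α) (ε : ℝ) (x : Plane) :
    ‖kernel α ε x‖ ≤ ‖x‖ ^ (-(1 + 2 * α)) := by
  rcases eq_or_ne x 0 with rfl | hx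
  · rw [kernel_zero_right, norm_zero]; positivity
  have hx' : 0 < ‖x‖ := norm_pos_iff.2 hx
  rw [kernel, norm_smul, norm_perp, Real.norm_of_nonneg (by positivity)]
  calc _ ≤ ‖x‖ ^ (-(2 + 2 * α)) * ‖x‖ := by gcongr; exact profile_le hα ε hx' le_rfl
    _ = ‖x‖ ^ (-(1 + 2 * α)) := by
      nth_rewrite 2 [← Real.rpow_one ‖x‖]
      rw [← Real.rpow_add hx']; ring_nf

/-- Bernoulli's inequality with exponent 2 + 2α ≤ 3 replaces the mean value theorem and gives a
constant free of ε. The regularization only brings the ratio of the two profiles closer to 1, since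
(b/a)² ≤ (b² + ε²)/(a² + ε²). -/
theorem profile_sub_le {α : ℝ} (hα : 0 < α) (hα' : α < 1 / 2) (ε : ℝ) {a b : ℝ} (hb : 0 < b)
    (hab : b ≤ a) :
    |(a ^ 2 + ε ^ 2) ^ (-(1 + α)) - (b ^ 2 + ε ^ 2) ^ (-(1 + α))| * b ≤
      3 * (a - b) * b ^ (-(2 + 2 * α)) := by
  have ha : 0 < a := hb.trans_le hab
  set A := a ^ 2 + ε ^ 2
  set B := b ^ 2 + ε ^ 2
  have hA : 0 < A := by positivity
  have hB : 0 < B := by positivity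
  have hBA : B ≤ A := by simp only [A, B]; gcongr
  have hmono : A ^ (-(1 + α)) ≤ B ^ (-(1 + α)) :=
    Real.rpow_le_rpow_of_nonpos hB hBA (by linarith)
  rw [abs_sub_comm, abs_of_nonneg (by linarith)]
  have hratio : (b / a) ^ 2 ≤ B / A := by
    rw [div_pow, div_le_div_iff₀ (by positivity) hA]
    have : b ^ 2 ≤ a ^ 2 := by gcongr
    simp only [A, B]; nlinarith [mul_le_mul_of_nonneg_right this (sq_nonneg ε)]
  have hbern : 1 + (2 + 2 * α) * (b / a - 1) ≤ (b / a) ^ (2 + 2 * α) := by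
    have := one_add_mul_self_le_rpow_one_add (s := b / a - 1) (p := 2 + 2 * α)
      (by have : 0 < b / a := by positivity
          linarith) (by linarith)
    simpa using this
  have hpow : (b / a) ^ (2 + 2 * α) ≤ (B / A) ^ (1 + α) := by
    calc (b / a) ^ (2 + 2 * α) = ((b / a) ^ 2) ^ (1 + α) := by
          rw [← Real.rpow_natCast, ← Real.rpow_mul (by positivity)]; push_cast; ring_nf
      _ ≤ _ := by gcongr
  have hdiv : A ^ (-(1 + α)) = B ^ (-(1 + α)) * (B / A) ^ (1 + α) := by
    rw [Real.div_rpow hB.le hA.le, Real.rpow_neg hA.le, Real.rpow_neg hB.le]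
    field_simp
  have hBle : B ^ (-(1 + α)) ≤ b ^ (-(2 + 2 * α)) := profile_le hα ε hb le_rfl
  have hBpos : 0 < B ^ (-(1 + α)) := by positivity
  have h1 : 1 - (B / A) ^ (1 + α) ≤ 3 * ((a - b) / a) := by
    have h2 : (b / a - 1) = -((a - b) / a) := by field_simp; ring
    have h3 : 0 ≤ (a - b) / a := div_nonneg (by linarith) ha.le
    rw [h2] at hbern
    nlinarith
  calc (B ^ (-(1 + α)) - A ^ (-(1 + α))) * b
      = B ^ (-(1 + α)) * ((1 - (B / A) ^ (1 + α)) * b) := by rw [hdiv]; ring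
    _ ≤ B ^ (-(1 + α)) * (3 * ((a - b) / a) * b) := by gcongr
    _ = B ^ (-(1 + α)) * (3 * (a - b) * (b / a)) := by ring
    _ ≤ b ^ (-(2 + 2 * α)) * (3 * (a - b) * 1) := by
        have : 0 ≤ a - b := by linarith
        gcongr
        rw [div_le_one ha]; exact hab
    _ = _ := by ring

/-- Integrating the derivative along the segment from y to x would fail, because the segment may
pass close to the origin. Instead the rotated vector and the radial profile are varied one after the
other. The bound is uniform in ε. -/
theorem norm_kernel_sub_le {α : ℝ} (hα : 0 < α) (hα' : α < 1 / 2) (ε : ℝ) {m : ℝ} (hm : 0 < m)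
    {x y : Plane} (hx : m ≤ ‖x‖) (hy : m ≤ ‖y‖) :
    ‖kernel α ε x - kernel α ε y‖ ≤ 4 * ‖x - y‖ * m ^ (-(2 + 2 * α)) := by
  wlog hxy : ‖y‖ ≤ ‖x‖ generalizing x y
  · rw [norm_sub_rev, norm_sub_rev x y]
    exact this hy hx (le_of_not_ge hxy)
  have hy0 : 0 < ‖y‖ := hm.trans_le hy
  have key : kernel α ε x - kernel α ε y = (‖x‖ ^ 2 + ε ^ 2) ^ (-(1 + α)) • perp (x - y) +
      ((‖x‖ ^ 2 + ε ^ 2) ^ (-(1 + α)) - (‖y‖ ^ 2 + ε ^ 2) ^ (-(1 + α))) • perp y := by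
    rw [kernel, kernel, perp_sub]; module
  rw [key]
  calc _ ≤ (‖x‖ ^ 2 + ε ^ 2) ^ (-(1 + α)) * ‖x - y‖ +
      |(‖x‖ ^ 2 + ε ^ 2) ^ (-(1 + α)) - (‖y‖ ^ 2 + ε ^ 2) ^ (-(1 + α))| * ‖y‖ := by
        refine (norm_add_le _ _).trans ?_
        rw [norm_smul, norm_smul, norm_perp, norm_perp, Real.norm_eq_abs, Real.norm_eq_abs,
          abs_of_nonneg (by positivity : 0 ≤ (‖x‖ ^ 2 + ε ^ 2) ^ (-(1 + α)))]
    _ ≤ ‖y‖ ^ (-(2 + 2 * α)) * ‖x - y‖ + 3 * (‖x‖ - ‖y‖) * ‖y‖ ^ (-(2 + 2 * α)) := by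
        refine add_le_add ?_ (profile_sub_le hα hα' ε hy0 hxy)
        gcongr
        exact profile_le hα ε hy0 hxy
    _ ≤ ‖y‖ ^ (-(2 + 2 * α)) * ‖x - y‖ + 3 * ‖x - y‖ * ‖y‖ ^ (-(2 + 2 * α)) := by
        gcongr; exact norm_sub_norm_le x y
    _ = 4 * ‖x - y‖ * ‖y‖ ^ (-(2 + 2 * α)) := by ring
    _ ≤ 4 * ‖x - y‖ * m ^ (-(2 + 2 * α)) := by
        gcongr 4 * ‖x - y‖ * ?_
        exact Real.rpow_le_rpow_of_nonpos hm hy (by linarith)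

/-! ### Integrals of powers of the distance -/

theorem volume_real_unitBall : (volume : Measure Plane).real (Metric.ball 0 1) = Real.pi := by
  rw [measureReal_def, EuclideanSpace.volume_ball_fin_two]; simp [Real.pi_pos.le]

theorem lintegral_fun_norm {f : ℝ → ℝ} (hf : ∀ r, 0 < r → 0 ≤ f r)
    (hi : IntegrableOn (fun r => r * f r) (Ioi 0)) :
    ∫⁻ x : Plane, ENNReal.ofReal (f ‖x‖) =
      ENNReal.ofReal (2 * Real.pi * ∫ r in Ioi (0 : ℝ), r * f r) := by
  have hint : Integrable (fun x : Plane => f ‖x‖) volume := by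
    rw [integrable_fun_norm_addHaar]
    simpa using hi
  have hne : ∀ᵐ x : Plane, x ≠ 0 := by
    simp [ae_iff]
  rw [← ofReal_integral_eq_lintegral_ofReal hint, integral_fun_norm_addHaar, volume_real_unitBall]
  · congr 1; simp [mul_assoc]
  · filter_upwards [hne] with x hx
    exact hf _ (norm_pos_iff.2 hx)

/-- Polar coordinates. This is where α < 1/2 enters: the singularity of the kernel is integrable. -/
theorem lintegral_ball_norm_rpow {α : ℝ} (hα' : α < 1 / 2) {r : ℝ} (hr : 0 < r) :
    ∫⁻ x in Metric.ball (0 : Plane) r, ENNReal.ofReal (‖x‖ ^ (-(1 + 2 * α))) =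
      ENNReal.ofReal (2 * Real.pi / (1 - 2 * α) * r ^ (1 - 2 * α)) := by
  have hmul : ∀ s : ℝ, 0 < s → s * s ^ (-(1 + 2 * α)) = s ^ (-(2 * α)) := fun s hs => by
    nth_rewrite 1 [← Real.rpow_one s]
    rw [← Real.rpow_add hs]; ring_nf
  have h1 : EqOn (fun s => s * (Iio r).indicator (fun s => s ^ (-(1 + 2 * α))) s)
      ((Ioo 0 r).indicator fun s => s ^ (-(2 * α))) (Ioi 0) := fun s (hs : 0 < s) => by
    by_cases h : s < r
    · simpa [indicator, hs, h] using hmul s hs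
    · simp [indicator, h]
  have h2 : IntegrableOn (fun s : ℝ => s ^ (-(2 * α))) (Ioo 0 r) := by
    have := (intervalIntegral.intervalIntegrable_rpow' (a := 0) (b := r)
      (r := -(2 * α)) (by linarith)).1
    exact this.mono_set Ioo_subset_Ioc_self
  have h3 : IntegrableOn ((Ioo 0 r).indicator fun s : ℝ => s ^ (-(2 * α))) (Ioi 0) :=
    ((integrable_indicator_iff measurableSet_Ioo).2 h2).integrableOn
  rw [← lintegral_indicator measurableSet_ball]
  have h4 := lintegral_fun_norm (f := (Iio r).indicator fun s => s ^ (-(1 + 2 * α)))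
    (fun s hs => indicator_apply_nonneg fun _ => by positivity) (h3.congr_fun h1.symm measurableSet_Ioi)
  rw [setIntegral_congr_fun measurableSet_Ioi h1, setIntegral_indicator measurableSet_Ioo,
    inter_eq_right.2 (fun s hs => hs.1), ← integral_Ioc_eq_integral_Ioo,
    ← intervalIntegral.integral_of_le hr.le, integral_rpow (Or.inl (by linarith))] at h4
  convert h4 using 1
  · refine lintegral_congr fun x => ?_
    by_cases h : ‖x‖ < r <;> simp [indicator, h]
  · congr 1
    rw [Real.zero_rpow (by linarith)]
    ring_nf

theorem lintegral_norm_rpow_ge {α : ℝ} (hα : 0 < α) {r : ℝ} (hr : 0 < r) :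
    ∫⁻ x in {x : Plane | r ≤ ‖x‖}, ENNReal.ofReal (‖x‖ ^ (-(2 + 2 * α))) =
      ENNReal.ofReal (Real.pi / α * r ^ (-(2 * α))) := by
  have hmul : ∀ s : ℝ, 0 < s → s * s ^ (-(2 + 2 * α)) = s ^ (-(1 + 2 * α)) := fun s hs => by
    nth_rewrite 1 [← Real.rpow_one s]
    rw [← Real.rpow_add hs]; ring_nf
  have h1 : EqOn (fun s => s * (Ici r).indicator (fun s => s ^ (-(2 + 2 * α))) s)
      ((Ici r).indicator fun s => s ^ (-(1 + 2 * α))) (Ioi 0) := fun s (hs : 0 < s) => by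
    by_cases h : r ≤ s
    · simpa [indicator, h] using hmul s hs
    · simp [indicator, h]
  have h2 : IntegrableOn (fun s : ℝ => s ^ (-(1 + 2 * α))) (Ici r) := by
    rw [integrableOn_Ici_iff_integrableOn_Ioi]
    exact integrableOn_Ioi_rpow_of_lt (by linarith) hr
  have h3 : IntegrableOn ((Ici r).indicator fun s : ℝ => s ^ (-(1 + 2 * α))) (Ioi 0) :=
    ((integrable_indicator_iff measurableSet_Ici).2 h2).integrableOn
  have hmeas : MeasurableSet {x : Plane | r ≤ ‖x‖} := measurableSet_le measurable_const measurable_norm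
  rw [← lintegral_indicator hmeas]
  have h4 := lintegral_fun_norm (f := (Ici r).indicator fun s => s ^ (-(2 + 2 * α)))
    (fun s hs => indicator_apply_nonneg fun _ => by positivity) (h3.congr_fun h1.symm measurableSet_Ioi)
  rw [setIntegral_congr_fun measurableSet_Ioi h1, setIntegral_indicator measurableSet_Ici,
    inter_eq_right.2 (Ici_subset_Ioi.2 hr), integral_Ici_eq_integral_Ioi,
    integral_Ioi_rpow_of_lt (by linarith) hr] at h4
  convert h4 using 1
  · refine lintegral_congr fun x => ?_
    by_cases h : r ≤ ‖x‖ <;> simp [indicator, h]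
  · congr 1
    rw [show -(1 + 2 * α) + 1 = -(2 * α) by ring]
    field_simp

/-! ### Cancellation in the kernel -/

theorem integrable_indicator_ball_norm_rpow {α : ℝ} (hα' : α < 1 / 2) {r : ℝ} (hr : 0 < r) :
    Integrable ((Metric.ball (0 : Plane) r).indicator fun x => ‖x‖ ^ (-(1 + 2 * α))) := by
  rw [integrable_indicator_iff measurableSet_ball, IntegrableOn,
    ← lintegral_ofReal_ne_top_iff_integrable (by
      have := measurable_norm (α := Plane)
      exact (this.pow_const _).aestronglyMeasurable) (ae_of_all _ fun x => by positivity),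
    lintegral_ball_norm_rpow hα' hr]
  exact ENNReal.ofReal_ne_top

theorem integrable_indicator_norm_rpow_ge {α : ℝ} (hα : 0 < α) {r : ℝ} (hr : 0 < r) :
    Integrable ({x : Plane | r ≤ ‖x‖}.indicator fun x => ‖x‖ ^ (-(2 + 2 * α))) := by
  rw [integrable_indicator_iff (measurableSet_le measurable_const measurable_norm), IntegrableOn,
    ← lintegral_ofReal_ne_top_iff_integrable (by
      have := measurable_norm (α := Plane)
      exact (this.pow_const _).aestronglyMeasurable) (ae_of_all _ fun x => by positivity),
    lintegral_norm_rpow_ge hα hr]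
  exact ENNReal.ofReal_ne_top

theorem integrable_indicator_ball_kernel {α : ℝ} (hα : 0 < α) (hα' : α < 1 / 2) (ε : ℝ) {r : ℝ}
    (hr : 0 < r) : Integrable ((Metric.ball (0 : Plane) r).indicator (kernel α ε)) := by
  refine (integrable_indicator_ball_norm_rpow hα' hr).mono'
    ((measurable_kernel α ε).indicator measurableSet_ball).aestronglyMeasurable
    (ae_of_all _ fun x => ?_)
  rw [norm_indicator_eq_indicator_norm]
  exact indicator_le_indicator (norm_kernel_le hα ε x)

theorem integral_indicator_ball_kernel (α ε r : ℝ) :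
    ∫ x, (Metric.ball (0 : Plane) r).indicator (kernel α ε) x = 0 := by
  have h := integral_neg_eq_self ((Metric.ball (0 : Plane) r).indicator (kernel α ε)) volume
  have h2 : ∀ x, (Metric.ball (0 : Plane) r).indicator (kernel α ε) (-x) =
      -(Metric.ball (0 : Plane) r).indicator (kernel α ε) x := fun x => by
    by_cases hx : ‖x‖ < r <;> simp [indicator, hx, kernel_neg]
  simp_rw [h2, integral_neg] at h
  have h3 : (2 : ℝ) • (∫ x, (Metric.ball (0 : Plane) r).indicator (kernel α ε) x) = 0 := by
    rw [two_smul]; nth_rewrite 1 [← h]; exact neg_add_cancel _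
  exact (smul_eq_zero.1 h3).resolve_left two_ne_zero

theorem integral_indicator_ball_kernel_comp {α : ℝ} (hα : 0 < α) (hα' : α < 1 / 2) (ε : ℝ)
    {a : Plane → Plane} (ha : MeasurePreserving a) {r : ℝ} (hr : 0 < r) :
    ∫ y, (a ⁻¹' Metric.ball (0 : Plane) r).indicator (fun y => kernel α ε (a y)) y = 0 := by
  have h := integrable_indicator_ball_kernel hα hα' ε hr
  have h2 := integral_map (μ := volume) ha.measurable.aemeasurable
    (f := (Metric.ball (0 : Plane) r).indicator (kernel α ε))
    (by rw [ha.map_eq]; exact h.aestronglyMeasurable)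
  rw [ha.map_eq, integral_indicator_ball_kernel] at h2
  exact h2.symm

/-- Neither kernel need be integrable at infinity, but their difference gains one power of decay
there. Near the singularities each kernel is integrable by itself, since a and b preserve measure.
-/
theorem integrable_kernel_sub {α : ℝ} (hα : 0 < α) (hα' : α < 1 / 2) (ε : ℝ) {a b : Plane → Plane}
    (ha : MeasurePreserving a) (hb : MeasurePreserving b) {A : ℝ} (hab : ∀ y, ‖a y - b y‖ ≤ A) :
    Integrable fun y => kernel α ε (a y) - kernel α ε (b y) := by
  have hA : 0 ≤ A := (norm_nonneg _).trans (hab 0)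
  have hR : 0 < 2 * A + 1 := by positivity
  have h1 := ha.integrable_comp_of_integrable (integrable_indicator_ball_norm_rpow hα' hR)
  have h2 := hb.integrable_comp_of_integrable
    (integrable_indicator_ball_norm_rpow hα' (by positivity : 0 < 3 * A + 1))
  have h3 := ha.integrable_comp_of_integrable (integrable_indicator_norm_rpow_ge hα hR)
  refine ((h1.add h2).add (h3.const_mul (32 * A))).mono'
    (((measurable_kernel α ε).comp ha.measurable).sub
      ((measurable_kernel α ε).comp hb.measurable)).aestronglyMeasurable (ae_of_all _ fun y => ?_)
  have hbn : ‖b y‖ ≤ ‖a y‖ + A := by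
    have := norm_sub_norm_le (b y) (a y)
    rw [norm_sub_rev] at this
    linarith [hab y]
  have han : ‖a y‖ ≤ ‖b y‖ + A := by
    have := norm_sub_norm_le (a y) (b y)
    linarith [hab y]
  by_cases h : ‖a y‖ < 2 * A + 1
  · have h' : ‖b y‖ < 3 * A + 1 := by linarith
    simp only [Pi.add_apply, Function.comp_apply, indicator, Metric.mem_ball, dist_zero_right, h, h',
      if_true, mem_ofPred_eq, not_le.2 h, if_false, mul_zero, add_zero]
    exact (norm_sub_le _ _).trans (add_le_add (norm_kernel_le hα ε _) (norm_kernel_le hα ε _))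
  · have h' : 2 * A + 1 ≤ ‖a y‖ := not_lt.1 h
    have hpos : 0 < ‖a y‖ := by linarith
    have hk := norm_kernel_sub_le hα hα' ε (m := ‖a y‖ / 2) (x := a y) (y := b y) (by linarith)
      (by linarith) (by linarith)
    have h8 : (‖a y‖ / 2) ^ (-(2 + 2 * α)) ≤ 8 * ‖a y‖ ^ (-(2 + 2 * α)) := by
      rw [Real.div_rpow hpos.le (by norm_num), Real.rpow_neg zero_le_two, div_inv_eq_mul, mul_comm]
      gcongr
      calc (2 : ℝ) ^ (2 + 2 * α) ≤ 2 ^ (3 : ℝ) :=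
            Real.rpow_le_rpow_of_exponent_le (by norm_num) (by linarith)
        _ = 8 := by norm_num
    simp only [Pi.add_apply, Function.comp_apply, indicator, mem_ofPred_eq, h', if_true]
    calc _ ≤ 4 * ‖a y - b y‖ * (‖a y‖ / 2) ^ (-(2 + 2 * α)) := hk
      _ ≤ 4 * A * (8 * ‖a y‖ ^ (-(2 + 2 * α))) := by gcongr; exact hab y
      _ = 32 * A * ‖a y‖ ^ (-(2 + 2 * α)) := by ring
      _ ≤ _ := by
        have := hA
        apply le_add_of_nonneg_left
        apply add_nonneg <;> split_ifs <;> positivity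

theorem lintegral_annulus_kernel_le {α : ℝ} (hα : 0 < α) (ε : ℝ) {A r : ℝ}
    (hA : 0 ≤ A) (hr : A < r) :
    ∫⁻ x in Metric.ball (0 : Plane) (r + A) \ Metric.ball 0 (r - A), ‖kernel α ε x‖ₑ ≤
      ENNReal.ofReal ((r - A) ^ (-(1 + 2 * α)) * (4 * Real.pi * A * r)) := by
  have hrA : 0 < r - A := by linarith
  have hvol : volume (Metric.ball (0 : Plane) (r + A) \ Metric.ball 0 (r - A)) =
      ENNReal.ofReal (4 * Real.pi * A * r) := by
    rw [measure_sdiff (Metric.ball_subset_ball (by linarith)) measurableSet_ball.nullMeasurableSet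
      measure_ball_lt_top.ne, EuclideanSpace.volume_ball_fin_two,
      EuclideanSpace.volume_ball_fin_two, ← ENNReal.ofReal_pow (by linarith),
      ← ENNReal.ofReal_pow (by linarith)]
    rw [← ENNReal.ofReal_mul (by positivity), ← ENNReal.ofReal_mul (by positivity),
      ← ENNReal.ofReal_sub _ (by positivity)]
    congr 1; ring
  calc _ ≤ ∫⁻ x in Metric.ball (0 : Plane) (r + A) \ Metric.ball 0 (r - A),
        ENNReal.ofReal ((r - A) ^ (-(1 + 2 * α))) := by
        refine setLIntegral_mono' (measurableSet_ball.diff measurableSet_ball) fun x hx => ?_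
        have hx' : r - A ≤ ‖x‖ := by simpa using hx.2
        rw [← ofReal_norm]
        refine ENNReal.ofReal_le_ofReal ((norm_kernel_le hα ε x).trans ?_)
        exact Real.rpow_le_rpow_of_nonpos hrA hx' (by linarith)
    _ = _ := by
        rw [setLIntegral_const, hvol, ← ENNReal.ofReal_mul (by positivity)]

theorem tendsto_annulus_bound {α : ℝ} (hα : 0 < α) (A : ℝ) :
    Tendsto (fun n : ℕ => ENNReal.ofReal
      (((n : ℝ) - A) ^ (-(1 + 2 * α)) * (4 * Real.pi * A * n))) atTop (𝓝 0) := by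
  have h0 : Tendsto (fun n : ℕ => (n : ℝ) - A) atTop atTop :=
    tendsto_atTop_add_const_right _ _ tendsto_natCast_atTop_atTop
  have h1 : Tendsto (fun s : ℝ => s ^ (-(1 + 2 * α)) * (4 * Real.pi * A * (s + A))) atTop (𝓝 0) := by
    have e1 := (tendsto_rpow_neg_atTop (y := 2 * α) (by linarith)).const_mul (4 * Real.pi * A)
    have e2 := (tendsto_rpow_neg_atTop (y := 1 + 2 * α) (by linarith)).const_mul
      (4 * Real.pi * A * A)
    have e3 := e1.add e2
    simp only [mul_zero, add_zero] at e3
    refine e3.congr' ?_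
    filter_upwards [eventually_gt_atTop 0] with s hs
    rw [show -(1 + 2 * α) = -(2 * α) - 1 by ring, Real.rpow_sub_one hs.ne']
    field_simp
  have h2 := h1.comp h0
  simp only [Function.comp_def, sub_add_cancel] at h2
  have h3 := (ENNReal.continuous_ofReal.tendsto 0).comp h2
  rwa [ENNReal.ofReal_zero] at h3

/-- An odd kernel has integral zero over balls centred at the origin, so K∘a and K∘b have integral
zero over the preimages under a and b of the ball of radius n. These preimages differ only inside
the preimage under b of an annulus of area O(n), where the kernel is O(n^{-1-2α}), so the
discrepancy is O(n^{-2α}). -/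
theorem integral_kernel_sub {α : ℝ} (hα : 0 < α) (hα' : α < 1 / 2) (ε : ℝ) {a b : Plane → Plane}
    (ha : MeasurePreserving a) (hb : MeasurePreserving b) {A : ℝ} (hab : ∀ y, ‖a y - b y‖ ≤ A) :
    ∫ y, (kernel α ε (a y) - kernel α ε (b y)) = 0 := by
  have hA : 0 ≤ A := (norm_nonneg _).trans (hab 0)
  have hint := integrable_kernel_sub hα hα' ε ha hb hab
  have hmeas : ∀ r : ℝ, MeasurableSet (a ⁻¹' Metric.ball 0 r) := fun r =>
    ha.measurable measurableSet_ball
  have hmeasb : ∀ r : ℝ, MeasurableSet (b ⁻¹' Metric.ball 0 r) := fun r =>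
    hb.measurable measurableSet_ball
  set B : ℕ → Set Plane := fun n => Metric.ball 0 (n : ℝ)
  have hlim : Tendsto (fun n : ℕ => ∫ y in a ⁻¹' B n, (kernel α ε (a y) - kernel α ε (b y)))
      atTop (𝓝 (∫ y, (kernel α ε (a y) - kernel α ε (b y)))) := by
    have hcover : AECover volume atTop fun n => a ⁻¹' B n := by
      refine ⟨ae_of_all _ fun y => ?_, fun n => hmeas n⟩
      filter_upwards [tendsto_natCast_atTop_atTop.eventually_gt_atTop ‖a y‖] with n hn
      simpa [B] using hn
    exact hcover.integral_tendsto_of_countably_generated hint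
  have hzero : Tendsto (fun n : ℕ => ∫ y in a ⁻¹' B n, (kernel α ε (a y) - kernel α ε (b y)))
      atTop (𝓝 0) := by
    rw [tendsto_zero_iff_enorm_tendsto_zero]
    refine tendsto_of_tendsto_of_tendsto_of_le_of_le' tendsto_const_nhds
      (tendsto_annulus_bound hα A) (Eventually.of_forall fun _ => zero_le) ?_
    have hev : ∀ᶠ n : ℕ in atTop, A < n := tendsto_natCast_atTop_atTop.eventually_gt_atTop A
    filter_upwards [hev] with n hn
    have hn0 : (0 : ℝ) < n := hA.trans_lt hn
    have ia : IntegrableOn (fun y => kernel α ε (a y)) (a ⁻¹' B n) := by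
      rw [← integrable_indicator_iff (hmeas n)]
      exact ha.integrable_comp_of_integrable (integrable_indicator_ball_kernel hα hα' ε hn0)
    have ib : ∀ r : ℝ, 0 < r → IntegrableOn (fun y => kernel α ε (b y)) (b ⁻¹' Metric.ball 0 r) := by
      intro r hr
      rw [← integrable_indicator_iff (hmeasb r)]
      exact hb.integrable_comp_of_integrable (integrable_indicator_ball_kernel hα hα' ε hr)
    have za : ∫ y in a ⁻¹' B n, kernel α ε (a y) = 0 := by
      rw [← integral_indicator (hmeas n)]
      exact integral_indicator_ball_kernel_comp hα hα' ε ha hn0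
    have zb : ∫ y in b ⁻¹' B n, kernel α ε (b y) = 0 := by
      rw [← integral_indicator (hmeasb n)]
      exact integral_indicator_ball_kernel_comp hα hα' ε hb hn0
    have hsub : IntegrableOn (fun y => kernel α ε (b y)) (a ⁻¹' B n) := by
      refine (ia.sub hint.integrableOn).congr (ae_of_all _ fun y => ?_)
      simp
    -- The vanishing integral of K∘b over the preimage under b is put back in, so that only the part
    -- over the symmetric difference of the two preimages remains.
    rw [integral_sub ia hsub, za, zero_sub, enorm_neg, ← sub_zero (∫ y in a ⁻¹' B n, _), ← zb,
      ← integral_indicator (hmeas n), ← integral_indicator (hmeasb n), ← integral_sub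
        ((integrable_indicator_iff (hmeas n)).2 hsub)
        ((integrable_indicator_iff (hmeasb n)).2 (ib n hn0))]
    refine (enorm_integral_le_lintegral_enorm _).trans ?_
    refine le_trans ?_ (lintegral_annulus_kernel_le hα ε hA hn)
    rw [← lintegral_indicator (measurableSet_ball.diff measurableSet_ball),
      ← hb.lintegral_comp ((measurable_kernel α ε).enorm.indicator
        (measurableSet_ball.diff measurableSet_ball))]
    refine lintegral_mono fun y => ?_
    have hbn : ‖b y‖ ≤ ‖a y‖ + A := by
      have := norm_sub_norm_le (b y) (a y)
      rw [norm_sub_rev] at this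
      linarith [hab y]
    have han : ‖a y‖ ≤ ‖b y‖ + A := by
      have := norm_sub_norm_le (a y) (b y)
      linarith [hab y]
    by_cases h1 : ‖a y‖ < n <;> by_cases h2 : ‖b y‖ < n
    · simp [indicator, h1, h2]
    · have h3 : ‖b y‖ < n + A := by linarith
      have h4 : (n : ℝ) - A ≤ ‖b y‖ := by linarith
      simp [indicator, h1, h2, h3, h4]
    · have h3 : ‖b y‖ < n + A := by linarith
      have h4 : (n : ℝ) - A ≤ ‖b y‖ := by linarith
      simp [indicator, h1, h2, h3, h4]
    · simp [indicator, h1, h2]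
  exact tendsto_nhds_unique hlim hzero

/-! ### The velocity generated by a transported density -/

/-- `∫ θ(y) K_ε(p - P(y)) dy`. -/
noncomputable def kernelIntegral (α ε : ℝ) (θ : Plane → ℝ) (P : Plane → Plane) (p : Plane) : Plane :=
  ∫ y, θ y • kernel α ε (p - P y)

theorem measurePreserving_sub {P : Plane → Plane} (hP : MeasurePreserving P) (p : Plane) :
    MeasurePreserving fun y => p - P y :=
  (Measure.measurePreserving_sub_left volume p).comp hP

theorem norm_smul_kernel_le {α : ℝ} (hα : 0 < α) (ε : ℝ) {t A : ℝ} (ht : |t| ≤ A) (w : Plane) :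
    ‖t • kernel α ε w‖ ≤
      A * (Metric.ball (0 : Plane) 1).indicator (fun x => ‖x‖ ^ (-(1 + 2 * α))) w + |t| := by
  have hA : 0 ≤ A := (abs_nonneg t).trans ht
  rw [norm_smul, Real.norm_eq_abs]
  by_cases h : ‖w‖ < 1
  · simp only [indicator, Metric.mem_ball, dist_zero_right, h, if_true]
    have := mul_le_mul ht (norm_kernel_le hα ε w) (norm_nonneg _) hA
    linarith [abs_nonneg t]
  · simp only [indicator, Metric.mem_ball, dist_zero_right, h, if_false, mul_zero, zero_add]
    have h1 : ‖kernel α ε w‖ ≤ 1 := by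
      refine (norm_kernel_le hα ε w).trans ?_
      exact Real.rpow_le_one_of_one_le_of_nonpos (not_lt.1 h) (by linarith)
    nlinarith [abs_nonneg t]

section

variable {α : ℝ} {θ : Plane → ℝ}

theorem integrable_smul_kernel (hα : 0 < α) (hα' : α < 1 / 2) (ε : ℝ) (hθ : Integrable θ) {A : ℝ}
    (hA : ∀ y, |θ y| ≤ A) {a : Plane → Plane} (ha : MeasurePreserving a) :
    Integrable fun y => θ y • kernel α ε (a y) := by
  have h1 := ha.integrable_comp_of_integrable
    (integrable_indicator_ball_norm_rpow hα' one_pos)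
  refine ((h1.const_mul A).add hθ.abs).mono' (hθ.aestronglyMeasurable.smul
    ((measurable_kernel α ε).comp ha.measurable).aestronglyMeasurable) (ae_of_all _ fun y => ?_)
  exact norm_smul_kernel_le hα ε (hA y) (a y)

theorem norm_kernelIntegral_le (hα : 0 < α) (hα' : α < 1 / 2) (ε : ℝ) (hθ : Integrable θ) {A : ℝ}
    (hA : ∀ y, |θ y| ≤ A) {P : Plane → Plane} (hP : MeasurePreserving P) (p : Plane) :
    ‖kernelIntegral α ε θ P p‖ ≤
      A * (∫ w, (Metric.ball (0 : Plane) 1).indicator (fun x => ‖x‖ ^ (-(1 + 2 * α))) w) +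
        ∫ y, |θ y| := by
  have ha := measurePreserving_sub hP p
  have h1 := integrable_indicator_ball_norm_rpow hα' one_pos
  have h2 : Integrable fun y =>
      (Metric.ball (0 : Plane) 1).indicator (fun x => ‖x‖ ^ (-(1 + 2 * α))) (p - P y) :=
    ha.integrable_comp_of_integrable h1
  have h3 : ∫ w, (Metric.ball (0 : Plane) 1).indicator (fun x => ‖x‖ ^ (-(1 + 2 * α))) w =
      ∫ y, (Metric.ball (0 : Plane) 1).indicator (fun x => ‖x‖ ^ (-(1 + 2 * α))) (p - P y) := by
    have := integral_map (μ := volume) ha.measurable.aemeasurable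
      (f := (Metric.ball (0 : Plane) 1).indicator fun x => ‖x‖ ^ (-(1 + 2 * α)))
      (by rw [ha.map_eq]; exact h1.aestronglyMeasurable)
    rwa [ha.map_eq] at this
  rw [h3, ← integral_const_mul, ← integral_add (h2.const_mul A) hθ.abs]
  exact norm_integral_le_of_norm_le ((h2.const_mul A).add hθ.abs)
    (ae_of_all _ fun y => norm_smul_kernel_le hα ε (hA y) (p - P y))

/-- By `integral_kernel_sub` any constant c may be subtracted from θ. Taking c = θ(x) produces the
integrand of the Dini seminorm. -/
theorem enorm_integral_smul_kernel_sub_le (hα : 0 < α) (hα' : α < 1 / 2) (ε : ℝ)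
    (hθ : Integrable θ) {A : ℝ} (hA : ∀ y, |θ y| ≤ A) {a b : Plane → Plane}
    (ha : MeasurePreserving a) (hb : MeasurePreserving b) {D : ℝ} (hab : ∀ y, ‖a y - b y‖ ≤ D)
    (c : ℝ) :
    ‖(∫ y, θ y • kernel α ε (a y)) - ∫ y, θ y • kernel α ε (b y)‖ₑ ≤
      ∫⁻ y, ‖c - θ y‖ₑ * ‖kernel α ε (a y) - kernel α ε (b y)‖ₑ := by
  have ia := integrable_smul_kernel hα hα' ε hθ hA ha
  have ib := integrable_smul_kernel hα hα' ε hθ hA hb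
  have h0 : (∫ y, θ y • kernel α ε (a y)) - ∫ y, θ y • kernel α ε (b y) =
      ∫ y, (θ y - c) • (kernel α ε (a y) - kernel α ε (b y)) := by
    have h1 := integral_kernel_sub hα hα' ε ha hb hab
    have h2 := integrable_kernel_sub hα hα' ε ha hb hab
    have h3 : ∫ y, c • (kernel α ε (a y) - kernel α ε (b y)) = 0 := by
      rw [integral_smul, h1, smul_zero]
    have h4 : Integrable fun y => c • (kernel α ε (a y) - kernel α ε (b y)) := h2.smul c
    have h5 : Integrable fun y => θ y • kernel α ε (a y) - θ y • kernel α ε (b y) := ia.sub ib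
    rw [← integral_sub ia ib, ← sub_zero (∫ y, _), ← h3, ← integral_sub h5 h4]
    congr 1; ext1 y; module
  rw [h0]
  refine (enorm_integral_le_lintegral_enorm _).trans (lintegral_mono fun y => ?_)
  rw [enorm_smul, ← neg_sub c (θ y), enorm_neg]

end

/-! ### The Dini seminorm -/

/-- `sup_x ∫ |θ(x) - θ(y)| / |x - y|^{2+2α} dy`. -/
noncomputable def dini (α : ℝ) (θ : Plane → ℝ) : ℝ≥0∞ :=
  ⨆ x, ∫⁻ y, ‖θ x - θ y‖ₑ * ENNReal.ofReal (‖x - y‖ ^ (-(2 + 2 * α)))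

theorem lintegral_le_dini (α : ℝ) (θ : Plane → ℝ) (x : Plane) :
    ∫⁻ y, ‖θ x - θ y‖ₑ * ENNReal.ofReal (‖x - y‖ ^ (-(2 + 2 * α))) ≤ dini α θ :=
  le_iSup (fun x => ∫⁻ y, ‖θ x - θ y‖ₑ * ENNReal.ofReal (‖x - y‖ ^ (-(2 + 2 * α)))) x

theorem two_rpow_le_eight {α : ℝ} (hα' : α < 1 / 2) : (2 : ℝ) ^ (2 + 2 * α) ≤ 8 := by
  calc (2 : ℝ) ^ (2 + 2 * α) ≤ 2 ^ (3 : ℝ) :=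
        Real.rpow_le_rpow_of_exponent_le (by norm_num) (by linarith)
    _ = 8 := by norm_num

section

variable {α : ℝ} {θ : Plane → ℝ}

/-- The arguments P x - P y and Q x - Q y differ by at most 2D and both have length at least |x -
y|/k, so the difference of the kernels is at most 8 D k^{2+2α} |x - y|^{-2-2α}. Comparing the flows
at the same label x is what lets θ(x) be subtracted in both. -/
theorem enorm_kernelIntegral_flow_sub_le (hα : 0 < α) (hα' : α < 1 / 2) (ε : ℝ)
    (hθ : Integrable θ) {A : ℝ} (hA : ∀ y, |θ y| ≤ A) {P Q : Plane → Plane}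
    (hP : MeasurePreserving P) (hQ : MeasurePreserving Q) {D : ℝ} (hD : ∀ y, ‖P y - Q y‖ ≤ D)
    {k : ℝ} (hk : 0 < k) (hPk : ∀ x y, ‖x - y‖ ≤ k * ‖P x - P y‖)
    (hQk : ∀ x y, ‖x - y‖ ≤ k * ‖Q x - Q y‖) (x : Plane) :
    ‖kernelIntegral α ε θ P (P x) - kernelIntegral α ε θ Q (Q x)‖ₑ ≤
      ENNReal.ofReal (8 * D * k ^ (2 + 2 * α)) * dini α θ := by
  have hD0 : 0 ≤ D := (norm_nonneg _).trans (hD 0)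
  have h2D : ∀ y, ‖(P x - P y) - (Q x - Q y)‖ ≤ 2 * D := fun y => by
    have := norm_sub_le (P x - Q x) (P y - Q y)
    rw [show (P x - P y) - (Q x - Q y) = (P x - Q x) - (P y - Q y) by abel]
    linarith [hD x, hD y]
  refine (enorm_integral_smul_kernel_sub_le hα hα' ε hθ hA (measurePreserving_sub hP (P x))
    (measurePreserving_sub hQ (Q x)) h2D (θ x)).trans ?_
  refine le_trans ?_ (mul_le_mul_right (lintegral_le_dini α θ x) _)
  rw [← lintegral_const_mul' _ _ ENNReal.ofReal_ne_top]
  refine lintegral_mono fun y => ?_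
  rcases eq_or_ne x y with rfl | hxy
  · simp
  rw [mul_left_comm, ← ENNReal.ofReal_mul (by positivity)]
  gcongr
  rw [← ofReal_norm]
  apply ENNReal.ofReal_le_ofReal
  have hpos : 0 < ‖x - y‖ := norm_pos_iff.2 (sub_ne_zero.2 hxy)
  calc _ ≤ 4 * ‖(P x - P y) - (Q x - Q y)‖ * (‖x - y‖ / k) ^ (-(2 + 2 * α)) :=
        norm_kernel_sub_le hα hα' ε (by positivity)
          (by rw [div_le_iff₀' hk]; exact hPk x y) (by rw [div_le_iff₀' hk]; exact hQk x y)
    _ ≤ 4 * (2 * D) * (‖x - y‖ / k) ^ (-(2 + 2 * α)) := by gcongr; exact h2D y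
    _ = _ := by
      rw [Real.div_rpow hpos.le hk.le, Real.rpow_neg hk.le, div_inv_eq_mul]; ring

theorem aemeasurable_dini_integrand (α : ℝ) (hθ : AEMeasurable θ) (x : Plane) :
    AEMeasurable fun y => ‖θ x - θ y‖ₑ * ENNReal.ofReal (‖x - y‖ ^ (-(2 + 2 * α))) := by
  have h : Measurable fun y : Plane => ENNReal.ofReal (‖x - y‖ ^ (-(2 + 2 * α))) :=
    (((measurable_const.sub measurable_id).norm).pow_const _).ennreal_ofReal
  exact (aemeasurable_const.sub hθ).enorm.mul h.aemeasurable

/-- Average |θ(x) - θ(x')| ≤ |θ(x) - θ(z)| + |θ(x') - θ(z)| over z in the ball of radius r = |x -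
x'| about x. All distances involved are at most 2r, so the weight of the Dini integral is at least
(2r)^{-2-2α}, while the ball has area at least r². -/
theorem enorm_sub_le_dini (hα : 0 < α) (hα' : α < 1 / 2) (hθ : AEMeasurable θ) (x x' : Plane) :
    ‖θ x - θ x'‖ₑ ≤ ENNReal.ofReal (16 * ‖x - x'‖ ^ (2 * α)) * dini α θ := by
  rcases eq_or_ne x x' with rfl | hxx
  · simp
  set r := ‖x - x'‖ with hr_def
  have hr : 0 < r := norm_pos_iff.2 (sub_ne_zero.2 hxx)
  have hpt : ∀ (w z : Plane), ‖w - z‖ ≤ 2 * r → ‖θ w - θ z‖ₑ ≤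
      ENNReal.ofReal ((2 * r) ^ (2 + 2 * α)) *
        (‖θ w - θ z‖ₑ * ENNReal.ofReal (‖w - z‖ ^ (-(2 + 2 * α)))) := fun w z hwz => by
    rcases eq_or_ne w z with rfl | hne
    · simp
    have hpos : 0 < ‖w - z‖ := norm_pos_iff.2 (sub_ne_zero.2 hne)
    rw [mul_left_comm, ← ENNReal.ofReal_mul (by positivity)]
    apply le_mul_of_one_le_right zero_le
    rw [← ENNReal.ofReal_one]
    apply ENNReal.ofReal_le_ofReal
    rw [Real.rpow_neg hpos.le, ← div_eq_mul_inv, one_le_div (by positivity)]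
    gcongr
  have hball : ENNReal.ofReal (r ^ 2) * ‖θ x - θ x'‖ₑ ≤
      ENNReal.ofReal ((2 * r) ^ (2 + 2 * α)) * (2 * dini α θ) := by
    calc ENNReal.ofReal (r ^ 2) * ‖θ x - θ x'‖ₑ
        ≤ ∫⁻ z in Metric.ball x r, ‖θ x - θ x'‖ₑ := by
          rw [setLIntegral_const, mul_comm, EuclideanSpace.volume_ball_fin_two,
            ← ENNReal.ofReal_pow hr.le]
          gcongr
          apply le_mul_of_one_le_right zero_le
          rw [← ENNReal.ofReal_one]
          exact ENNReal.ofReal_le_ofReal (by linarith [Real.pi_gt_three])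
      _ ≤ ∫⁻ z in Metric.ball x r, ENNReal.ofReal ((2 * r) ^ (2 + 2 * α)) *
            (‖θ x - θ z‖ₑ * ENNReal.ofReal (‖x - z‖ ^ (-(2 + 2 * α))) +
              ‖θ x' - θ z‖ₑ * ENNReal.ofReal (‖x' - z‖ ^ (-(2 + 2 * α)))) := by
          refine setLIntegral_mono' measurableSet_ball fun z hz => ?_
          have hz' : ‖x - z‖ < r := by rwa [Metric.mem_ball, dist_comm, dist_eq_norm] at hz
          have hz'' : ‖x' - z‖ ≤ 2 * r := by
            have := norm_sub_le_norm_sub_add_norm_sub x' x z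
            rw [norm_sub_rev x' x, ← hr_def] at this
            linarith
          rw [mul_add]
          refine le_trans ?_ (add_le_add (hpt x z (by linarith)) (hpt x' z hz''))
          rw [← enorm_neg (θ x' - θ z), ← sub_add_sub_cancel (θ x) (θ z) (θ x'), neg_sub]
          exact enorm_add_le _ _
      _ ≤ ∫⁻ z, ENNReal.ofReal ((2 * r) ^ (2 + 2 * α)) *
            (‖θ x - θ z‖ₑ * ENNReal.ofReal (‖x - z‖ ^ (-(2 + 2 * α))) +
              ‖θ x' - θ z‖ₑ * ENNReal.ofReal (‖x' - z‖ ^ (-(2 + 2 * α)))) :=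
          setLIntegral_le_lintegral _ _
      _ ≤ _ := by
          rw [lintegral_const_mul' _ _ ENNReal.ofReal_ne_top,
            lintegral_add_left' (aemeasurable_dini_integrand α hθ x), two_mul (dini α θ)]
          gcongr
          · exact lintegral_le_dini α θ x
          · exact lintegral_le_dini α θ x'
  have hr2 : (2 * r) ^ (2 + 2 * α) * 2 ≤ r ^ 2 * (16 * r ^ (2 * α)) := by
    rw [Real.mul_rpow zero_le_two hr.le, Real.rpow_add hr, Real.rpow_two]
    have := two_rpow_le_eight hα'
    have h0 : 0 ≤ r ^ 2 * r ^ (2 * α) := by positivity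
    nlinarith
  have hne : ENNReal.ofReal (r ^ 2) ≠ 0 := by simpa using hr.ne'
  rw [← ENNReal.mul_le_mul_iff_right hne ENNReal.ofReal_ne_top, ← mul_assoc,
    ← ENNReal.ofReal_mul (by positivity)]
  refine hball.trans ?_
  rw [← mul_assoc, show (2 : ℝ≥0∞) = ENNReal.ofReal 2 by simp, ← ENNReal.ofReal_mul (by positivity)]
  gcongr

/-- The constant in the Lipschitz bound for the velocity. -/
noncomputable def lipConst (α : ℝ) : ℝ := 34 + 64 * Real.pi / (1 - 2 * α)

theorem lipConst_pos (hα' : α < 1 / 2) : 0 < lipConst α := by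
  have : 0 < 1 - 2 * α := by linarith
  unfold lipConst; positivity

theorem rpow_neg_one_add (s : ℝ) (hs : 0 ≤ s) (hα : 0 < α) :
    s ^ (-(1 + 2 * α)) = s * s ^ (-(2 + 2 * α)) := by
  rcases hs.eq_or_lt with rfl | hs
  · rw [Real.zero_rpow (by linarith), zero_mul]
  · nth_rewrite 2 [← Real.rpow_one s]
    rw [← Real.rpow_add hs]; ring_nf

/-- Far from both points the kernels are compared with each other, near them each is estimated
alone. In the near region the singularity at x' is not compensated by θ(x) - θ(y). Hence θ(x') is
inserted, and the remainder θ(x) - θ(x') is paired with an integrable singularity. -/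
theorem enorm_kernel_sub_mul_le (hα : 0 < α) (hα' : α < 1 / 2) (ε : ℝ) (θ : Plane → ℝ)
    (x x' y : Plane) :
    ‖θ x - θ y‖ₑ * ‖kernel α ε (x - y) - kernel α ε (x' - y)‖ₑ ≤
      ENNReal.ofReal (32 * ‖x - x'‖) *
          (‖θ x - θ y‖ₑ * ENNReal.ofReal (‖x - y‖ ^ (-(2 + 2 * α)))) +
        ENNReal.ofReal (2 * ‖x - x'‖) *
          (‖θ x' - θ y‖ₑ * ENNReal.ofReal (‖x' - y‖ ^ (-(2 + 2 * α)))) +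
        ‖θ x - θ x'‖ₑ * (Metric.ball (0 : Plane) (2 * ‖x - x'‖)).indicator
          (fun w => ENNReal.ofReal (‖w‖ ^ (-(1 + 2 * α)))) (x' - y) := by
  set r := ‖x - x'‖ with hr_def
  have hr : 0 ≤ r := norm_nonneg _
  have htri : ‖x - y‖ ≤ r + ‖x' - y‖ := norm_sub_le_norm_sub_add_norm_sub x x' y
  have htri' : ‖x' - y‖ ≤ r + ‖x - y‖ := by
    have := norm_sub_le_norm_sub_add_norm_sub x' x y
    rwa [norm_sub_rev x' x] at this
  rw [← ofReal_norm (θ x - θ y), ← ofReal_norm (θ x' - θ y), ← ofReal_norm (θ x - θ x'),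
    ← ofReal_norm (kernel α ε (x - y) - _)]
  set p := ‖θ x - θ y‖
  set q := ‖θ x' - θ y‖
  set s := ‖θ x - θ x'‖
  have hpq : p ≤ s + q := norm_sub_le_norm_sub_add_norm_sub _ _ _
  by_cases h : ‖x' - y‖ < 2 * r
  · have e1 := norm_kernel_le hα ε (x - y)
    have e2 := norm_kernel_le hα ε (x' - y)
    have e3 := norm_sub_le (kernel α ε (x - y)) (kernel α ε (x' - y))
    rw [rpow_neg_one_add _ (norm_nonneg _) hα] at e1
    have hx2 := e2
    rw [rpow_neg_one_add _ (norm_nonneg _) hα] at hx2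
    have hmem : x' - y ∈ Metric.ball (0 : Plane) (2 * r) := by simpa using h
    rw [indicator_of_mem hmem, ← ENNReal.ofReal_mul (by positivity),
      ← ENNReal.ofReal_mul (by positivity), ← ENNReal.ofReal_mul (by positivity),
      ← ENNReal.ofReal_mul (by positivity), ← ENNReal.ofReal_mul (by positivity),
      ← ENNReal.ofReal_mul (by positivity), ← ENNReal.ofReal_add (by positivity) (by positivity),
      ← ENNReal.ofReal_add (by positivity) (by positivity)]
    apply ENNReal.ofReal_le_ofReal
    have hu : 0 ≤ ‖x - y‖ ^ (-(2 + 2 * α)) := by positivity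
    have hv : 0 ≤ ‖x' - y‖ ^ (-(2 + 2 * α)) := by positivity
    set u := ‖x - y‖ ^ (-(2 + 2 * α))
    set v := ‖x' - y‖ ^ (-(2 + 2 * α))
    have f1 : ‖kernel α ε (x - y)‖ ≤ 32 * r * u :=
      e1.trans (mul_le_mul_of_nonneg_right (by linarith) hu)
    have f2 : ‖kernel α ε (x' - y)‖ ≤ 2 * r * v :=
      hx2.trans (mul_le_mul_of_nonneg_right (by linarith) hv)
    have hp : 0 ≤ p := norm_nonneg _
    have hq : 0 ≤ q := norm_nonneg _
    have hs : 0 ≤ s := norm_nonneg _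
    calc p * ‖kernel α ε (x - y) - kernel α ε (x' - y)‖
        ≤ p * (‖kernel α ε (x - y)‖ + ‖kernel α ε (x' - y)‖) := by gcongr
      _ ≤ p * ‖kernel α ε (x - y)‖ + (s + q) * ‖kernel α ε (x' - y)‖ := by
          rw [mul_add]; gcongr
      _ = p * ‖kernel α ε (x - y)‖ + q * ‖kernel α ε (x' - y)‖ +
          s * ‖kernel α ε (x' - y)‖ := by ring
      _ ≤ p * (32 * r * u) + q * (2 * r * v) + s * ‖x' - y‖ ^ (-(1 + 2 * α)) := by gcongr
      _ = _ := by ring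
  · have h' : 2 * r ≤ ‖x' - y‖ := not_lt.1 h
    refine le_add_right (le_add_right ?_)
    rw [← ENNReal.ofReal_mul (by positivity), ← ENNReal.ofReal_mul (by positivity),
      ← ENNReal.ofReal_mul (by positivity)]
    apply ENNReal.ofReal_le_ofReal
    rcases (norm_nonneg (x - y)).eq_or_lt with h0 | hpos
    -- If y = x then |x' - y| ≤ r, which is compatible with 2r ≤ |x' - y| only for r = 0.
    · have : r = 0 := by linarith
      have hxx : x = x' := sub_eq_zero.1 (norm_eq_zero.1 this)
      subst hxx
      simp only [sub_self, norm_zero, mul_zero]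
      positivity
    have hk := norm_kernel_sub_le hα hα' ε (m := ‖x - y‖ / 2) (x := x - y) (y := x' - y)
      (by linarith) (by linarith) (by linarith)
    rw [sub_sub_sub_cancel_right, ← hr_def, Real.div_rpow hpos.le zero_le_two,
      Real.rpow_neg zero_le_two, div_inv_eq_mul] at hk
    have h8 := two_rpow_le_eight hα'
    calc p * ‖kernel α ε (x - y) - kernel α ε (x' - y)‖
        ≤ p * (4 * r * (‖x - y‖ ^ (-(2 + 2 * α)) * 8)) := by
          gcongr p * ?_
          exact hk.trans (by gcongr)
      _ = _ := by ring

/-- Two of the three terms of the pointwise bound are Dini integrals. In the third the Hölder factor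
r^{2α} from `enorm_sub_le_dini` exactly makes up for the integral of the singularity over a ball, of
order r^{1-2α}, so the result is Lipschitz with no logarithmic loss. -/
theorem enorm_kernelIntegral_sub_le (hα : 0 < α) (hα' : α < 1 / 2) (ε : ℝ)
    (hθ : Integrable θ) {A : ℝ} (hA : ∀ y, |θ y| ≤ A) (x x' : Plane) :
    ‖kernelIntegral α ε θ id x - kernelIntegral α ε θ id x'‖ₑ ≤
      ENNReal.ofReal (lipConst α * ‖x - x'‖) * dini α θ := by
  rcases eq_or_ne x x' with rfl | hxx
  · simp
  set r := ‖x - x'‖ with hr_def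
  have hr : 0 < r := norm_pos_iff.2 (sub_ne_zero.2 hxx)
  have hid := MeasurePreserving.id (volume : Measure Plane)
  refine (enorm_integral_smul_kernel_sub_le hα hα' ε hθ hA (measurePreserving_sub hid x)
    (measurePreserving_sub hid x') (D := r) (fun y => by simp [hr_def]) (θ x)).trans ?_
  refine (lintegral_mono fun y => enorm_kernel_sub_mul_le hα hα' ε θ x x' y).trans ?_
  have hm := aemeasurable_dini_integrand α hθ.aemeasurable
  have hm2 : AEMeasurable fun y =>
      ENNReal.ofReal (32 * ‖x - x'‖) *
          (‖θ x - θ y‖ₑ * ENNReal.ofReal (‖x - y‖ ^ (-(2 + 2 * α)))) +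
        ENNReal.ofReal (2 * ‖x - x'‖) *
          (‖θ x' - θ y‖ₑ * ENNReal.ofReal (‖x' - y‖ ^ (-(2 + 2 * α)))) :=
    ((hm x).const_mul _).add ((hm x').const_mul _)
  rw [lintegral_add_left' hm2,
    lintegral_add_left' ((hm x).const_mul _), lintegral_const_mul' _ _ ENNReal.ofReal_ne_top,
    lintegral_const_mul' _ _ ENNReal.ofReal_ne_top, lintegral_const_mul' _ _ enorm_ne_top,
    lintegral_sub_left_eq_self (μ := volume) (fun w : Plane => (Metric.ball (0 : Plane) (2 * ‖x - x'‖)).indicator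
      (fun w => ENNReal.ofReal (‖w‖ ^ (-(1 + 2 * α)))) w) x',
    lintegral_indicator measurableSet_ball, ← hr_def,
    lintegral_ball_norm_rpow hα' (by positivity)]
  have h12 : 0 < 1 - 2 * α := by linarith
  calc _ ≤ ENNReal.ofReal (32 * r) * dini α θ + ENNReal.ofReal (2 * r) * dini α θ +
        ENNReal.ofReal (16 * r ^ (2 * α)) * dini α θ *
          ENNReal.ofReal (2 * Real.pi / (1 - 2 * α) * (2 * r) ^ (1 - 2 * α)) := by
        gcongr
        · exact lintegral_le_dini α θ x
        · exact lintegral_le_dini α θ x'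
        · exact enorm_sub_le_dini hα hα' hθ.aemeasurable x x'
    _ = ENNReal.ofReal (32 * r + 2 * r + 16 * r ^ (2 * α) *
          (2 * Real.pi / (1 - 2 * α) * (2 * r) ^ (1 - 2 * α))) * dini α θ := by
        rw [mul_right_comm, ← ENNReal.ofReal_mul (by positivity), ← add_mul, ← add_mul,
          ← ENNReal.ofReal_add (by positivity) (by positivity),
          ← ENNReal.ofReal_add (by positivity) (by positivity)]
    _ ≤ _ := by
        gcongr
        have h1 : r ^ (2 * α) * (2 * r) ^ (1 - 2 * α) ≤ 2 * r := by
          have h2 : r ^ (2 * α) ≤ (2 * r) ^ (2 * α) := by gcongr; linarith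
          calc _ ≤ (2 * r) ^ (2 * α) * (2 * r) ^ (1 - 2 * α) := by gcongr
            _ = 2 * r := by
              rw [← Real.rpow_add (by positivity)]; norm_num
        have h3 : 0 ≤ 32 * Real.pi / (1 - 2 * α) := by positivity
        have h4 := mul_le_mul_of_nonneg_left h1 h3
        unfold lipConst
        calc _ = 34 * r + 32 * Real.pi / (1 - 2 * α) * (r ^ (2 * α) * (2 * r) ^ (1 - 2 * α)) := by
              ring
          _ ≤ 34 * r + 32 * Real.pi / (1 - 2 * α) * (2 * r) := by gcongr
          _ = _ := by ring

end

/-! ### Behaviour under bi-Lipschitz measure-preserving maps -/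

/-- The change of variables by Φ costs nothing because Φ preserves measure. Only the weight changes,
as distances shrink by a factor of at most k. -/
theorem dini_comp_symm_le {α : ℝ} (hα : 0 < α) (θ : Plane → ℝ) {Φ : Plane ≃ₜ Plane}
    (hΦ : MeasurePreserving Φ) {k : ℝ} (hk : 0 < k) (hΦk : ∀ x y, ‖x - y‖ ≤ k * ‖Φ x - Φ y‖) :
    dini α (fun x => θ (Φ.symm x)) ≤ ENNReal.ofReal (k ^ (2 + 2 * α)) * dini α θ := by
  refine iSup_le fun x => ?_
  obtain ⟨a, rfl⟩ := Φ.surjective x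
  rw [← hΦ.lintegral_comp_emb Φ.measurableEmbedding]
  simp only [Homeomorph.symm_apply_apply]
  refine le_trans ?_ (mul_le_mul_right (lintegral_le_dini α θ a) _)
  rw [← lintegral_const_mul' _ _ ENNReal.ofReal_ne_top]
  refine lintegral_mono fun b => ?_
  rcases eq_or_ne a b with rfl | hab
  · simp
  have hpos : 0 < ‖a - b‖ := norm_pos_iff.2 (sub_ne_zero.2 hab)
  rw [mul_left_comm, ← ENNReal.ofReal_mul (by positivity)]
  gcongr
  calc ‖Φ a - Φ b‖ ^ (-(2 + 2 * α)) ≤ (‖a - b‖ / k) ^ (-(2 + 2 * α)) :=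
        Real.rpow_le_rpow_of_nonpos (by positivity) (by rw [div_le_iff₀' hk]; exact hΦk a b)
          (by linarith)
    _ = _ := by
      rw [Real.div_rpow hpos.le hk.le, Real.rpow_neg hk.le, div_inv_eq_mul]; ring

theorem slice_push {L : Type*} (Φ : Plane ≃ₜ Plane) (Θ : Set (Plane × L)) (l : L) :
    slice (push Φ Θ) l = Φ '' slice Θ l := by
  ext x
  simp only [slice, push, mem_image, Prod.exists, Prod.mk.injEq]
  constructor
  · rintro ⟨a, b, h, rfl, rfl⟩
    exact ⟨a, h, rfl⟩
  · rintro ⟨a, h, rfl⟩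
    exact ⟨a, l, h, rfl, rfl⟩

theorem mem_slice_push {L : Type*} (Φ : Plane ≃ₜ Plane) (Θ : Set (Plane × L)) (l : L) (x : Plane) :
    x ∈ slice (push Φ Θ) l ↔ Φ.symm x ∈ slice Θ l := by
  rw [slice_push, Homeomorph.image_eq_preimage_symm, mem_preimage]

/-- A homeomorphism carries the frontier of a slice to the frontier of its image, so every distance
to a frontier shrinks by a factor of at most k. -/
theorem layerCakeL_push_le {L : Type*} [MeasurableSpace L] {α : ℝ} (hα : 0 < α)
    (Θ : Set (Plane × L)) (μ : SigmaFiniteSignedMeasure L) {Φ : Plane ≃ₜ Plane} {k : ℝ} (hk : 0 < k)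
    (hΦk : ∀ x y, ‖x - y‖ ≤ k * ‖Φ x - Φ y‖) :
    layerCakeL α (push Φ Θ) μ ≤ ENNReal.ofReal (k ^ (2 * α)) * layerCakeL α Θ μ := by
  refine iSup_le fun x => ?_
  obtain ⟨a, rfl⟩ := Φ.surjective x
  refine le_trans ?_ (mul_le_mul_right (le_iSup (fun x : Plane =>
    ∫⁻ l, ((Metric.infEDist x (frontier (slice Θ l))) ^ (2 * α))⁻¹ ∂μ.totalVariation) a) _)
  rw [← lintegral_const_mul' _ _ ENNReal.ofReal_ne_top]
  refine lintegral_mono fun l => ?_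
  have hk0 : ENNReal.ofReal k ≠ 0 := by simpa using hk
  have h1 : Metric.infEDist a (frontier (slice Θ l)) / ENNReal.ofReal k ≤
      Metric.infEDist (Φ a) (frontier (slice (push Φ Θ) l)) := by
    rw [slice_push, ← Homeomorph.image_frontier, Metric.le_infEDist]
    rintro _ ⟨b, hb, rfl⟩
    rw [ENNReal.div_le_iff hk0 ENNReal.ofReal_ne_top]
    refine (Metric.infEDist_le_edist_of_mem hb).trans ?_
    rw [edist_dist, edist_dist, dist_eq_norm, dist_eq_norm, mul_comm,
      ← ENNReal.ofReal_mul hk.le]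
    exact ENNReal.ofReal_le_ofReal (hΦk a b)
  calc ((Metric.infEDist (Φ a) (frontier (slice (push Φ Θ) l))) ^ (2 * α))⁻¹
      ≤ ((Metric.infEDist a (frontier (slice Θ l)) / ENNReal.ofReal k) ^ (2 * α))⁻¹ := by
        gcongr
    _ = ENNReal.ofReal (k ^ (2 * α)) *
        ((Metric.infEDist a (frontier (slice Θ l))) ^ (2 * α))⁻¹ := by
        rw [ENNReal.div_rpow_of_nonneg _ _ (by positivity), ENNReal.inv_div
          (Or.inl (ENNReal.rpow_ne_top_of_nonneg (by positivity) ENNReal.ofReal_ne_top))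
          (Or.inl (by simp [hk])),
          ENNReal.ofReal_rpow_of_pos hk, ENNReal.div_eq_inv_mul, mul_comm]

theorem sigmaFinite_totalVariation {L : Type*} [MeasurableSpace L]
    (μ : SigmaFiniteSignedMeasure L) : SigmaFinite μ.totalVariation := by
  have := μ.sigmaFinite_pos
  have := μ.sigmaFinite_neg
  unfold SigmaFiniteSignedMeasure.totalVariation
  infer_instance

theorem IsLayerCake.push {L : Type*} [MeasurableSpace L] {θ : Plane → ℝ} {Θ : Set (Plane × L)}
    {μ : SigmaFiniteSignedMeasure L} (h : IsLayerCake θ Θ μ) {Φ : Plane ≃ₜ Plane}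
    (hΦ : MeasurePreserving Φ) :
    IsLayerCake (fun x => θ (Φ.symm x)) (push Φ Θ) μ := by
  have hσ := sigmaFinite_totalVariation μ
  have hpre : GSQG.push Φ Θ = (Prod.map Φ.symm id) ⁻¹' Θ := by
    ext ⟨x, l⟩
    exact mem_slice_push Φ Θ l x
  have hmp : MeasurePreserving (Prod.map Φ.symm id)
      ((volume : Measure Plane).prod μ.totalVariation) (volume.prod μ.totalVariation) := by
    have hs : MeasurePreserving Φ.symm volume volume :=
      MeasurePreserving.symm (e := Φ.toMeasurableEquiv) hΦ
    exact hs.prod (MeasurePreserving.id _)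
  have hind : ∀ x l, (slice (GSQG.push Φ Θ) l).indicator (fun _ => (1 : ℝ)) x =
      (slice Θ l).indicator (fun _ => (1 : ℝ)) (Φ.symm x) := fun x l => by
    by_cases hx : Φ.symm x ∈ slice Θ l <;> simp [indicator, mem_slice_push, hx]
  refine ⟨?_, ?_, fun x => ?_, fun x => ?_⟩
  · rw [hpre]; exact hmp.measurable h.measurableSet
  · rw [hpre, hmp.measure_preimage h.measurableSet.nullMeasurableSet]; exact h.measure_lt_top
  · simp_rw [hind]; exact h.integrable _
  · simp_rw [hind]; exact h.eq_integral _

/-! ### The Dini seminorm of a layer cake -/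

theorem inter_frontier_nonempty {X : Type*} [TopologicalSpace X] {t S : Set X}
    (ht : IsPreconnected t) {x y : X} (hx : x ∈ t) (hy : y ∈ t) (hxS : x ∈ S) (hyS : y ∉ S) :
    (t ∩ frontier S).Nonempty := by
  by_contra hne
  have hdisj : ∀ z ∈ t, z ∉ frontier S := fun z hz hzf => hne ⟨z, hz, hzf⟩
  have hcover : t ⊆ interior S ∪ (closure S)ᶜ := fun z hz => by
    by_cases hzi : z ∈ interior S
    · exact Or.inl hzi
    · exact Or.inr fun hzc => hdisj z hz ⟨hzc, hzi⟩
  have hx' : x ∈ interior S := (hcover hx).resolve_right fun h => h (subset_closure hxS)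
  have hy' : y ∈ (closure S)ᶜ := (hcover hy).resolve_left fun h => hyS (interior_subset h)
  obtain ⟨z, -, hz1, hz2⟩ := ht _ _ isOpen_interior isClosed_closure.isOpen_compl hcover
    ⟨x, hx, hx'⟩ ⟨y, hy, hy'⟩
  exact hz2 (subset_closure (interior_subset hz1))

/-- The segment between a point of S and a point outside S is connected, so it meets the frontier of
S. -/
theorem infEDist_frontier_le {S : Set Plane} {x y : Plane}
    (h : S.indicator (fun _ => (1 : ℝ)) x ≠ S.indicator (fun _ => (1 : ℝ)) y) :
    Metric.infEDist x (frontier S) ≤ edist x y := by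
  have hseg : IsPreconnected (segment ℝ x y) := (convex_segment x y).isPreconnected
  have hx := left_mem_segment ℝ x y
  have hy := right_mem_segment ℝ x y
  have : (segment ℝ x y ∩ frontier S).Nonempty := by
    by_cases hxS : x ∈ S <;> by_cases hyS : y ∈ S
    · simp [hxS, hyS] at h
    · exact inter_frontier_nonempty hseg hx hy hxS hyS
    · exact inter_frontier_nonempty hseg hy hx hyS hxS
    · simp [hxS, hyS] at h
  obtain ⟨w, hw, hwS⟩ := this
  refine (Metric.infEDist_le_edist_of_mem hwS).trans ?_
  rw [edist_dist, edist_dist]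
  apply ENNReal.ofReal_le_ofReal
  have := (mem_segment_iff_wbtw.1 hw).dist_add_dist
  linarith [dist_nonneg (x := w) (y := y)]

/-- The integrand vanishes for y closer to x than the frontier of S, so the integral is at most the
tail of |w|^{-2-2α} beyond the distance d. The cases d = 0 and d = ∞ match the conventions 1/0 = ∞
and 1/∞ = 0. -/
theorem lintegral_indicator_sub_le {α : ℝ} (hα : 0 < α) (S : Set Plane) (x : Plane) :
    ∫⁻ y, ‖S.indicator (fun _ => (1 : ℝ)) x - S.indicator (fun _ => (1 : ℝ)) y‖ₑ *
        ENNReal.ofReal (‖x - y‖ ^ (-(2 + 2 * α))) ≤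
      ENNReal.ofReal (Real.pi / α) * ((Metric.infEDist x (frontier S)) ^ (2 * α))⁻¹ := by
  set d := Metric.infEDist x (frontier S) with hd
  have hzero : ∀ y, edist x y < d →
      S.indicator (fun _ => (1 : ℝ)) x - S.indicator (fun _ => (1 : ℝ)) y = 0 := fun y hy => by
    by_contra hne
    exact absurd (infEDist_frontier_le (sub_ne_zero.1 hne)) (not_le.2 hy)
  rcases eq_or_ne d 0 with h0 | h0
  · rw [h0, ENNReal.zero_rpow_of_pos (by positivity), ENNReal.inv_zero, ENNReal.mul_top]
    · exact le_top
    · simp only [ne_eq, ENNReal.ofReal_eq_zero, not_le]; positivity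
  rcases eq_or_ne d ∞ with htop | htop
  · have : ∀ y, S.indicator (fun _ => (1 : ℝ)) x - S.indicator (fun _ => (1 : ℝ)) y = 0 :=
      fun y => hzero y (by rw [htop]; exact edist_lt_top x y)
    simp [this]
  set r := d.toReal
  have hr : 0 < r := ENNReal.toReal_pos h0 htop
  have hdr : d = ENNReal.ofReal r := (ENNReal.ofReal_toReal htop).symm
  have hmeas : MeasurableSet {w : Plane | r ≤ ‖w‖} :=
    measurableSet_le measurable_const measurable_norm
  calc _ ≤ ∫⁻ y, {w : Plane | r ≤ ‖w‖}.indicator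
        (fun w => ENNReal.ofReal (‖w‖ ^ (-(2 + 2 * α)))) (x - y) := by
        refine lintegral_mono fun y => ?_
        by_cases h : r ≤ ‖x - y‖
        · rw [indicator_of_mem (show x - y ∈ {w : Plane | r ≤ ‖w‖} from h)]
          apply mul_le_of_le_one_left zero_le
          by_cases hx : x ∈ S <;> by_cases hy : y ∈ S <;> simp [hx, hy]
        · rw [hzero y, enorm_zero, zero_mul]
          · exact zero_le
          · rw [hdr, edist_dist, dist_eq_norm]
            exact (ENNReal.ofReal_lt_ofReal_iff hr).2 (not_le.1 h)
    _ = ENNReal.ofReal (Real.pi / α * r ^ (-(2 * α))) := by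
        rw [lintegral_sub_left_eq_self (μ := volume) (fun y : Plane => {w : Plane | r ≤ ‖w‖}.indicator
          (fun w => ENNReal.ofReal (‖w‖ ^ (-(2 + 2 * α)))) y) x, lintegral_indicator hmeas,
          lintegral_norm_rpow_ge hα hr]
    _ = _ := by
        have : 0 < Real.pi / α := by positivity
        rw [hdr, ENNReal.ofReal_rpow_of_pos hr, ← ENNReal.ofReal_inv_of_pos (by positivity),
          ← ENNReal.ofReal_mul this.le, Real.rpow_neg hr.le]

theorem enorm_sub_le_lintegral_of_isLayerCake {L : Type*} [MeasurableSpace L] {θ : Plane → ℝ}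
    {Θ : Set (Plane × L)} {μ : SigmaFiniteSignedMeasure L} (h : IsLayerCake θ Θ μ) (x y : Plane) :
    ‖θ x - θ y‖ₑ ≤ ∫⁻ l, ‖(slice Θ l).indicator (fun _ => (1 : ℝ)) x -
      (slice Θ l).indicator (fun _ => (1 : ℝ)) y‖ₑ ∂μ.totalVariation := by
  have hp : μ.pos ≤ μ.totalVariation := Measure.le_add_right le_rfl
  have hn : μ.neg ≤ μ.totalVariation := Measure.le_add_left le_rfl
  have hx := h.integrable x
  have hy := h.integrable y
  have key : θ x - θ y =
      (∫ l, ((slice Θ l).indicator (fun _ => (1 : ℝ)) x -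
        (slice Θ l).indicator (fun _ => (1 : ℝ)) y) ∂μ.pos) -
      ∫ l, ((slice Θ l).indicator (fun _ => (1 : ℝ)) x -
        (slice Θ l).indicator (fun _ => (1 : ℝ)) y) ∂μ.neg := by
    rw [h.eq_integral x, h.eq_integral y, SigmaFiniteSignedMeasure.integral,
      SigmaFiniteSignedMeasure.integral,
      integral_sub (hx.mono_measure hp) (hy.mono_measure hp),
      integral_sub (hx.mono_measure hn) (hy.mono_measure hn)]
    ring
  rw [key, SigmaFiniteSignedMeasure.totalVariation, lintegral_add_measure]
  exact enorm_sub_le.trans (add_le_add (enorm_integral_le_lintegral_enorm _)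
    (enorm_integral_le_lintegral_enorm _))

/-- Bound |θ(x) - θ(y)| by the integral over the slices of the differences of their indicators,
exchange the integrals, and treat each slice separately. Membership of Θ in the product σ-algebra is
what allows the exchange. -/
theorem dini_le_layerCakeL {L : Type*} [MeasurableSpace L] {α : ℝ} (hα : 0 < α) {θ : Plane → ℝ}
    {Θ : Set (Plane × L)} {μ : SigmaFiniteSignedMeasure L} (h : IsLayerCake θ Θ μ) :
    dini α θ ≤ ENNReal.ofReal (Real.pi / α) * layerCakeL α Θ μ := by
  have hσ := sigmaFinite_totalVariation μ
  refine iSup_le fun x => ?_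
  refine le_trans ?_ (mul_le_mul_right (le_iSup (fun x : Plane =>
    ∫⁻ l, ((Metric.infEDist x (frontier (slice Θ l))) ^ (2 * α))⁻¹ ∂μ.totalVariation) x) _)
  rw [← lintegral_const_mul' _ _ ENNReal.ofReal_ne_top]
  have hmeas : Measurable fun p : Plane × L =>
      ‖(slice Θ p.2).indicator (fun _ => (1 : ℝ)) x -
        (slice Θ p.2).indicator (fun _ => (1 : ℝ)) p.1‖ₑ *
          ENNReal.ofReal (‖x - p.1‖ ^ (-(2 + 2 * α))) := by
    have h1 : Measurable fun p : Plane × L => Θ.indicator (fun _ => (1 : ℝ)) p :=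
      measurable_const.indicator h.measurableSet
    have h2 : Measurable fun p : Plane × L => Θ.indicator (fun _ => (1 : ℝ)) (x, p.2) :=
      h1.comp (measurable_const.prodMk measurable_snd)
    have h3 : Measurable fun p : Plane × L => ENNReal.ofReal (‖x - p.1‖ ^ (-(2 + 2 * α))) :=
      (((measurable_const.sub measurable_fst).norm).pow_const _).ennreal_ofReal
    exact (h2.sub h1).enorm.mul h3
  calc _ ≤ ∫⁻ y, ∫⁻ l, ‖(slice Θ l).indicator (fun _ => (1 : ℝ)) x -
        (slice Θ l).indicator (fun _ => (1 : ℝ)) y‖ₑ *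
          ENNReal.ofReal (‖x - y‖ ^ (-(2 + 2 * α))) ∂μ.totalVariation := by
        refine lintegral_mono fun y => ?_
        rw [lintegral_mul_const' _ _ ENNReal.ofReal_ne_top]
        gcongr
        exact enorm_sub_le_lintegral_of_isLayerCake h x y
    _ = ∫⁻ l, ∫⁻ y, ‖(slice Θ l).indicator (fun _ => (1 : ℝ)) x -
        (slice Θ l).indicator (fun _ => (1 : ℝ)) y‖ₑ *
          ENNReal.ofReal (‖x - y‖ ^ (-(2 + 2 * α))) ∂volume ∂μ.totalVariation :=
        lintegral_lintegral_swap hmeas.aemeasurable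
    _ ≤ _ := lintegral_mono fun l => lintegral_indicator_sub_le hα _ x

/-! ### Continuity -/

theorem continuous_of_dini_lt_top {α : ℝ} (hα : 0 < α) (hα' : α < 1 / 2) {θ : Plane → ℝ}
    (hθ : AEMeasurable θ) (hd : dini α θ < ∞) : Continuous θ := by
  rw [continuous_iff_continuousAt]
  intro x
  rw [ContinuousAt, tendsto_iff_edist_tendsto_0]
  have h1 : Tendsto (fun y => ENNReal.ofReal (16 * ‖y - x‖ ^ (2 * α)) * dini α θ) (𝓝 x) (𝓝 0) := by
    have h2 : Tendsto (fun y : Plane => 16 * ‖y - x‖ ^ (2 * α)) (𝓝 x) (𝓝 0) := by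
      have : ContinuousAt (fun y : Plane => 16 * ‖y - x‖ ^ (2 * α)) x := by
        refine continuousAt_const.mul (ContinuousAt.rpow_const (by fun_prop) (Or.inr (by positivity)))
      have h3 := this.tendsto
      simpa [Real.zero_rpow (by positivity : 2 * α ≠ 0)] using h3
    have h3 := ENNReal.Tendsto.mul_const (ENNReal.tendsto_ofReal h2) (Or.inr hd.ne)
    simpa using h3
  refine tendsto_of_tendsto_of_tendsto_of_le_of_le tendsto_const_nhds h1 (fun _ => zero_le)
    fun y => ?_
  rw [edist_eq_enorm_sub]
  exact enorm_sub_le_dini hα hα' hθ y x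

/-- The set where a continuous function exceeds its essential bound is open and null, hence empty.
-/
theorem exists_abs_le_of_continuous_of_memLp {θ : Plane → ℝ} (hc : Continuous θ)
    (h : MemLp θ ∞ volume) : ∃ A : ℝ, ∀ x, |θ x| ≤ A := by
  have hae : ∀ᵐ x, ‖θ x‖ ≤ (eLpNormEssSup θ volume).toReal := by
    have h1 := enorm_ae_le_eLpNormEssSup θ volume
    have h2 : eLpNormEssSup θ volume ≠ ∞ := by
      have := h.2; rw [eLpNorm_exponent_top] at this; exact this.ne
    filter_upwards [h1] with x hx
    rw [← toReal_enorm]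
    exact ENNReal.toReal_mono h2 hx
  refine ⟨(eLpNormEssSup θ volume).toReal, fun x => ?_⟩
  by_contra hx
  have hopen : IsOpen {y | (eLpNormEssSup θ volume).toReal < |θ y|} :=
    isOpen_lt continuous_const hc.abs
  have hnull : volume {y | (eLpNormEssSup θ volume).toReal < |θ y|} = 0 := by
    rw [ae_iff] at hae
    simpa using hae
  have hempty := (hopen.measure_eq_zero_iff volume).1 hnull
  have : x ∈ {y | (eLpNormEssSup θ volume).toReal < |θ y|} := not_le.1 hx
  rw [hempty] at this
  exact this

/-! ### Gronwall estimates in both time directions -/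

section

variable {E : Type*} [NormedAddCommGroup E] [NormedSpace ℝ E]

theorem norm_le_gronwallBound_of_hasDerivAt {f f' : ℝ → E} {K δ s r : ℝ}
    (hf : ∀ t ∈ uIcc s r, HasDerivAt f (f' t) t)
    (hb : ∀ t ∈ uIcc s r, ‖f' t‖ ≤ K * ‖f t‖ + δ) :
    ‖f r‖ ≤ gronwallBound ‖f s‖ K δ |r - s| := by
  rcases le_total s r with h | h
  · rw [uIcc_of_le h] at hf hb
    rw [abs_of_nonneg (sub_nonneg.2 h)]
    exact norm_le_gronwallBound_of_norm_deriv_right_le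
      (fun t ht => (hf t ht).continuousAt.continuousWithinAt)
      (fun t ht => (hf t (Ico_subset_Icc_self ht)).hasDerivWithinAt) le_rfl
      (fun t ht => hb t (Ico_subset_Icc_self ht)) r (right_mem_Icc.2 h)
  · rw [uIcc_of_ge h] at hf hb
    have hmem : ∀ t ∈ Icc (-s) (-r), -t ∈ Icc r s := fun t ht =>
      ⟨by linarith [ht.2], by linarith [ht.1]⟩
    have hd : ∀ t ∈ Icc (-s) (-r), HasDerivAt (fun t => f (-t)) (-f' (-t)) t := fun t ht => by
      have := (hf (-t) (hmem t ht)).scomp t (hasDerivAt_neg t)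
      rwa [neg_one_smul] at this
    have := norm_le_gronwallBound_of_norm_deriv_right_le (f := fun t => f (-t))
      (f' := fun t => -f' (-t)) (δ := ‖f s‖) (K := K) (ε := δ) (a := -s) (b := -r)
      (fun t ht => (hd t ht).continuousAt.continuousWithinAt)
      (fun t ht => (hd t (Ico_subset_Icc_self ht)).hasDerivWithinAt) (by simp)
      (fun t ht => by
        rw [norm_neg]; exact hb (-t) (hmem t (Ico_subset_Icc_self ht))) (-r)
      (right_mem_Icc.2 (by linarith))
    rw [abs_of_nonpos (by linarith), show -(r - s) = -r - -s by ring]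
    simpa using this

theorem norm_le_mul_exp_of_hasDerivAt {f f' : ℝ → E} {K s r : ℝ}
    (hf : ∀ t ∈ uIcc s r, HasDerivAt f (f' t) t) (hb : ∀ t ∈ uIcc s r, ‖f' t‖ ≤ K * ‖f t‖) :
    ‖f r‖ ≤ ‖f s‖ * Real.exp (K * |r - s|) := by
  have := norm_le_gronwallBound_of_hasDerivAt (δ := 0) hf (by simpa using hb)
  rwa [gronwallBound_ε0] at this

/-- In the norm weighted by exp(-2C|t - s|) the integral operator with rate C contracts by the
factor 1/2. Iterating this replaces Gronwall when the derivative is bounded not by |f| itself but by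
a supremum over all particles, whose regularity in time is unknown. -/
theorem norm_le_half_mul_exp_of_hasDerivAt {f f' : ℝ → E} {C A s r : ℝ} (hA : 0 ≤ A) (hs : f s = 0)
    (hf : ∀ t ∈ uIcc s r, HasDerivAt f (f' t) t)
    (hb : ∀ t ∈ uIcc s r, ‖f' t‖ ≤ C * (A * Real.exp (2 * C * |t - s|))) :
    ‖f r‖ ≤ A / 2 * Real.exp (2 * C * |r - s|) := by
  have key : ∀ (g g' : ℝ → E) (T : ℝ), 0 ≤ T → g 0 = 0 → (∀ t ∈ Icc 0 T, HasDerivAt g (g' t) t) →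
      (∀ t ∈ Icc 0 T, ‖g' t‖ ≤ C * (A * Real.exp (2 * C * t))) →
      ‖g T‖ ≤ A / 2 * Real.exp (2 * C * T) := by
    intro g g' T hT h0 hg hg'
    refine image_norm_le_of_norm_deriv_right_le_deriv_boundary (a := 0) (b := T)
      (fun t ht => (hg t ht).continuousAt.continuousWithinAt)
      (fun t ht => (hg t (Ico_subset_Icc_self ht)).hasDerivWithinAt)
      (B := fun t => A / 2 * Real.exp (2 * C * t))
      (B' := fun t => C * (A * Real.exp (2 * C * t))) ?_ (fun t => ?_)
      (fun t ht => hg' t (Ico_subset_Icc_self ht)) (right_mem_Icc.2 hT)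
    · rw [h0, norm_zero]; positivity
    · have h1 : HasDerivAt (fun t : ℝ => 2 * C * t) (2 * C) t := by
        simpa using (hasDerivAt_id t).const_mul (2 * C)
      have h2 := h1.exp.const_mul (A / 2)
      rwa [show A / 2 * (Real.exp (2 * C * t) * (2 * C)) = C * (A * Real.exp (2 * C * t)) by ring]
        at h2
  rcases le_total s r with h | h
  · rw [uIcc_of_le h] at hf hb
    rw [abs_of_nonneg (sub_nonneg.2 h)]
    have := key (fun t => f (s + t)) (fun t => f' (s + t)) (r - s) (by linarith) (by simpa using hs)
      (fun t ht => HasDerivAt.comp_const_add s t (hf (s + t) ⟨by linarith [ht.1], by linarith [ht.2]⟩))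
      (fun t ht => by
        have := hb (s + t) ⟨by linarith [ht.1], by linarith [ht.2]⟩
        rwa [add_sub_cancel_left, abs_of_nonneg ht.1] at this)
    simpa using this
  · rw [uIcc_of_ge h] at hf hb
    rw [abs_of_nonpos (sub_nonpos.2 h)]
    have := key (fun t => f (s - t)) (fun t => -f' (s - t)) (s - r) (by linarith) (by simpa using hs)
      (fun t ht => HasDerivAt.comp_const_sub s t (hf (s - t) ⟨by linarith [ht.2], by linarith [ht.1]⟩))
      (fun t ht => by
        have := hb (s - t) ⟨by linarith [ht.2], by linarith [ht.1]⟩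
        rw [norm_neg]
        rwa [sub_sub_cancel_left, abs_neg, abs_of_nonneg ht.1] at this)
    simpa using this

end

/-! ### Homeomorphisms close to the identity -/

theorem approximatesLinearOn_id_add {g : Plane → Plane} (hg : LipschitzWith (1 / 2) g) :
    ApproximatesLinearOn (fun x => x + g x)
      ((ContinuousLinearEquiv.refl ℝ Plane : Plane ≃L[ℝ] Plane) : Plane →L[ℝ] Plane) univ
      (1 / 2) := by
  rw [ApproximatesLinearOn.approximatesLinearOn_iff_lipschitzOnWith, lipschitzOnWith_univ]
  have : (fun x => x + g x) -
      (((ContinuousLinearEquiv.refl ℝ Plane : Plane ≃L[ℝ] Plane) : Plane →L[ℝ] Plane) :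
        Plane → Plane) = g := by
    ext1 x
    simp
  rwa [this]

theorem half_lt_inv_nnnorm_refl :
    (1 / 2 : ℝ≥0) < ‖((ContinuousLinearEquiv.refl ℝ Plane).symm : Plane →L[ℝ] Plane)‖₊⁻¹ := by
  have : ((ContinuousLinearEquiv.refl ℝ Plane).symm : Plane →L[ℝ] Plane) =
      ContinuousLinearMap.id ℝ Plane := rfl
  rw [this, ContinuousLinearMap.nnnorm_id, inv_one]
  exact NNReal.half_lt_self one_ne_zero

/-- The homeomorphism `x ↦ x + g x` for a `1/2`-Lipschitz map `g`. -/
noncomputable def idAddHomeomorph {g : Plane → Plane} (hg : LipschitzWith (1 / 2) g) :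
    Plane ≃ₜ Plane :=
  (approximatesLinearOn_id_add hg).toHomeomorph _ (Or.inr half_lt_inv_nnnorm_refl)

theorem idAddHomeomorph_apply {g : Plane → Plane} (hg : LipschitzWith (1 / 2) g) (x : Plane) :
    idAddHomeomorph hg x = x + g x := rfl

theorem norm_sub_le_two_mul_of_lipschitz {g : Plane → Plane} (hg : LipschitzWith (1 / 2) g)
    (x y : Plane) : ‖x - y‖ ≤ 2 * ‖(x + g x) - (y + g y)‖ := by
  have h1 := hg.norm_sub_le x y
  have h2 := norm_sub_le ((x + g x) - (y + g y)) (g x - g y)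
  rw [show (x + g x) - (y + g y) - (g x - g y) = x - y by abel] at h2
  push_cast at h1
  linarith

/-! ### Limits of almost measure-preserving maps -/

theorem norm_le_add_of_norm_sub_le {B : ℝ} {x y : Plane} (h : ‖y - x‖ ≤ B) : ‖x‖ ≤ ‖y‖ + B := by
  have := norm_sub_norm_le x y
  rw [norm_sub_rev] at this
  linarith

/-- A bounded displacement makes preimages of bounded sets bounded. Local finiteness of the image
measure is needed to identify it through compactly supported test functions. -/
theorem isFiniteMeasureOnCompacts_map {Φ : Plane → Plane} (hΦ : Measurable Φ) {B : ℝ}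
    (hB : ∀ x, ‖Φ x - x‖ ≤ B) :
    IsFiniteMeasureOnCompacts (Measure.map Φ (volume : Measure Plane)) := by
  refine ⟨fun s hs => ?_⟩
  rw [Measure.map_apply hΦ hs.measurableSet]
  obtain ⟨R, hR⟩ := hs.isBounded.subset_closedBall 0
  refine (measure_mono (t := Metric.closedBall 0 (R + B)) fun x hx => ?_).trans_lt
    measure_closedBall_lt_top
  have h1 : ‖Φ x‖ ≤ R := by simpa using hR hx
  have h2 := norm_le_add_of_norm_sub_le (hB x)
  simp only [Metric.mem_closedBall, dist_zero_right]
  linarith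

theorem tendsto_lintegral_comp_of_hasCompactSupport {E : ℕ → Plane → Plane} {Φ : Plane → Plane}
    (hE : ∀ n, Measurable (E n)) (hlim : ∀ x, Tendsto (fun n => E n x) atTop (𝓝 (Φ x))) {B : ℝ}
    (hB : ∀ n x, ‖E n x - x‖ ≤ B) {f : Plane → ℝ≥0} (hf : Continuous f)
    (hf' : HasCompactSupport f) :
    Tendsto (fun n => ∫⁻ x, (f (E n x) : ℝ≥0∞)) atTop (𝓝 (∫⁻ x, (f (Φ x) : ℝ≥0∞))) := by
  obtain ⟨R, hR⟩ := hf'.isCompact.isBounded.subset_closedBall 0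
  obtain ⟨C, hC⟩ : ∃ C : ℝ≥0, ∀ x, f x ≤ C := by
    obtain ⟨C, hC⟩ := (hf'.isCompact_range hf).bddAbove
    exact ⟨C, fun x => hC (mem_range_self x)⟩
  refine tendsto_lintegral_of_dominated_convergence
    ((Metric.closedBall (0 : Plane) (R + B)).indicator fun _ => (C : ℝ≥0∞))
    (fun n => (measurable_coe_nnreal_ennreal.comp (hf.measurable.comp (hE n))))
    (fun n => ae_of_all _ fun x => ?_) ?_ (ae_of_all _ fun x => ?_)
  · by_cases hx : x ∈ Metric.closedBall (0 : Plane) (R + B)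
    · rw [indicator_of_mem hx]
      exact ENNReal.coe_le_coe.2 (hC _)
    · have : f (E n x) = 0 := by
        refine image_eq_zero_of_notMem_tsupport fun hmem => hx ?_
        have h1 : ‖E n x‖ ≤ R := by simpa using hR hmem
        have h2 := norm_le_add_of_norm_sub_le (hB n x)
        simp only [Metric.mem_closedBall, dist_zero_right]
        linarith
      simp [this]
  · rw [lintegral_indicator_const measurableSet_closedBall]
    exact ENNReal.mul_ne_top ENNReal.coe_ne_top measure_closedBall_lt_top.ne
  · exact ((ENNReal.continuous_coe.comp hf).tendsto _).comp (hlim x)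

/-- The approximating maps need not preserve measure, only asymptotically preserve integrals of test
functions. The common bound B supplies the dominating function, and a locally finite measure is
determined by its integrals of compactly supported continuous functions. -/
theorem measurePreserving_of_tendsto {E : ℕ → Plane → Plane} {Φ : Plane → Plane}
    (hE : ∀ n, Measurable (E n)) (hlim : ∀ x, Tendsto (fun n => E n x) atTop (𝓝 (Φ x))) {B : ℝ}
    (hB : ∀ n x, ‖E n x - x‖ ≤ B)
    (hint : ∀ f : Plane → ℝ≥0, Continuous f → HasCompactSupport f →
      Tendsto (fun n => ∫⁻ x, (f (E n x) : ℝ≥0∞)) atTop (𝓝 (∫⁻ x, (f x : ℝ≥0∞)))) :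
    MeasurePreserving Φ := by
  have hΦ : Measurable Φ := measurable_of_tendsto_metrizable hE (tendsto_pi_nhds.2 hlim)
  have hΦB : ∀ x, ‖Φ x - x‖ ≤ B := fun x =>
    le_of_tendsto ((hlim x).sub_const x).norm (Eventually.of_forall fun n => hB n x)
  have hfin := isFiniteMeasureOnCompacts_map hΦ hΦB
  refine ⟨hΦ, Measure.ext_of_integral_eq_on_compactlySupported_nnreal fun f => ?_⟩
  have hf : Continuous f := f.continuous
  have heq := tendsto_nhds_unique
    (tendsto_lintegral_comp_of_hasCompactSupport hE hlim hB hf f.hasCompactSupport)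
    (hint f hf f.hasCompactSupport)
  have hm : Measurable fun x => (f x : ℝ≥0∞) := measurable_coe_nnreal_ennreal.comp hf.measurable
  have hm' : AEStronglyMeasurable (fun x => (f x : ℝ)) (volume : Measure Plane) :=
    (NNReal.continuous_coe.comp hf).aestronglyMeasurable
  have hm'' : AEStronglyMeasurable (fun x => (f x : ℝ)) (Measure.map Φ volume) :=
    (NNReal.continuous_coe.comp hf).aestronglyMeasurable
  rw [← lintegral_map hm hΦ] at heq
  rw [integral_eq_lintegral_of_nonneg_ae (ae_of_all _ fun x => NNReal.coe_nonneg _) hm'',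
    integral_eq_lintegral_of_nonneg_ae (ae_of_all _ fun x => NNReal.coe_nonneg _) hm']
  simp only [ENNReal.ofReal_coe_nnreal]
  rw [heq]

/-! ### Liouville's theorem -/

/-- The term of first order in h in the determinant is h times the trace, which vanishes. Only a
term of order h² is left. -/
theorem abs_det_id_add_smul_sub_one_le {A : Plane →L[ℝ] Plane} {K h : ℝ} (hA : ‖A‖ ≤ K)
    (htr : A (EuclideanSpace.single 0 1) 0 + A (EuclideanSpace.single 1 1) 1 = 0) :
    |(ContinuousLinearMap.id ℝ Plane + h • A).det - 1| ≤ 2 * (h * K) ^ 2 := by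
  set a := fun i j : Fin 2 => A (EuclideanSpace.single j 1) i
  have ha : ∀ i j, |a i j| ≤ K := fun i j => by
    calc |a i j| ≤ ‖A (EuclideanSpace.single j 1)‖ := by
          rw [← Real.norm_eq_abs]; exact PiLp.norm_apply_le _ i
      _ ≤ ‖A‖ * ‖(EuclideanSpace.single j 1 : Plane)‖ := A.le_opNorm _
      _ = ‖A‖ := by simp
      _ ≤ K := hA
  have hdet : (ContinuousLinearMap.id ℝ Plane + h • A).det =
      (1 + h * a 0 0) * (1 + h * a 1 1) - h * a 0 1 * (h * a 1 0) := by
    rw [ContinuousLinearMap.det,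
      ← LinearMap.det_toMatrix (EuclideanSpace.basisFun (Fin 2) ℝ).toBasis, Matrix.det_fin_two]
    simp [LinearMap.toMatrix_apply, a]
  have htr' : a 1 1 = -a 0 0 := by simp only [a]; linarith
  have e : (ContinuousLinearMap.id ℝ Plane + h • A).det - 1 =
      -(h ^ 2 * (a 0 0 * a 0 0 + a 0 1 * a 1 0)) := by
    rw [hdet, htr']; ring
  have hK : 0 ≤ K := (norm_nonneg _).trans hA
  have h1 : |a 0 0 * a 0 0 + a 0 1 * a 1 0| ≤ 2 * K ^ 2 := by
    refine (abs_add_le _ _).trans ?_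
    rw [abs_mul, abs_mul]
    nlinarith [mul_le_mul (ha 0 0) (ha 0 0) (abs_nonneg _) hK,
      mul_le_mul (ha 0 1) (ha 1 0) (abs_nonneg _) hK]
  rw [e, abs_neg, abs_mul, abs_of_nonneg (sq_nonneg h)]
  nlinarith [sq_nonneg h]

theorem lintegral_euler_step {w : Plane → Plane} {w' : Plane → Plane →L[ℝ] Plane} {K : ℝ≥0} {h : ℝ}
    (h0 : 0 ≤ h) (hK : h * K ≤ 1 / 2) (hw : LipschitzWith K w)
    (hw' : ∀ x, HasFDerivAt w (w' x) x)
    (htr : ∀ x, w' x (EuclideanSpace.single 0 1) 0 + w' x (EuclideanSpace.single 1 1) 1 = 0)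
    (f : Plane → ℝ≥0∞) :
    ENNReal.ofReal (1 - 2 * (h * K) ^ 2) * ∫⁻ x, f (x + h • w x) ≤ ∫⁻ x, f x ∧
      ∫⁻ x, f x ≤ ENNReal.ofReal (1 + 2 * (h * K) ^ 2) * ∫⁻ x, f (x + h • w x) := by
  have hg : LipschitzWith (1 / 2) fun x => h • w x := by
    refine LipschitzWith.of_dist_le_mul fun x y => ?_
    rw [dist_smul₀, Real.norm_of_nonneg h0]
    calc h * dist (w x) (w y) ≤ h * (K * dist x y) := by gcongr; exact hw.dist_le_mul x y
      _ = h * K * dist x y := by ring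
      _ ≤ _ := by push_cast; gcongr
  have hder : ∀ x ∈ univ, HasFDerivWithinAt (fun x => x + h • w x)
      (ContinuousLinearMap.id ℝ Plane + h • w' x) univ x := fun x _ =>
    ((hasFDerivAt_id x).add ((hw' x).const_smul h)).hasFDerivWithinAt
  have himg := lintegral_image_eq_lintegral_abs_det_fderiv_mul volume MeasurableSet.univ hder
    (idAddHomeomorph hg).injective.injOn f
  have hrange : range (fun x => x + h • w x) = univ := (idAddHomeomorph hg).surjective.range_eq
  rw [image_univ, hrange, Measure.restrict_univ] at himg
  have hdet : ∀ x, |(ContinuousLinearMap.id ℝ Plane + h • w' x).det - 1| ≤ 2 * (h * K) ^ 2 :=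
    fun x => abs_det_id_add_smul_sub_one_le ((hw' x).le_of_lipschitz hw) (htr x)
  rw [himg]
  constructor
  · rw [← lintegral_const_mul' _ _ ENNReal.ofReal_ne_top]
    refine lintegral_mono fun x => ?_
    gcongr
    have := (abs_le.1 (hdet x)).1
    exact le_trans (by linarith) (le_abs_self _)
  · rw [← lintegral_const_mul' _ _ ENNReal.ofReal_ne_top]
    refine lintegral_mono fun x => ?_
    gcongr
    have h1 := hdet x
    have h2 := abs_sub_abs_le_abs_sub (ContinuousLinearMap.id ℝ Plane + h • w' x).det 1
    rw [abs_one] at h2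
    linarith

/-- The `k`-th iterate of the explicit Euler scheme with step `h` for the vector field `v`. -/
noncomputable def euler (v : ℝ → Plane → Plane) (h : ℝ) : ℕ → Plane → Plane
  | 0, x => x
  | k + 1, x => euler v h k x + h • v (k * h) (euler v h k x)

section

variable {v : ℝ → Plane → Plane} {v' : ℝ → Plane → Plane →L[ℝ] Plane} {K : ℝ≥0} {T : ℝ}

theorem norm_euler_sub_le {h B : ℝ} (h0 : 0 ≤ h) {n : ℕ} (hn : n * h ≤ T)
    (hB : ∀ t ∈ Icc 0 T, ∀ x, ‖v t x‖ ≤ B) (x : Plane) :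
    ‖euler v h n x - x‖ ≤ n * h * B := by
  induction n with
  | zero => simp [euler]
  | succ k ih =>
    push_cast at hn ⊢
    have hk : k * h ≤ T := by nlinarith
    have h1 := ih hk
    have h2 := hB (k * h) ⟨by positivity, hk⟩ (euler v h k x)
    calc ‖euler v h (k + 1) x - x‖ = ‖(euler v h k x - x) + h • v (k * h) (euler v h k x)‖ := by
          rw [euler]; congr 1; abel
      _ ≤ k * h * B + h * B := by
          refine (norm_add_le _ _).trans (add_le_add h1 ?_)
          rw [norm_smul, Real.norm_of_nonneg h0]
          gcongr
      _ = _ := by ring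

theorem continuous_euler {h : ℝ} (h0 : 0 ≤ h) {n : ℕ} (hn : n * h ≤ T)
    (hv : ∀ t ∈ Icc 0 T, LipschitzWith K (v t)) : Continuous (euler v h n) := by
  induction n with
  | zero => exact continuous_id
  | succ k ih =>
    push_cast at hn
    have hk : k * h ≤ T := by nlinarith
    exact (ih hk).add (((hv (k * h) ⟨by positivity, hk⟩).continuous.comp (ih hk)).const_smul h)

theorem lintegral_euler {h : ℝ} (h0 : 0 ≤ h) (hK : h * K ≤ 1 / 2) {n : ℕ} (hn : n * h ≤ T)
    (hv : ∀ t ∈ Icc 0 T, LipschitzWith K (v t))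
    (hv' : ∀ t ∈ Icc 0 T, ∀ x, HasFDerivAt (v t) (v' t x) x)
    (htr : ∀ t ∈ Icc 0 T, ∀ x, v' t x (EuclideanSpace.single 0 1) 0 +
      v' t x (EuclideanSpace.single 1 1) 1 = 0) (f : Plane → ℝ≥0∞) :
    ENNReal.ofReal ((1 - 2 * (h * K) ^ 2) ^ n) * ∫⁻ x, f (euler v h n x) ≤ ∫⁻ x, f x ∧
      ∫⁻ x, f x ≤ ENNReal.ofReal ((1 + 2 * (h * K) ^ 2) ^ n) * ∫⁻ x, f (euler v h n x) := by
  have hd : 0 ≤ 1 - 2 * (h * K) ^ 2 := by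
    have : 0 ≤ h * K := by positivity
    nlinarith
  induction n generalizing f with
  | zero => simp [euler]
  | succ k ih =>
    push_cast at hn
    have hk : k * h ≤ T := by nlinarith
    have hmem : k * h ∈ Icc 0 T := ⟨by positivity, hk⟩
    have h1 := lintegral_euler_step h0 hK (hv _ hmem) (hv' _ hmem) (htr _ hmem) f
    have h2 := ih hk (fun x => f (x + h • v (k * h) x))
    simp only [euler]
    constructor
    · rw [pow_succ', ENNReal.ofReal_mul hd, mul_assoc]
      exact (mul_le_mul_right h2.1 _).trans h1.1
    · rw [pow_succ', ENNReal.ofReal_mul (by positivity), mul_assoc]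
      exact h1.2.trans (mul_le_mul_right h2.2 _)

/-- Each step commits an error of at most (K' + K B) h², and errors made earlier are amplified by 1
+ h K per step. -/
theorem norm_euler_sub_flow_le {K' B h : ℝ} (h0 : 0 ≤ h) {n : ℕ} (hn : n * h ≤ T)
    (hK' : 0 ≤ K') (hv : ∀ t ∈ Icc 0 T, LipschitzWith K (v t))
    (hvt : ∀ s ∈ Icc 0 T, ∀ t ∈ Icc 0 T, ∀ x, ‖v s x - v t x‖ ≤ K' * |s - t|)
    (hB : ∀ t ∈ Icc 0 T, ∀ x, ‖v t x‖ ≤ B) {φ : ℝ → Plane}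
    (hφ : ∀ t ∈ Icc 0 T, HasDerivWithinAt φ (v t (φ t)) (Icc 0 T) t) :
    ‖euler v h n (φ 0) - φ (n * h)‖ ≤ n * ((K' + K * B) * h ^ 2) * (1 + h * K) ^ n := by
  induction n with
  | zero => simp [euler]
  | succ k ih =>
    push_cast at hn
    have hk : k * h ≤ T := by nlinarith
    have hmem : k * h ∈ Icc 0 T := ⟨by positivity, hk⟩
    have hmem' : (k + 1) * h ∈ Icc 0 T := ⟨by positivity, hn⟩
    have hB0 : 0 ≤ B := (norm_nonneg _).trans (hB _ hmem 0)
    have hsub : Icc (k * h) ((k + 1) * h) ⊆ Icc 0 T := Icc_subset_Icc hmem.1 hn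
    have hlip : ∀ s ∈ Icc (k * h) ((k + 1) * h), ‖φ s - φ (k * h)‖ ≤ B * h := fun s hs => by
      have h1 := (convex_Icc (0 : ℝ) T).norm_image_sub_le_of_norm_hasDerivWithin_le hφ
        (fun t ht => hB t ht _) hmem (hsub hs)
      refine h1.trans ?_
      rw [Real.norm_of_nonneg (by linarith [hs.1])]
      have := hs.2
      gcongr
      linarith
    -- Subtracting the linear motion with the velocity frozen at the start of the step leaves a
    -- function whose derivative is O(h), hence whose increment over the step is O(h²).
    have hstep : ‖(φ ((k + 1) * h) - ((k + 1) * h) • v (k * h) (φ (k * h))) -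
        (φ (k * h) - (k * h) • v (k * h) (φ (k * h)))‖ ≤ (K' + K * B) * h * h := by
      have h1 := (convex_Icc (k * h) ((k + 1) * h)).norm_image_sub_le_of_norm_hasDerivWithin_le
        (f := fun t => φ t - t • v (k * h) (φ (k * h)))
        (f' := fun t => v t (φ t) - v (k * h) (φ (k * h))) (C := (K' + K * B) * h)
        (fun t ht => by
          have := ((hasDerivAt_id t).smul_const (v (k * h) (φ (k * h)))).hasDerivWithinAt
            (s := Icc (k * h) ((k + 1) * h))
          rw [one_smul] at this
          exact ((hφ t (hsub ht)).mono hsub).sub this)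
        (fun t ht => by
          have e1 := hvt t (hsub ht) (k * h) hmem (φ t)
          have e2 := (hv (k * h) hmem).norm_sub_le (φ t) (φ (k * h))
          have e3 := hlip t ht
          have e4 : |t - k * h| ≤ h := by
            rw [abs_of_nonneg (by linarith [ht.1])]; linarith [ht.2]
          calc _ = ‖(v t (φ t) - v (k * h) (φ t)) + (v (k * h) (φ t) - v (k * h) (φ (k * h)))‖ := by
                congr 1; abel
            _ ≤ K' * h + K * (B * h) := by
                refine (norm_add_le _ _).trans (add_le_add (e1.trans ?_) (e2.trans ?_)) <;> gcongr
            _ = _ := by ring)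
        (left_mem_Icc.2 (by linarith)) (right_mem_Icc.2 (by linarith))
      refine h1.trans (le_of_eq ?_)
      rw [show (k + 1) * h - k * h = h by ring, Real.norm_of_nonneg h0]
    have h1 := ih hk
    set e := euler v h k (φ 0)
    have e2 := (hv (k * h) hmem).norm_sub_le e (φ (k * h))
    push_cast
    have hone : 1 ≤ (1 + h * K) ^ (k + 1) := one_le_pow₀ (by
      have : 0 ≤ h * K := by positivity
      linarith)
    have hC : 0 ≤ (K' + K * B) * h ^ 2 := by positivity
    calc ‖euler v h (k + 1) (φ 0) - φ ((k + 1) * h)‖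
        = ‖(e - φ (k * h)) + h • (v (k * h) e - v (k * h) (φ (k * h))) -
          ((φ ((k + 1) * h) - ((k + 1) * h) • v (k * h) (φ (k * h))) -
            (φ (k * h) - (k * h) • v (k * h) (φ (k * h))))‖ := by
          rw [euler]; congr 1; module
      _ ≤ ‖e - φ (k * h)‖ + h * (K * ‖e - φ (k * h)‖) + (K' + K * B) * h * h := by
          refine (norm_sub_le _ _).trans (add_le_add ((norm_add_le _ _).trans (add_le_add le_rfl ?_))
            hstep)
          rw [norm_smul, Real.norm_of_nonneg h0]
          gcongr
      _ = ‖e - φ (k * h)‖ * (1 + h * K) + (K' + K * B) * h ^ 2 * 1 := by ring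
      _ ≤ k * ((K' + K * B) * h ^ 2) * (1 + h * K) ^ k * (1 + h * K) +
          (K' + K * B) * h ^ 2 * (1 + h * K) ^ (k + 1) := by gcongr
      _ = _ := by ring

/-- **Liouville's theorem** for a divergence-free Lipschitz vector field. -/
theorem measurePreserving_flow {K' B : ℝ} (hT : 0 ≤ T) (hK' : 0 ≤ K')
    (hv : ∀ t ∈ Icc 0 T, LipschitzWith K (v t))
    (hvt : ∀ s ∈ Icc 0 T, ∀ t ∈ Icc 0 T, ∀ x, ‖v s x - v t x‖ ≤ K' * |s - t|)
    (hB : ∀ t ∈ Icc 0 T, ∀ x, ‖v t x‖ ≤ B)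
    (hv' : ∀ t ∈ Icc 0 T, ∀ x, HasFDerivAt (v t) (v' t x) x)
    (htr : ∀ t ∈ Icc 0 T, ∀ x, v' t x (EuclideanSpace.single 0 1) 0 +
      v' t x (EuclideanSpace.single 1 1) 1 = 0)
    {Φ : ℝ → Plane → Plane} (hΦ0 : ∀ x, Φ 0 x = x)
    (hΦ : ∀ x, ∀ t ∈ Icc 0 T, HasDerivWithinAt (fun s => Φ s x) (v t (Φ t x)) (Icc 0 T) t) :
    MeasurePreserving (Φ T) := by
  have hB0 : 0 ≤ B := (norm_nonneg _).trans (hB 0 (left_mem_Icc.2 hT) 0)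
  have hn0 : ∀ n : ℕ, (n + 1 : ℝ) ≠ 0 := fun n => by positivity
  have hnh : ∀ n : ℕ, ((n + 1 : ℕ) : ℝ) * (T / (n + 1)) = T := fun n => by
    push_cast; field_simp
  have hh0 : ∀ n : ℕ, 0 ≤ T / (n + 1) := fun n => by positivity
  -- a shift of the index makes the step small
  obtain ⟨N, hN⟩ := exists_nat_ge (2 * T * K)
  have hhK : ∀ n : ℕ, T / ((n + N : ℕ) + 1) * K ≤ 1 / 2 := fun n => by
    rw [div_mul_eq_mul_div, div_le_iff₀ (by positivity)]
    push_cast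
    have : (0 : ℝ) ≤ n := n.cast_nonneg
    linarith
  have hinv : Tendsto (fun n : ℕ => 1 / (((n + N : ℕ) : ℝ) + 1)) atTop (𝓝 0) :=
    (tendsto_add_atTop_iff_nat (f := fun n : ℕ => 1 / ((n : ℝ) + 1)) N).2
      tendsto_one_div_add_atTop_nhds_zero_nat
  set E : ℕ → Plane → Plane := fun n => euler v (T / ((n + N : ℕ) + 1)) (n + N + 1)
  refine measurePreserving_of_tendsto (E := E) (B := T * B)
    (fun n => (continuous_euler (hh0 _) (hnh _).le hv).measurable) (fun x => ?_) (fun n x => ?_)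
    fun f hf hf' => ?_
  · rw [tendsto_iff_norm_sub_tendsto_zero]
    have hexp : ∀ n : ℕ, (1 + T / ((n + N : ℕ) + 1) * K) ^ (n + N + 1) ≤ Real.exp (T * K) :=
      fun n => by
        have h1 := Real.add_one_le_exp (T / ((n + N : ℕ) + 1) * K)
        have h0 := hh0 (n + N)
        calc _ ≤ (Real.exp (T / ((n + N : ℕ) + 1) * K)) ^ (n + N + 1) := by
              gcongr; linarith
          _ = Real.exp (((n + N + 1 : ℕ) : ℝ) * (T / ((n + N : ℕ) + 1)) * K) := by
              rw [← Real.exp_nat_mul, mul_assoc]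
          _ = _ := by rw [hnh (n + N)]
    have hlim : Tendsto (fun n : ℕ => T * ((K' + K * B) * T) * Real.exp (T * K) *
        (1 / (((n + N : ℕ) : ℝ) + 1))) atTop (𝓝 0) := by
      simpa using hinv.const_mul (T * ((K' + K * B) * T) * Real.exp (T * K))
    refine squeeze_zero (fun n => norm_nonneg _) (fun n => ?_) hlim
    have h1 := norm_euler_sub_flow_le (hh0 (n + N)) (hnh (n + N)).le hK' hv hvt hB (hΦ x)
    rw [hnh (n + N), hΦ0] at h1
    refine h1.trans ?_
    have h2 : ((n + N + 1 : ℕ) : ℝ) * ((K' + K * B) * (T / ((n + N : ℕ) + 1)) ^ 2) =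
        T * ((K' + K * B) * T) * (1 / (((n + N : ℕ) : ℝ) + 1)) := by
      push_cast
      field_simp
    rw [h2, mul_right_comm]
    gcongr
    exact hexp n
  · have := norm_euler_sub_le (hh0 (n + N)) (hnh (n + N)).le hB x
    rwa [hnh (n + N)] at this
  · have hbd := fun n : ℕ => lintegral_euler (hh0 (n + N)) (hhK n) (hnh (n + N)).le hv hv' htr
      (fun x => (f x : ℝ≥0∞))
    set δ : ℕ → ℝ := fun n => 2 * (T / ((n + N : ℕ) + 1) * K) ^ 2
    have hδ0 : ∀ n, 0 ≤ δ n := fun n => by positivity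
    have hδ1 : ∀ n, δ n ≤ 1 / 2 := fun n => by
      have h1 := hhK n
      have h2 : 0 ≤ T / ((n + N : ℕ) + 1) * K := mul_nonneg (hh0 (n + N)) K.2
      simp only [δ]
      nlinarith
    have hmδ : Tendsto (fun n : ℕ => ((n + N + 1 : ℕ) : ℝ) * δ n) atTop (𝓝 0) := by
      have h1 : ∀ n : ℕ, ((n + N + 1 : ℕ) : ℝ) * δ n =
          2 * (T * K) ^ 2 * (1 / (((n + N : ℕ) : ℝ) + 1)) := fun n => by
        simp only [δ]; push_cast; field_simp
      simp_rw [h1]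
      simpa using hinv.const_mul (2 * (T * K) ^ 2)
    have ha : Tendsto (fun n => (1 - δ n) ^ (n + N + 1)) atTop (𝓝 1) := by
      have h1 : Tendsto (fun n : ℕ => 1 - ((n + N + 1 : ℕ) : ℝ) * δ n) atTop (𝓝 1) := by
        simpa using hmδ.const_sub 1
      refine tendsto_of_tendsto_of_tendsto_of_le_of_le h1 tendsto_const_nhds (fun n => ?_)
        fun n => pow_le_one₀ (by linarith [hδ1 n]) (by linarith [hδ0 n])
      have := one_add_mul_le_pow (a := -δ n) (by linarith [hδ1 n]) (n + N + 1)
      simpa [sub_eq_add_neg] using this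
    have hb : Tendsto (fun n => (1 + δ n) ^ (n + N + 1)) atTop (𝓝 1) := by
      have h1 : Tendsto (fun n : ℕ => Real.exp (((n + N + 1 : ℕ) : ℝ) * δ n)) atTop (𝓝 1) := by
        have h2 := (Real.continuous_exp.tendsto 0).comp hmδ
        rwa [Real.exp_zero] at h2
      refine tendsto_of_tendsto_of_tendsto_of_le_of_le tendsto_const_nhds h1
        (fun n => one_le_pow₀ (by linarith [hδ0 n])) fun n => ?_
      have := Real.add_one_le_exp (δ n)
      calc (1 + δ n) ^ (n + N + 1) ≤ (Real.exp (δ n)) ^ (n + N + 1) := by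
            have := hδ0 n
            gcongr; linarith
        _ = _ := (Real.exp_nat_mul _ _).symm
    have hlim : ∀ {c : ℕ → ℝ}, Tendsto c atTop (𝓝 1) →
        Tendsto (fun n => ENNReal.ofReal (c n)⁻¹ * ∫⁻ x, (f x : ℝ≥0∞)) atTop
          (𝓝 (∫⁻ x, (f x : ℝ≥0∞))) := fun {c} hc => by
      have h1 := ENNReal.tendsto_ofReal (hc.inv₀ one_ne_zero)
      rw [inv_one, ENNReal.ofReal_one] at h1
      simpa using ENNReal.Tendsto.mul_const (b := ∫⁻ x, (f x : ℝ≥0∞)) h1 (Or.inl one_ne_zero)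
    -- The integral along the Euler maps is squeezed between the exact integral divided by (1 + δ)^m
    -- and by (1 - δ)^m, where m is the number of steps and both powers tend to 1 since m δ → 0.
    refine tendsto_of_tendsto_of_tendsto_of_le_of_le (hlim hb) (hlim ha) (fun n => ?_) fun n => ?_
    · have hpos : 0 < (1 + δ n) ^ (n + N + 1) := pow_pos (by linarith [hδ0 n]) _
      refine (mul_le_mul_right (hbd n).2 _).trans (le_of_eq ?_)
      rw [← mul_assoc, ← ENNReal.ofReal_mul (by positivity), inv_mul_cancel₀ hpos.ne',
        ENNReal.ofReal_one, one_mul]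
    · have hpos : 0 < (1 - δ n) ^ (n + N + 1) := pow_pos (by linarith [hδ1 n]) _
      refine le_trans (le_of_eq ?_) (mul_le_mul_right (hbd n).1 _)
      rw [← mul_assoc, ← ENNReal.ofReal_mul (by positivity), inv_mul_cancel₀ hpos.ne',
        ENNReal.ofReal_one, one_mul]

end

/-! ### The regularized kernel is smooth -/

/-- The derivative of the regularized kernel. -/
noncomputable def kernelDeriv (α ε : ℝ) (x : Plane) : Plane →L[ℝ] Plane :=
  (‖x‖ ^ 2 + ε ^ 2) ^ (-(1 + α)) • perpL +
    ((-(1 + α) * (‖x‖ ^ 2 + ε ^ 2) ^ (-(1 + α) - 1)) • ((2 : ℝ) • innerSL ℝ x)).smulRight (perp x)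

theorem hasFDerivAt_kernel (α : ℝ) {ε : ℝ} (hε : 0 < ε) (x : Plane) :
    HasFDerivAt (kernel α ε) (kernelDeriv α ε x) x := by
  have hpos : ‖x‖ ^ 2 + ε ^ 2 ≠ 0 := by positivity
  have h1 : HasFDerivAt (fun x : Plane => ‖x‖ ^ 2 + ε ^ 2) ((2 : ℝ) • innerSL ℝ x) x := by
    have := (hasStrictFDerivAt_norm_sq x).hasFDerivAt.add_const (ε ^ 2)
    rwa [two_smul, ← two_smul ℝ] at this
  have h2 := h1.rpow_const (p := -(1 + α)) (Or.inl hpos)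
  exact h2.smul perpL.hasFDerivAt

theorem trace_kernelDeriv (α ε : ℝ) (x : Plane) :
    kernelDeriv α ε x (EuclideanSpace.single 0 1) 0 +
      kernelDeriv α ε x (EuclideanSpace.single 1 1) 1 = 0 := by
  simp [kernelDeriv, perpL_apply, perp, PiLp.inner_apply]
  ring

theorem norm_perpL_le : ‖perpL‖ ≤ 1 :=
  ContinuousLinearMap.opNorm_le_bound _ zero_le_one fun x => by
    rw [perpL_apply, norm_perp, one_mul]

theorem profile_le_const {α : ℝ} (hα : 0 < α) {ε : ℝ} (hε : 0 < ε) (r : ℝ) :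
    (r ^ 2 + ε ^ 2) ^ (-(1 + α)) ≤ (ε ^ 2) ^ (-(1 + α)) :=
  Real.rpow_le_rpow_of_nonpos (by positivity) (by nlinarith [sq_nonneg r]) (by linarith)

theorem norm_kernelDeriv_le {α : ℝ} (hα : 0 < α) (hα' : α < 1 / 2) {ε : ℝ} (hε : 0 < ε) (x : Plane) :
    ‖kernelDeriv α ε x‖ ≤ 4 * (ε ^ 2) ^ (-(1 + α)) := by
  have hρ : 0 < ‖x‖ ^ 2 + ε ^ 2 := by positivity
  have hp := profile_le_const hα hε ‖x‖
  have h2 : (‖x‖ ^ 2 + ε ^ 2) ^ (-(1 + α) - 1) * ‖x‖ ^ 2 ≤ (ε ^ 2) ^ (-(1 + α)) := by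
    rw [Real.rpow_sub_one hρ.ne', div_mul_eq_mul_div, div_le_iff₀ hρ]
    gcongr
    nlinarith [sq_nonneg ε]
  refine (norm_add_le _ _).trans ?_
  rw [norm_smul, ContinuousLinearMap.norm_smulRight_apply, norm_smul, norm_smul, norm_perp,
    innerSL_apply_norm, norm_mul, Real.norm_of_nonneg (by positivity), norm_neg,
    Real.norm_of_nonneg (by positivity : 0 ≤ 1 + α), Real.norm_of_nonneg (by positivity),
    Real.norm_of_nonneg zero_le_two]
  calc _ ≤ (ε ^ 2) ^ (-(1 + α)) * 1 +
        (1 + α) * 2 * ((‖x‖ ^ 2 + ε ^ 2) ^ (-(1 + α) - 1) * ‖x‖ ^ 2) := by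
        refine add_le_add (mul_le_mul hp norm_perpL_le (norm_nonneg _) (by positivity))
          (le_of_eq (by ring))
    _ ≤ (ε ^ 2) ^ (-(1 + α)) * 1 + (1 + α) * 2 * (ε ^ 2) ^ (-(1 + α)) := by gcongr
    _ ≤ _ := by
      have : 0 ≤ (ε ^ 2) ^ (-(1 + α)) := by positivity
      nlinarith

/-- A bound for the regularized kernel and for its derivative. -/
noncomputable def kernelBound (α ε : ℝ) : ℝ≥0 :=
  ⟨1 + 4 * (ε ^ 2) ^ (-(1 + α)), by positivity⟩

theorem coe_kernelBound (α ε : ℝ) : (kernelBound α ε : ℝ) = 1 + 4 * (ε ^ 2) ^ (-(1 + α)) := rfl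

theorem norm_kernel_le_kernelBound {α : ℝ} (hα : 0 < α) {ε : ℝ} (hε : 0 < ε) (x : Plane) :
    ‖kernel α ε x‖ ≤ kernelBound α ε := by
  have h0 : 0 ≤ (ε ^ 2) ^ (-(1 + α)) := by positivity
  rw [coe_kernelBound]
  rcases le_total ‖x‖ 1 with h | h
  · rw [kernel, norm_smul, norm_perp, Real.norm_of_nonneg (by positivity)]
    have h1 := mul_le_mul (profile_le_const hα hε ‖x‖) h (norm_nonneg x) h0
    linarith
  · have h1 := norm_kernel_le hα ε x
    have h2 : ‖x‖ ^ (-(1 + 2 * α)) ≤ 1 := Real.rpow_le_one_of_one_le_of_nonpos h (by linarith)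
    linarith

theorem norm_kernelDeriv_le_kernelBound {α : ℝ} (hα : 0 < α) (hα' : α < 1 / 2) {ε : ℝ} (hε : 0 < ε)
    (x : Plane) : ‖kernelDeriv α ε x‖ ≤ kernelBound α ε := by
  rw [coe_kernelBound]
  linarith [norm_kernelDeriv_le hα hα' hε x]

theorem lipschitzWith_kernel {α : ℝ} (hα : 0 < α) (hα' : α < 1 / 2) {ε : ℝ} (hε : 0 < ε) :
    LipschitzWith (kernelBound α ε) (kernel α ε) :=
  lipschitzWith_of_nnnorm_fderiv_le (𝕜 := ℝ)
    (fun x => (hasFDerivAt_kernel α hε x).differentiableAt) fun x => by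
      rw [(hasFDerivAt_kernel α hε x).fderiv]
      exact norm_kernelDeriv_le_kernelBound hα hα' hε x

/-! ### The regularized velocity -/

section

variable {α ε : ℝ} {θ : Plane → ℝ}

theorem integrable_smul_kernel_of_pos (hα : 0 < α) (hε : 0 < ε) (hθ : Integrable θ)
    {a : Plane → Plane} (ha : Measurable a) : Integrable fun y => θ y • kernel α ε (a y) := by
  refine (hθ.norm.mul_const (kernelBound α ε : ℝ)).mono' (hθ.aestronglyMeasurable.smul
    ((measurable_kernel α ε).comp ha).aestronglyMeasurable) (ae_of_all _ fun y => ?_)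
  rw [norm_smul]
  gcongr
  exact norm_kernel_le_kernelBound hα hε _

theorem norm_kernelIntegral_le_of_pos (hα : 0 < α) (hε : 0 < ε) (hθ : Integrable θ)
    (P : Plane → Plane) (p : Plane) :
    ‖kernelIntegral α ε θ P p‖ ≤ kernelBound α ε * ∫ y, ‖θ y‖ := by
  rw [← integral_const_mul]
  refine norm_integral_le_of_norm_le (hθ.norm.const_mul _) (ae_of_all _ fun y => ?_)
  rw [norm_smul, mul_comm]
  gcongr
  exact norm_kernel_le_kernelBound hα hε _

theorem norm_kernelIntegral_sub_le_of_pos (hα : 0 < α) (hα' : α < 1 / 2) (hε : 0 < ε)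
    (hθ : Integrable θ) {P Q : Plane → Plane} (hP : Measurable P) (hQ : Measurable Q) {p q : Plane}
    {D : ℝ} (hD : ∀ y, ‖(p - P y) - (q - Q y)‖ ≤ D) :
    ‖kernelIntegral α ε θ P p - kernelIntegral α ε θ Q q‖ ≤
      kernelBound α ε * (∫ y, ‖θ y‖) * D := by
  rw [kernelIntegral, kernelIntegral, ← integral_sub
    (integrable_smul_kernel_of_pos hα hε hθ (hP.const_sub p))
    (integrable_smul_kernel_of_pos hα hε hθ (hQ.const_sub q)), mul_right_comm, ← integral_const_mul]
  refine norm_integral_le_of_norm_le (hθ.norm.const_mul _) (ae_of_all _ fun y => ?_)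
  rw [← smul_sub, norm_smul, mul_comm]
  gcongr
  exact ((lipschitzWith_kernel hα hα' hε).norm_sub_le _ _).trans (by gcongr; exact hD y)

theorem hasFDerivAt_kernelIntegral (hα : 0 < α) (hα' : α < 1 / 2) (hε : 0 < ε)
    (hθ : Integrable θ) {P : Plane → Plane} (hP : Measurable P) (p : Plane) :
    HasFDerivAt (kernelIntegral α ε θ P) (∫ y, θ y • kernelDeriv α ε (p - P y)) p ∧
      Integrable (fun y => θ y • kernelDeriv α ε (p - P y)) := by
  have hmeas : Measurable (kernelDeriv α ε) := by
    have : kernelDeriv α ε = fderiv ℝ (kernel α ε) := by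
      ext1 x; exact (hasFDerivAt_kernel α hε x).fderiv.symm
    rw [this]; exact measurable_fderiv ℝ _
  have hm : AEStronglyMeasurable (fun y => θ y • kernelDeriv α ε (p - P y)) volume :=
    hθ.aestronglyMeasurable.smul (hmeas.comp (hP.const_sub p)).aestronglyMeasurable
  have hbd : ∀ x y, ‖θ y • kernelDeriv α ε (x - P y)‖ ≤ ‖θ y‖ * kernelBound α ε := fun x y => by
    rw [norm_smul]
    gcongr
    exact norm_kernelDeriv_le_kernelBound hα hα' hε _
  refine ⟨hasFDerivAt_integral_of_dominated_of_fderiv_le (𝕜 := ℝ)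
    (F := fun p y => θ y • kernel α ε (p - P y))
    (F' := fun p y => θ y • kernelDeriv α ε (p - P y)) (s := univ)
    (bound := fun y => ‖θ y‖ * kernelBound α ε) univ_mem (Eventually.of_forall fun x => ?_) ?_ hm
    (ae_of_all _ fun y x _ => hbd x y) (hθ.norm.mul_const _) (ae_of_all _ fun y x _ => ?_),
    (hθ.norm.mul_const _).mono' hm (ae_of_all _ fun y => hbd p y)⟩
  · exact (integrable_smul_kernel_of_pos hα hε hθ (hP.const_sub x)).aestronglyMeasurable
  · exact integrable_smul_kernel_of_pos hα hε hθ (hP.const_sub p)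
  · have h1 := (hasFDerivAt_kernel α hε (x - P y)).comp x ((hasFDerivAt_id x).sub_const (P y))
    exact h1.const_smul (θ y)

/-- The sum of the diagonal entries, as a continuous linear functional. -/
noncomputable def diagSum : (Plane →L[ℝ] Plane) →L[ℝ] ℝ :=
  (EuclideanSpace.proj (0 : Fin 2)).comp
      (ContinuousLinearMap.apply ℝ Plane (EuclideanSpace.single 0 1 : Plane)) +
    (EuclideanSpace.proj (1 : Fin 2)).comp
      (ContinuousLinearMap.apply ℝ Plane (EuclideanSpace.single 1 1 : Plane))

theorem diagSum_apply (A : Plane →L[ℝ] Plane) : diagSum A =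
    A (EuclideanSpace.single 0 1) 0 + A (EuclideanSpace.single 1 1) 1 := rfl

theorem diagSum_integral_kernelDeriv (hα : 0 < α) (hα' : α < 1 / 2) (hε : 0 < ε)
    (hθ : Integrable θ) {P : Plane → Plane} (hP : Measurable P) (p : Plane) :
    diagSum (∫ y, θ y • kernelDeriv α ε (p - P y)) = 0 := by
  rw [← diagSum.integral_comp_comm (hasFDerivAt_kernelIntegral hα hα' hε hθ hP p).2]
  have : ∀ y, diagSum (θ y • kernelDeriv α ε (p - P y)) = 0 := fun y => by
    rw [map_smul, diagSum_apply, trace_kernelDeriv, smul_zero]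
  simp [this]

theorem continuous_kernelIntegral (hα : 0 < α) (hα' : α < 1 / 2) (hε : 0 < ε)
    (hθ : Integrable θ) {P : Plane → Plane} (hP : Measurable P) :
    Continuous (kernelIntegral α ε θ P) :=
  continuous_iff_continuousAt.2 fun p =>
    (hasFDerivAt_kernelIntegral hα hα' hε hθ hP p).1.continuousAt

end

/-! ### The regularized flow -/

/-- The velocity of the regularized flow `x ↦ x + g(x)`. -/
noncomputable def flowField (α ε : ℝ) (θ : Plane → ℝ) (g : Plane → Plane) (x : Plane) : Plane :=
  velocityConst α • kernelIntegral α ε θ (fun y => y + g y) (x + g x)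

/-- `g` solves the regularized equation for the displacement on `[-τ, τ]`. -/
structure IsRegularizedSolution (α ε : ℝ) (θ : Plane → ℝ) (τ : ℝ) (g : ℝ → Plane →ᵇ Plane)
    (g' : ℝ → Plane →ᵇ Plane) : Prop where
  zero : g 0 = 0
  hasDerivAt : ∀ t ∈ Icc (-τ) τ, HasDerivAt g (g' t) t
  eq_flowField : ∀ t ∈ Icc (-τ) τ, ∀ x, g' t x = flowField α ε θ (g t) x

section

variable {α ε : ℝ} {θ : Plane → ℝ}

theorem norm_flowField_le (hα : 0 < α) (hε : 0 < ε) (hθ : Integrable θ) (g : Plane → Plane)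
    (x : Plane) :
    ‖flowField α ε θ g x‖ ≤ |velocityConst α| * (kernelBound α ε * ∫ y, ‖θ y‖) := by
  rw [flowField, norm_smul, Real.norm_eq_abs]
  gcongr
  exact norm_kernelIntegral_le_of_pos hα hε hθ _ _

theorem continuous_flowField (hα : 0 < α) (hα' : α < 1 / 2) (hε : 0 < ε) (hθ : Integrable θ)
    {g : Plane → Plane} (hg : Continuous g) : Continuous (flowField α ε θ g) := by
  have h : Continuous fun y => y + g y := continuous_id.add hg
  exact ((continuous_kernelIntegral hα hα' hε hθ h.measurable).comp h).const_smul (velocityConst α)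

theorem norm_flowField_sub_le (hα : 0 < α) (hα' : α < 1 / 2) (hε : 0 < ε) (hθ : Integrable θ)
    (g h : Plane →ᵇ Plane) (x : Plane) :
    ‖flowField α ε θ g x - flowField α ε θ h x‖ ≤
      |velocityConst α| * (kernelBound α ε * (∫ y, ‖θ y‖) * (2 * ‖g - h‖)) := by
  rw [flowField, flowField, ← smul_sub, norm_smul, Real.norm_eq_abs]
  gcongr
  refine norm_kernelIntegral_sub_le_of_pos hα hα' hε hθ (by fun_prop) (by fun_prop) fun y => ?_
  have hx := (g - h).norm_coe_le_norm x
  have hy := (g - h).norm_coe_le_norm y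
  rw [BoundedContinuousFunction.coe_sub, Pi.sub_apply] at hx hy
  rw [show x + g x - (y + g y) - (x + h x - (y + h y)) = (g x - h x) - (g y - h y) by abel]
  linarith [norm_sub_le (g x - h x) (g y - h y)]

/-- For fixed ε the kernel is bounded and Lipschitz, so the field is bounded and globally Lipschitz
on the Banach space of bounded continuous displacements, and Picard–Lindelöf works on any time
interval. The constants may degenerate as ε → 0. -/
theorem exists_isRegularizedSolution (hα : 0 < α) (hα' : α < 1 / 2) (hε : 0 < ε)
    (hθ : Integrable θ) {τ : ℝ} (hτ : 0 ≤ τ) :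
    ∃ g g' : ℝ → Plane →ᵇ Plane, IsRegularizedSolution α ε θ τ g g' := by
  have hI : 0 ≤ ∫ y, ‖θ y‖ := integral_nonneg fun y => norm_nonneg _
  set V : ℝ≥0 := ⟨|velocityConst α| * (kernelBound α ε * ∫ y, ‖θ y‖), by positivity⟩
  set K : ℝ≥0 := ⟨|velocityConst α| * (kernelBound α ε * (∫ y, ‖θ y‖) * 2), by positivity⟩
  set F : (Plane →ᵇ Plane) → Plane →ᵇ Plane := fun g =>
    BoundedContinuousFunction.ofNormedAddCommGroup (flowField α ε θ g)
      (continuous_flowField hα hα' hε hθ g.continuous) V (norm_flowField_le hα hε hθ g)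
  have hF : ∀ g, ‖F g‖ ≤ V := fun g =>
    BoundedContinuousFunction.norm_ofNormedAddCommGroup_le _ V.2 _
  have hFL : LipschitzWith K F := by
    refine LipschitzWith.of_dist_le_mul fun g h => ?_
    rw [BoundedContinuousFunction.dist_le (by positivity)]
    intro x
    rw [dist_eq_norm, dist_eq_norm]
    refine (norm_flowField_sub_le hα hα' hε hθ g h x).trans (le_of_eq ?_)
    have hK : (K : ℝ) = |velocityConst α| * (kernelBound α ε * (∫ y, ‖θ y‖) * 2) := rfl
    rw [hK]
    ring
  -- The equation is solved on [-τ-1, τ+1] so that the derivatives are two-sided up to the ends of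
  -- [-τ, τ]. The radius V(τ + 1) cannot be exceeded at speed V.
  have hpl : IsPicardLindelof (fun _ : ℝ => F) (tmin := -(τ + 1)) (tmax := τ + 1)
      ⟨0, by linarith, by linarith⟩ 0 (V * (τ + 1).toNNReal) 0 V K := by
    refine IsPicardLindelof.of_time_independent (fun g _ => hF g) hFL.lipschitzOnWith ?_
    simp [(by linarith : 0 ≤ τ + 1)]
  obtain ⟨g, hg0, hg⟩ := hpl.exists_eq_forall_mem_Icc_hasDerivWithinAt₀
  refine ⟨g, fun t => F (g t), hg0, fun t ht => ?_, fun t _ x => rfl⟩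
  exact (hg t ⟨by linarith [ht.1], by linarith [ht.2]⟩).hasDerivAt
    (Icc_mem_nhds (by linarith [ht.1]) (by linarith [ht.2]))

end

/-! ### Quantitative velocity bounds along bi-Lipschitz maps -/

theorem norm_le_of_enorm_le_mul {v : Plane} {a M : ℝ} {d : ℝ≥0∞} (ha : 0 ≤ a) (hM : 0 ≤ M)
    (hv : ‖v‖ₑ ≤ ENNReal.ofReal a * d) (hd : d ≤ ENNReal.ofReal M) : ‖v‖ ≤ a * M := by
  have h : ENNReal.ofReal ‖v‖ ≤ ENNReal.ofReal (a * M) := by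
    rw [ofReal_norm, ENNReal.ofReal_mul ha]
    exact hv.trans (mul_le_mul_right hd _)
  exact (ENNReal.ofReal_le_ofReal_iff (by positivity)).1 h

theorem measurePreserving_symm {Φ : Plane ≃ₜ Plane} (hΦ : MeasurePreserving Φ) :
    MeasurePreserving Φ.symm :=
  MeasurePreserving.symm (e := Φ.toMeasurableEquiv) hΦ

theorem kernelIntegral_comp_symm (α ε : ℝ) (θ : Plane → ℝ) {Φ : Plane ≃ₜ Plane}
    (hΦ : MeasurePreserving Φ) (p : Plane) :
    kernelIntegral α ε (fun x => θ (Φ.symm x)) id p = kernelIntegral α ε θ Φ p := by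
  have := hΦ.integral_comp Φ.measurableEmbedding
    (fun z => θ (Φ.symm z) • kernel α ε (p - z))
  simp only [Homeomorph.symm_apply_apply] at this
  exact this.symm

theorem velocity_eq_kernelIntegral (α : ℝ) (θ : Plane → ℝ) (p : Plane) :
    velocity α θ p = velocityConst α • kernelIntegral α 0 θ id p := by
  rw [velocity, kernelIntegral]
  congr 2
  ext1 y
  rw [kernel, smul_smul, div_eq_mul_inv, zero_pow two_ne_zero, add_zero,
    sq_rpow_neg (norm_nonneg _), ← Real.rpow_neg (norm_nonneg _), id_eq]
  ring_nf

theorem velocity_comp_symm (α : ℝ) (θ : Plane → ℝ) {Φ : Plane ≃ₜ Plane}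
    (hΦ : MeasurePreserving Φ) (p : Plane) :
    velocity α (fun x => θ (Φ.symm x)) p = velocityConst α • kernelIntegral α 0 θ Φ p := by
  rw [velocity_eq_kernelIntegral, kernelIntegral_comp_symm α 0 θ hΦ]

/-- An integrable bounded function whose Dini seminorm is at most `M`. -/
structure IsDiniDensity (α : ℝ) (θ : Plane → ℝ) (A M : ℝ) : Prop where
  integrable : Integrable θ
  abs_le : ∀ x, |θ x| ≤ A
  dini_le : dini α θ ≤ ENNReal.ofReal M
  nonneg : 0 ≤ M

theorem dini_neg (α : ℝ) (θ : Plane → ℝ) : dini α (-θ) = dini α θ := by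
  unfold dini
  congr 1; ext1 x; congr 1; ext1 y
  rw [Pi.neg_apply, Pi.neg_apply, ← enorm_neg (θ x - θ y)]
  congr 2; ring

section

variable {α ε : ℝ} {θ : Plane → ℝ} {A M : ℝ}

theorem IsDiniDensity.neg (h : IsDiniDensity α θ A M) : IsDiniDensity α (-θ) A M :=
  ⟨h.integrable.neg, fun x => by simpa using h.abs_le x, by rw [dini_neg]; exact h.dini_le, h.nonneg⟩

theorem IsDiniDensity.comp_symm (hα : 0 < α) (h : IsDiniDensity α θ A M) {Φ : Plane ≃ₜ Plane}
    (hΦ : MeasurePreserving Φ) {k : ℝ} (hk : 0 < k) (hΦk : ∀ x y, ‖x - y‖ ≤ k * ‖Φ x - Φ y‖) :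
    IsDiniDensity α (fun x => θ (Φ.symm x)) A (k ^ (2 + 2 * α) * M) := by
  have h0 := h.nonneg
  refine ⟨(measurePreserving_symm hΦ).integrable_comp_of_integrable h.integrable,
    fun x => h.abs_le _, ?_, by positivity⟩
  refine (dini_comp_symm_le hα θ hΦ hk hΦk).trans ?_
  rw [ENNReal.ofReal_mul (by positivity)]
  exact mul_le_mul_right h.dini_le _

theorem IsDiniDensity.norm_kernelIntegral_sub_le (hα : 0 < α) (hα' : α < 1 / 2)
    (h : IsDiniDensity α θ A M) (ε : ℝ) (p q : Plane) :
    ‖kernelIntegral α ε θ id p - kernelIntegral α ε θ id q‖ ≤ lipConst α * ‖p - q‖ * M :=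
  norm_le_of_enorm_le_mul (mul_nonneg (lipConst_pos hα').le (norm_nonneg _)) h.nonneg
    (enorm_kernelIntegral_sub_le hα hα' ε h.integrable h.abs_le p q) h.dini_le

theorem IsDiniDensity.norm_velocity_sub_le (hα : 0 < α) (hα' : α < 1 / 2)
    (h : IsDiniDensity α θ A M) (p q : Plane) :
    ‖velocity α θ p - velocity α θ q‖ ≤ |velocityConst α| * lipConst α * M * ‖p - q‖ := by
  rw [velocity_eq_kernelIntegral, velocity_eq_kernelIntegral, ← smul_sub, norm_smul,
    Real.norm_eq_abs]
  have := h.norm_kernelIntegral_sub_le hα hα' 0 p q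
  calc _ ≤ |velocityConst α| * (lipConst α * ‖p - q‖ * M) := by gcongr
    _ = _ := by ring

theorem IsDiniDensity.norm_kernelIntegral_flow_sub_le (hα : 0 < α) (hα' : α < 1 / 2)
    (h : IsDiniDensity α θ A M) (ε : ℝ) {P Q : Plane → Plane}
    (hP : MeasurePreserving P) (hQ : MeasurePreserving Q) {D : ℝ} (hD : ∀ y, ‖P y - Q y‖ ≤ D)
    {k : ℝ} (hk : 0 < k) (hPk : ∀ x y, ‖x - y‖ ≤ k * ‖P x - P y‖)
    (hQk : ∀ x y, ‖x - y‖ ≤ k * ‖Q x - Q y‖) (x : Plane) :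
    ‖kernelIntegral α ε θ P (P x) - kernelIntegral α ε θ Q (Q x)‖ ≤
      8 * D * k ^ (2 + 2 * α) * M := by
  have hD0 : 0 ≤ D := (norm_nonneg _).trans (hD 0)
  exact norm_le_of_enorm_le_mul (by positivity) h.nonneg
    (enorm_kernelIntegral_flow_sub_le hα hα' ε h.integrable h.abs_le hP hQ hD hk hPk hQk x)
    h.dini_le

/-- The rate at which the displacement of the flow loses regularity while it is `1/2`-Lipschitz. -/
noncomputable def lipRate (α M : ℝ) : ℝ := |velocityConst α| * (12 * lipConst α * M)

/-- Here x ↦ x + g(x) is 3/2-Lipschitz with a 2-Lipschitz inverse, so the transported density has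
Dini seminorm at most 8M, and 3/2 · 8 = 12 is the factor in `lipRate`. The rate does not depend on
ε. -/
theorem norm_flowField_sub_le_of_lipschitz (hα : 0 < α) (hα' : α < 1 / 2)
    (h : IsDiniDensity α θ A M) (ε : ℝ) {g : Plane → Plane} (hg : LipschitzWith (1 / 2) g)
    (hmp : MeasurePreserving fun y => y + g y) (x x' : Plane) :
    ‖flowField α ε θ g x - flowField α ε θ g x'‖ ≤ lipRate α M * ‖x - x'‖ := by
  set Φ := idAddHomeomorph hg
  have hΦ : MeasurePreserving Φ := hmp
  have h1 := (h.comp_symm hα hΦ two_pos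
    (norm_sub_le_two_mul_of_lipschitz hg)).norm_kernelIntegral_sub_le hα hα' ε (Φ x) (Φ x')
  rw [kernelIntegral_comp_symm α ε θ hΦ, kernelIntegral_comp_symm α ε θ hΦ] at h1
  have h2 : ‖Φ x - Φ x'‖ ≤ 3 / 2 * ‖x - x'‖ := by
    have e1 := hg.norm_sub_le x x'
    have e2 := norm_add_le (x - x') (g x - g x')
    have e3 : Φ x - Φ x' = (x - x') + (g x - g x') := by
      simp only [Φ, idAddHomeomorph_apply]; abel
    rw [e3]
    push_cast at e1
    linarith
  have h3 := two_rpow_le_eight hα'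
  have h4 := lipConst_pos hα'
  have h5 := h.nonneg
  change ‖velocityConst α • kernelIntegral α ε θ Φ (Φ x) -
    velocityConst α • kernelIntegral α ε θ Φ (Φ x')‖ ≤ _
  rw [← smul_sub, norm_smul, Real.norm_eq_abs]
  calc _ ≤ |velocityConst α| * (lipConst α * (3 / 2 * ‖x - x'‖) * (8 * M)) := by
        gcongr
        exact h1.trans (by gcongr)
    _ = _ := by rw [lipRate]; ring

theorem norm_flowField_sub_flowField_le (hα : 0 < α) (hα' : α < 1 / 2)
    (h : IsDiniDensity α θ A M) (ε : ℝ) {g₁ g₂ : Plane →ᵇ Plane} (hg₁ : LipschitzWith (1 / 2) g₁)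
    (hg₂ : LipschitzWith (1 / 2) g₂) (hmp₁ : MeasurePreserving fun y => y + g₁ y)
    (hmp₂ : MeasurePreserving fun y => y + g₂ y) (x : Plane) :
    ‖flowField α ε θ g₁ x - flowField α ε θ g₂ x‖ ≤ |velocityConst α| * (64 * M) * ‖g₁ - g₂‖ := by
  have h1 := h.norm_kernelIntegral_flow_sub_le hα hα' ε hmp₁ hmp₂ (D := ‖g₁ - g₂‖)
    (fun y => by simpa using (g₁ - g₂).norm_coe_le_norm y) two_pos
    (norm_sub_le_two_mul_of_lipschitz hg₁) (norm_sub_le_two_mul_of_lipschitz hg₂) x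
  have h3 := two_rpow_le_eight hα'
  have h5 := h.nonneg
  rw [flowField, flowField, ← smul_sub, norm_smul, Real.norm_eq_abs]
  calc _ ≤ |velocityConst α| * (8 * ‖g₁ - g₂‖ * 8 * M) := by
        gcongr
        exact h1.trans (by gcongr)
    _ = _ := by ring

end

/-! ### The regularized flow is measure preserving -/

namespace IsRegularizedSolution

variable {α ε : ℝ} {θ : Plane → ℝ} {τ : ℝ} {g g' : ℝ → Plane →ᵇ Plane}

/-- The field is linear in θ, so reversing time amounts to changing the sign of the density.
Negative times thus reduce to positive ones. -/
theorem reverse (h : IsRegularizedSolution α ε θ τ g g') :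
    IsRegularizedSolution α ε (-θ) τ (fun t => g (-t)) (fun t => -g' (-t)) := by
  have hmem : ∀ t ∈ Icc (-τ) τ, -t ∈ Icc (-τ) τ := fun t ht =>
    ⟨by linarith [ht.2], by linarith [ht.1]⟩
  refine ⟨by simpa using h.zero, fun t ht => ?_, fun t ht x => ?_⟩
  · have := (h.hasDerivAt (-t) (hmem t ht)).scomp t (hasDerivAt_neg t)
    rwa [neg_one_smul] at this
  · rw [BoundedContinuousFunction.coe_neg, Pi.neg_apply, h.eq_flowField _ (hmem t ht), flowField,
      flowField, kernelIntegral, kernelIntegral]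
    simp [integral_neg]

theorem hasDerivAt_apply (h : IsRegularizedSolution α ε θ τ g g') {t : ℝ} (ht : t ∈ Icc (-τ) τ)
    (x : Plane) : HasDerivAt (fun s => g s x) (flowField α ε θ (g t) x) t := by
  rw [← h.eq_flowField t ht]
  exact (BoundedContinuousFunction.evalCLM ℝ x).hasFDerivAt.comp_hasDerivAt t (h.hasDerivAt t ht)

theorem norm_sub_le (hα : 0 < α) (hε : 0 < ε) (hθ : Integrable θ)
    (h : IsRegularizedSolution α ε θ τ g g') {s t : ℝ} (hs : s ∈ Icc (-τ) τ)
    (ht : t ∈ Icc (-τ) τ) :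
    ‖g s - g t‖ ≤ |velocityConst α| * (kernelBound α ε * ∫ y, ‖θ y‖) * |s - t| := by
  have hI : 0 ≤ ∫ y, ‖θ y‖ := integral_nonneg fun y => norm_nonneg _
  refine (convex_Icc (-τ) τ).norm_image_sub_le_of_norm_hasDerivWithin_le
    (fun t ht => (h.hasDerivAt t ht).hasDerivWithinAt) (fun t ht => ?_) ht hs
  rw [BoundedContinuousFunction.norm_le (by positivity)]
  intro x
  rw [h.eq_flowField t ht]
  exact norm_flowField_le hα hε hθ _ _

theorem measurePreserving_of_nonneg (hα : 0 < α) (hα' : α < 1 / 2) (hε : 0 < ε)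
    (hθ : Integrable θ) (h : IsRegularizedSolution α ε θ τ g g') {t : ℝ} (ht0 : 0 ≤ t)
    (ht : t ≤ τ) : MeasurePreserving fun y => y + g t y := by
  have hI : 0 ≤ ∫ y, ‖θ y‖ := integral_nonneg fun y => norm_nonneg _
  have hmem : ∀ s ∈ Icc 0 t, s ∈ Icc (-τ) τ := fun s hs => ⟨by linarith [hs.1], by linarith [hs.2]⟩
  set c := |velocityConst α| * (kernelBound α ε * ∫ y, ‖θ y‖)
  have hc : 0 ≤ c := by positivity
  have hm : ∀ s, Measurable fun y => y + g s y := fun s => by fun_prop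
  refine measurePreserving_flow (T := t)
    (v := fun s p => velocityConst α • kernelIntegral α ε θ (fun y => y + g s y) p)
    (v' := fun s p => velocityConst α • ∫ y, θ y • kernelDeriv α ε (p - (y + g s y)))
    (K := ⟨c, hc⟩) (K' := c * c) (B := c) (Φ := fun s y => y + g s y) ht0 (by positivity)
    (fun s _ => LipschitzWith.of_dist_le_mul fun p q => ?_) (fun s hs s' hs' p => ?_)
    (fun s _ p => ?_) (fun s _ p => ?_) (fun s _ p => ?_) (fun x => ?_) fun x s hs => ?_
  · have := norm_kernelIntegral_sub_le_of_pos hα hα' hε hθ (hm s) (hm s) (p := p) (q := q)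
      (D := ‖p - q‖) (fun y => by simp)
    rw [dist_smul₀, Real.norm_eq_abs, dist_eq_norm, dist_eq_norm]
    calc _ ≤ |velocityConst α| * (kernelBound α ε * (∫ y, ‖θ y‖) * ‖p - q‖) := by gcongr
      _ = c * ‖p - q‖ := by ring
  · have := norm_kernelIntegral_sub_le_of_pos hα hα' hε hθ (hm s) (hm s') (p := p) (q := p)
      (D := ‖g s - g s'‖) (fun y => by
        have := (g s - g s').norm_coe_le_norm y
        rw [BoundedContinuousFunction.coe_sub, Pi.sub_apply] at this
        rw [show p - (y + g s y) - (p - (y + g s' y)) = -(g s y - g s' y) by abel, norm_neg]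
        exact this)
    rw [← smul_sub, norm_smul, Real.norm_eq_abs]
    calc _ ≤ |velocityConst α| * (kernelBound α ε * (∫ y, ‖θ y‖) * ‖g s - g s'‖) := by gcongr
      _ = c * ‖g s - g s'‖ := by ring
      _ ≤ c * (c * |s - s'|) := by
          gcongr; exact h.norm_sub_le hα hε hθ (hmem s hs) (hmem s' hs')
      _ = _ := by ring
  · rw [norm_smul, Real.norm_eq_abs]
    simp only [c]
    gcongr
    exact norm_kernelIntegral_le_of_pos hα hε hθ _ _
  · exact (hasFDerivAt_kernelIntegral hα hα' hε hθ (hm s) p).1.const_smul (velocityConst α)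
  · rw [← diagSum_apply, map_smul, diagSum_integral_kernelDeriv hα hα' hε hθ (hm s), smul_zero]
  · simp [h.zero]
  · exact ((h.hasDerivAt_apply (hmem s hs) x).const_add x).hasDerivWithinAt

theorem measurePreserving (hα : 0 < α) (hα' : α < 1 / 2) (hε : 0 < ε)
    (hθ : Integrable θ) (h : IsRegularizedSolution α ε θ τ g g') {t : ℝ} (ht : t ∈ Icc (-τ) τ) :
    MeasurePreserving fun y => y + g t y := by
  rcases le_total 0 t with h0 | h0
  · exact h.measurePreserving_of_nonneg hα hα' hε hθ h0 ht.2
  · have := h.reverse.measurePreserving_of_nonneg hα hα' hε hθ.neg (t := -t) (by linarith)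
      (by linarith [ht.1])
    simpa using this

/-! ### The displacement stays `1/2`-Lipschitz -/

/-- A crude bound with C depending on ε. It serves only to make the Lipschitz constant of the
displacement continuous in time, as the bootstrap in `lipschitzWith_of_nonneg` requires. -/
theorem norm_displacement_sub_le (hα : 0 < α) (hα' : α < 1 / 2) (hε : 0 < ε)
    (hθ : Integrable θ) (h : IsRegularizedSolution α ε θ τ g g') :
    ∃ C : ℝ, 0 ≤ C ∧ ∀ s ∈ Icc 0 τ, ∀ t ∈ Icc 0 τ, ∀ x x',
      ‖(g t x - g t x') - (g s x - g s x')‖ ≤ C * ‖x - x'‖ * |t - s| := by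
  have hI : 0 ≤ ∫ y, ‖θ y‖ := integral_nonneg fun y => norm_nonneg _
  set c := |velocityConst α| * (kernelBound α ε * ∫ y, ‖θ y‖)
  have hc : 0 ≤ c := by positivity
  have hmem : ∀ s ∈ Icc 0 τ, s ∈ Icc (-τ) τ := fun s hs =>
    ⟨by linarith [hs.1, hs.2], hs.2⟩
  have hm : ∀ s, Measurable fun y => y + g s y := fun s => by fun_prop
  have hfield : ∀ s x x', ‖flowField α ε θ (g s) x - flowField α ε θ (g s) x'‖ ≤
      c * ‖(x - x') + (g s x - g s x')‖ := fun s x x' => by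
    have := norm_kernelIntegral_sub_le_of_pos hα hα' hε hθ (hm s) (hm s) (p := x + g s x)
      (q := x' + g s x') (D := ‖(x - x') + (g s x - g s x')‖) (fun y => le_of_eq (by
        congr 1; abel))
    rw [flowField, flowField, ← smul_sub, norm_smul, Real.norm_eq_abs]
    calc _ ≤ |velocityConst α| * (kernelBound α ε * (∫ y, ‖θ y‖) *
          ‖(x - x') + (g s x - g s x')‖) := by gcongr
      _ = _ := by ring
  have hd : ∀ s ∈ Icc 0 τ, ∀ x x', HasDerivAt (fun s => g s x - g s x')
      (flowField α ε θ (g s) x - flowField α ε θ (g s) x') s := fun s hs x x' =>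
    (h.hasDerivAt_apply (hmem s hs) x).sub (h.hasDerivAt_apply (hmem s hs) x')
  have hgr : ∀ s ∈ Icc 0 τ, ∀ x x', ‖(x - x') + (g s x - g s x')‖ ≤
      ‖x - x'‖ * Real.exp (c * τ) := fun s hs x x' => by
    have hsub : uIcc 0 s ⊆ Icc 0 τ := by
      rw [uIcc_of_le hs.1]; exact Icc_subset_Icc le_rfl hs.2
    have h1 := norm_le_mul_exp_of_hasDerivAt (s := 0) (r := s) (K := c)
      (f := fun s => (x - x') + (g s x - g s x'))
      (fun t ht => (hd t (hsub ht) x x').const_add (x - x')) (fun t _ => hfield t x x')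
    simp only [h.zero, BoundedContinuousFunction.coe_zero, Pi.zero_apply, sub_zero, add_zero] at h1
    refine h1.trans ?_
    rw [abs_of_nonneg hs.1]
    have := hs.2
    gcongr
  refine ⟨c * Real.exp (c * τ), by positivity, fun s hs t ht x x' => ?_⟩
  refine (convex_Icc 0 τ).norm_image_sub_le_of_norm_hasDerivWithin_le
    (fun t ht => (hd t ht x x').hasDerivWithinAt) (fun t ht => ?_) hs ht
  refine (hfield t x x').trans ?_
  calc _ ≤ c * (‖x - x'‖ * Real.exp (c * τ)) := by gcongr; exact hgr t ht x x'
    _ = _ := by ring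

/-- Bootstrap in time steps of length δ. If the displacement is 1/4-Lipschitz up to time k δ, the
crude bound keeps it 1/2-Lipschitz one step longer. On that range the rate `lipRate`, which does not
depend on ε, applies from time 0 and restores the constant 1/4, because `lipRate α M * τ ≤ 1 / 4`.
-/
theorem lipschitzWith_of_nonneg (hα : 0 < α) (hα' : α < 1 / 2) (hε : 0 < ε) {A M : ℝ}
    (hθ : IsDiniDensity α θ A M) (h : IsRegularizedSolution α ε θ τ g g')
    (hτ : lipRate α M * τ ≤ 1 / 4) {t : ℝ} (ht : t ∈ Icc 0 τ) :
    ∀ x x', ‖g t x - g t x'‖ ≤ 1 / 4 * ‖x - x'‖ := by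
  obtain ⟨C, hC, hlip⟩ := h.norm_displacement_sub_le hα hα' hε hθ.integrable
  have hrate : 0 ≤ lipRate α M := by
    have := lipConst_pos hα'
    have := hθ.nonneg
    unfold lipRate; positivity
  set δ := 1 / (4 * (C + 1))
  have hδ : 0 < δ := by positivity
  have hCδ : C * δ ≤ 1 / 4 := by
    simp only [δ]
    rw [mul_one_div, div_le_div_iff₀ (by positivity) (by positivity)]
    linarith
  have hmem : ∀ s ∈ Icc 0 τ, s ∈ Icc (-τ) τ := fun s hs =>
    ⟨by linarith [hs.1, hs.2], hs.2⟩
  have key : ∀ k : ℕ, ∀ t ∈ Icc 0 τ, t ≤ k * δ → ∀ x x', ‖g t x - g t x'‖ ≤ 1 / 4 * ‖x - x'‖ := by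
    intro k
    induction k with
    | zero =>
      intro t ht htk x x'
      have : t = 0 := le_antisymm (by simpa using htk) ht.1
      subst this
      simp only [h.zero, BoundedContinuousFunction.coe_zero, Pi.zero_apply, sub_self, norm_zero]
      positivity
    | succ k ih =>
      intro t ht htk x x'
      push_cast at htk
      have hhalf : ∀ s ∈ Icc 0 t, LipschitzWith (1 / 2) (g s) := fun s hs => by
        have hsτ : s ∈ Icc 0 τ := ⟨hs.1, hs.2.trans ht.2⟩
        refine LipschitzWith.of_dist_le_mul fun y y' => ?_
        rw [dist_eq_norm, dist_eq_norm]
        push_cast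
        rcases le_total s (k * δ) with hsk | hsk
        · exact (ih s hsτ hsk y y').trans (by gcongr; norm_num)
        · have hk : (k * δ : ℝ) ∈ Icc 0 τ := ⟨by positivity, hsk.trans hsτ.2⟩
          have h1 := ih _ hk le_rfl y y'
          have h2 := hlip _ hk s hsτ y y'
          have h3 : |s - k * δ| ≤ δ := by
            rw [abs_of_nonneg (by linarith)]; linarith [hs.2]
          have h4 : C * ‖y - y'‖ * |s - k * δ| ≤ 1 / 4 * ‖y - y'‖ := by
            calc _ ≤ C * ‖y - y'‖ * δ := by gcongr
              _ = C * δ * ‖y - y'‖ := by ring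
              _ ≤ _ := by gcongr
          have h5 := norm_add_le (g (k * δ) y - g (k * δ) y')
            ((g s y - g s y') - (g (k * δ) y - g (k * δ) y'))
          rw [add_sub_cancel] at h5
          linarith
      have hfin := (convex_Icc 0 t).norm_image_sub_le_of_norm_hasDerivWithin_le
        (f := fun s => g s x - g s x')
        (f' := fun s => flowField α ε θ (g s) x - flowField α ε θ (g s) x')
        (C := lipRate α M * ‖x - x'‖)
        (fun s hs => by
          have hsτ := hmem s ⟨hs.1, hs.2.trans ht.2⟩
          exact ((h.hasDerivAt_apply hsτ x).sub (h.hasDerivAt_apply hsτ x')).hasDerivWithinAt)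
        (fun s hs => norm_flowField_sub_le_of_lipschitz hα hα' hθ ε (hhalf s hs)
          (h.measurePreserving hα hα' hε hθ.integrable (hmem s ⟨hs.1, hs.2.trans ht.2⟩)) x x')
        (left_mem_Icc.2 ht.1) (right_mem_Icc.2 ht.1)
      simp only [h.zero, BoundedContinuousFunction.coe_zero, Pi.zero_apply, sub_self, sub_zero,
        Real.norm_of_nonneg ht.1] at hfin
      refine hfin.trans ?_
      calc lipRate α M * ‖x - x'‖ * t ≤ lipRate α M * ‖x - x'‖ * τ := by gcongr; exact ht.2
        _ = lipRate α M * τ * ‖x - x'‖ := by ring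
        _ ≤ _ := by gcongr
  obtain ⟨k, hk⟩ := exists_nat_ge (t / δ)
  exact key k t ht ((div_le_iff₀ hδ).1 hk)

theorem lipschitzWith (hα : 0 < α) (hα' : α < 1 / 2) (hε : 0 < ε) {A M : ℝ}
    (hθ : IsDiniDensity α θ A M) (h : IsRegularizedSolution α ε θ τ g g')
    (hτ : lipRate α M * τ ≤ 1 / 4) {t : ℝ} (ht : t ∈ Icc (-τ) τ) : LipschitzWith (1 / 2) (g t) := by
  have key : ∀ x x', ‖g t x - g t x'‖ ≤ 1 / 4 * ‖x - x'‖ := by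
    rcases le_total 0 t with h0 | h0
    · exact h.lipschitzWith_of_nonneg hα hα' hε hθ hτ ⟨h0, ht.2⟩
    · have := h.reverse.lipschitzWith_of_nonneg hα hα' hε hθ.neg hτ (t := -t)
        ⟨by linarith, by linarith [ht.1]⟩
      simpa using this
  refine LipschitzWith.of_dist_le_mul fun x x' => ?_
  rw [dist_eq_norm, dist_eq_norm]
  push_cast
  exact (key x x').trans (by gcongr; norm_num)

end IsRegularizedSolution

/-! ### Removing the regularization -/

section

variable {α : ℝ}

theorem norm_kernel_sub_kernel_zero (ε : ℝ) (w : Plane) :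
    ‖kernel α ε w - kernel α 0 w‖ =
      |(‖w‖ ^ 2 + ε ^ 2) ^ (-(1 + α)) - (‖w‖ ^ 2) ^ (-(1 + α))| * ‖w‖ := by
  rw [kernel, kernel, zero_pow two_ne_zero, add_zero, ← sub_smul, norm_smul, norm_perp,
    Real.norm_eq_abs]

theorem norm_kernel_sub_kernel_zero_le (hα : 0 < α) (ε : ℝ) (w : Plane) :
    ‖kernel α ε w - kernel α 0 w‖ ≤ ‖w‖ ^ (-(1 + 2 * α)) := by
  rcases eq_or_ne w 0 with rfl | hw
  · rw [kernel_zero_right, kernel_zero_right, sub_zero, norm_zero]; positivity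
  have hw' : 0 < ‖w‖ := norm_pos_iff.2 hw
  have h1 : (‖w‖ ^ 2 + ε ^ 2) ^ (-(1 + α)) ≤ (‖w‖ ^ 2) ^ (-(1 + α)) :=
    Real.rpow_le_rpow_of_nonpos (by positivity) (by nlinarith [sq_nonneg ε]) (by linarith)
  have h2 : 0 ≤ (‖w‖ ^ 2 + ε ^ 2) ^ (-(1 + α)) := by positivity
  have h3 := norm_kernel_le hα 0 w
  rw [kernel, zero_pow two_ne_zero, add_zero, norm_smul, norm_perp,
    Real.norm_of_nonneg (by positivity)] at h3
  rw [norm_kernel_sub_kernel_zero, abs_sub_comm, abs_of_nonneg (by linarith)]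
  refine le_trans ?_ h3
  gcongr
  linarith

/-- Bernoulli's inequality with exponent 1 + α ≤ 2 for the ratio |w|²/(|w|² + ε²), whose distance
from 1 is at most ε² when |w| ≥ 1. -/
theorem norm_kernel_sub_kernel_zero_le_of_one_le (hα : 0 < α) (hα' : α < 1 / 2) (ε : ℝ) {w : Plane}
    (hw : 1 ≤ ‖w‖) : ‖kernel α ε w - kernel α 0 w‖ ≤ 2 * ε ^ 2 := by
  set R := ‖w‖ ^ 2
  set ρ := R + ε ^ 2
  have hR1 : 1 ≤ R := one_le_pow₀ hw
  have hR : 0 < R := by linarith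
  have hρ : 0 < ρ := by positivity
  have hbern : 1 + (1 + α) * (R / ρ - 1) ≤ (R / ρ) ^ (1 + α) := by
    have := one_add_mul_self_le_rpow_one_add (s := R / ρ - 1) (p := 1 + α)
      (by have : 0 < R / ρ := by positivity
          linarith) (by linarith)
    simpa using this
  have hdiv : ρ ^ (-(1 + α)) = R ^ (-(1 + α)) * (R / ρ) ^ (1 + α) := by
    rw [Real.div_rpow hR.le hρ.le, Real.rpow_neg hρ.le, Real.rpow_neg hR.le]
    field_simp
  have h1 : ρ ^ (-(1 + α)) ≤ R ^ (-(1 + α)) :=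
    Real.rpow_le_rpow_of_nonpos hR (by simp only [ρ]; nlinarith [sq_nonneg ε]) (by linarith)
  have hone : R ^ (-(1 + α)) * ‖w‖ ≤ 1 := by
    have h2 := norm_kernel_le hα 0 w
    rw [kernel, zero_pow two_ne_zero, add_zero, norm_smul, norm_perp,
      Real.norm_of_nonneg (by positivity)] at h2
    exact h2.trans (Real.rpow_le_one_of_one_le_of_nonpos hw (by linarith))
  have hfrac : R / ρ - 1 = -(ε ^ 2 / ρ) := by
    simp only [ρ]; field_simp; ring
  have hle : ε ^ 2 / ρ ≤ ε ^ 2 := div_le_self (sq_nonneg ε) (by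
    simp only [ρ]; nlinarith [sq_nonneg ε])
  have h0 : 0 ≤ ε ^ 2 / ρ := by positivity
  rw [norm_kernel_sub_kernel_zero, abs_sub_comm, abs_of_nonneg (by linarith)]
  rw [hfrac] at hbern
  have h3 : 1 - (R / ρ) ^ (1 + α) ≤ 2 * ε ^ 2 := by nlinarith
  calc (R ^ (-(1 + α)) - ρ ^ (-(1 + α))) * ‖w‖
      = (R ^ (-(1 + α)) * ‖w‖) * (1 - (R / ρ) ^ (1 + α)) := by rw [hdiv]; ring
    _ ≤ (R ^ (-(1 + α)) * ‖w‖) * (2 * ε ^ 2) := by gcongr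
    _ ≤ 1 * (2 * ε ^ 2) := by gcongr
    _ = _ := one_mul _

theorem tendsto_kernel_zero (w : Plane) {e : ℕ → ℝ} (he : Tendsto e atTop (𝓝 0)) :
    Tendsto (fun n => ‖kernel α (e n) w - kernel α 0 w‖) atTop (𝓝 0) := by
  rcases eq_or_ne w 0 with rfl | hw
  · simp [kernel_zero_right]
  have hw' : 0 < ‖w‖ := norm_pos_iff.2 hw
  rw [← tendsto_iff_norm_sub_tendsto_zero]
  have hc : ContinuousAt (fun ε : ℝ => kernel α ε w) 0 := by
    refine ContinuousAt.smul (ContinuousAt.rpow_const (by fun_prop) (Or.inl ?_)) continuousAt_const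
    positivity
  exact hc.tendsto.comp he

/-- A bound for the error made by regularizing the velocity. -/
noncomputable def regularizationError (α ε : ℝ) (θ : Plane → ℝ) (A : ℝ) : ℝ :=
  A * (∫ w, (Metric.ball (0 : Plane) 1).indicator
    (fun w => ‖kernel α ε w - kernel α 0 w‖) w) + 2 * ε ^ 2 * ∫ y, |θ y|

theorem integrable_indicator_kernel_sub (hα : 0 < α) (hα' : α < 1 / 2) (ε : ℝ) :
    Integrable ((Metric.ball (0 : Plane) 1).indicator
      fun w => ‖kernel α ε w - kernel α 0 w‖) := by
  refine (integrable_indicator_ball_norm_rpow hα' one_pos).mono'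
    ((((measurable_kernel α ε).sub (measurable_kernel α 0)).norm).indicator
      measurableSet_ball).aestronglyMeasurable (ae_of_all _ fun w => ?_)
  rw [norm_indicator_eq_indicator_norm]
  refine indicator_le_indicator ?_
  rw [norm_norm]
  exact norm_kernel_sub_kernel_zero_le hα ε w

theorem tendsto_regularizationError (hα : 0 < α) (hα' : α < 1 / 2) (θ : Plane → ℝ) (A : ℝ)
    {e : ℕ → ℝ} (he : Tendsto e atTop (𝓝 0)) :
    Tendsto (fun n => regularizationError α (e n) θ A) atTop (𝓝 0) := by
  have h1 : Tendsto (fun n => ∫ w, (Metric.ball (0 : Plane) 1).indicator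
      (fun w => ‖kernel α (e n) w - kernel α 0 w‖) w) atTop (𝓝 (∫ _ : Plane, (0 : ℝ))) := by
    refine tendsto_integral_of_dominated_convergence _
      (fun n => (integrable_indicator_kernel_sub hα hα' (e n)).aestronglyMeasurable)
      (integrable_indicator_ball_norm_rpow (α := α) hα' one_pos)
      (fun n => ae_of_all _ fun w => ?_) (ae_of_all _ fun w => ?_)
    · rw [norm_indicator_eq_indicator_norm]
      refine indicator_le_indicator ?_
      rw [norm_norm]
      exact norm_kernel_sub_kernel_zero_le hα (e n) w
    · by_cases hw : w ∈ Metric.ball (0 : Plane) 1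
      · simpa only [indicator_of_mem hw] using tendsto_kernel_zero w he
      · simp only [indicator_of_notMem hw, tendsto_const_nhds_iff]
  have h2 : Tendsto (fun n => 2 * e n ^ 2 * ∫ y, |θ y|) atTop (𝓝 0) := by
    simpa using ((he.pow 2).const_mul 2).mul_const (∫ y, |θ y|)
  simpa [regularizationError] using (h1.const_mul A).add h2

variable {θ : Plane → ℝ} {A M : ℝ}

theorem IsDiniDensity.bound_nonneg (h : IsDiniDensity α θ A M) : 0 ≤ A :=
  (abs_nonneg _).trans (h.abs_le 0)

theorem regularizationError_nonneg (h : IsDiniDensity α θ A M) (ε : ℝ) :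
    0 ≤ regularizationError α ε θ A := by
  have hA := h.bound_nonneg
  have h1 : 0 ≤ ∫ w, (Metric.ball (0 : Plane) 1).indicator
      (fun w => ‖kernel α ε w - kernel α 0 w‖) w :=
    integral_nonneg fun w => indicator_nonneg (fun _ _ => norm_nonneg _) w
  have h2 : 0 ≤ ∫ y, |θ y| := integral_nonneg fun y => abs_nonneg _
  unfold regularizationError
  positivity

/-- Inside the unit ball the error of the kernel is integrated against |θ| ≤ A, and P preserves
measure; outside, it is at most 2ε² and is integrated against θ in L¹. The bound is therefore the
same for all P and p. -/
theorem norm_kernelIntegral_sub_zero_le (hα : 0 < α) (hα' : α < 1 / 2) (h : IsDiniDensity α θ A M)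
    (ε : ℝ) {P : Plane → Plane} (hP : MeasurePreserving P) (p : Plane) :
    ‖kernelIntegral α ε θ P p - kernelIntegral α 0 θ P p‖ ≤ regularizationError α ε θ A := by
  have ha := measurePreserving_sub hP p
  have hA := h.bound_nonneg
  have h1 := integrable_indicator_kernel_sub hα hα' ε
  have h2 : Integrable fun y => (Metric.ball (0 : Plane) 1).indicator
      (fun w => ‖kernel α ε w - kernel α 0 w‖) (p - P y) := ha.integrable_comp_of_integrable h1
  have h3 : ∫ w, (Metric.ball (0 : Plane) 1).indicator
      (fun w => ‖kernel α ε w - kernel α 0 w‖) w =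
      ∫ y, (Metric.ball (0 : Plane) 1).indicator
        (fun w => ‖kernel α ε w - kernel α 0 w‖) (p - P y) := by
    have := integral_map (μ := volume) ha.measurable.aemeasurable
      (f := (Metric.ball (0 : Plane) 1).indicator fun w => ‖kernel α ε w - kernel α 0 w‖)
      (by rw [ha.map_eq]; exact h1.aestronglyMeasurable)
    rwa [ha.map_eq] at this
  rw [regularizationError, h3, ← integral_const_mul, ← integral_const_mul,
    ← integral_add (h2.const_mul A) (h.integrable.abs.const_mul _), kernelIntegral, kernelIntegral,
    ← integral_sub (integrable_smul_kernel hα hα' ε h.integrable h.abs_le ha)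
      (integrable_smul_kernel hα hα' 0 h.integrable h.abs_le ha)]
  refine norm_integral_le_of_norm_le ((h2.const_mul A).add (h.integrable.abs.const_mul _))
    (ae_of_all _ fun y => ?_)
  rw [← smul_sub, norm_smul, Real.norm_eq_abs]
  have hθy := h.abs_le y
  have hθ0 := abs_nonneg (θ y)
  by_cases hy : p - P y ∈ Metric.ball (0 : Plane) 1
  · rw [indicator_of_mem hy]
    have : 0 ≤ 2 * ε ^ 2 * |θ y| := by positivity
    have h4 := mul_le_mul_of_nonneg_right hθy
      (norm_nonneg (kernel α ε (p - P y) - kernel α 0 (p - P y)))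
    linarith
  · rw [indicator_of_notMem hy, mul_zero, zero_add, mul_comm]
    gcongr
    exact norm_kernel_sub_kernel_zero_le_of_one_le hα hα' ε (by simpa using hy)

theorem norm_flowField_sub_zero_le (hα : 0 < α) (hα' : α < 1 / 2) (h : IsDiniDensity α θ A M)
    (ε : ℝ) {g : Plane → Plane} (hg : MeasurePreserving fun y => y + g y) (x : Plane) :
    ‖flowField α ε θ g x - flowField α 0 θ g x‖ ≤
      |velocityConst α| * regularizationError α ε θ A := by
  rw [flowField, flowField, ← smul_sub, norm_smul, Real.norm_eq_abs]
  gcongr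
  exact norm_kernelIntegral_sub_zero_le hα hα' h ε hg _

/-! ### Local existence -/

/-- Both fields are compared with the unregularized one, which is Lipschitz in the displacement with
a constant independent of ε. Gronwall then works in the uniform norm, because the regularized
solutions are differentiable as curves of bounded continuous maps. -/
theorem IsRegularizedSolution.norm_sub_regularizedSolution_le (hα : 0 < α) (hα' : α < 1 / 2)
    (h : IsDiniDensity α θ A M) {τ ε₁ ε₂ : ℝ} (hε₁ : 0 < ε₁) (hε₂ : 0 < ε₂)
    (hτ : lipRate α M * τ ≤ 1 / 4) {g₁ g₁' g₂ g₂' : ℝ → Plane →ᵇ Plane}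
    (h₁ : IsRegularizedSolution α ε₁ θ τ g₁ g₁') (h₂ : IsRegularizedSolution α ε₂ θ τ g₂ g₂')
    {t : ℝ} (ht : t ∈ Icc (-τ) τ) :
    ‖g₁ t - g₂ t‖ ≤ |velocityConst α| * Real.exp ((|velocityConst α| * (64 * M) + 1) * τ) *
      (regularizationError α ε₁ θ A + regularizationError α ε₂ θ A) := by
  have hM := h.nonneg
  -- The added 1 makes K ≥ 1, so that the division by K in the Gronwall bound does no harm.
  set K := |velocityConst α| * (64 * M) + 1
  have hK : 1 ≤ K := by
    have : 0 ≤ |velocityConst α| * (64 * M) := by positivity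
    simp only [K]; linarith
  set e₁ := regularizationError α ε₁ θ A
  set e₂ := regularizationError α ε₂ θ A
  have he₁ : 0 ≤ e₁ := regularizationError_nonneg h ε₁
  have he₂ : 0 ≤ e₂ := regularizationError_nonneg h ε₂
  have h0 : (0 : ℝ) ∈ Icc (-τ) τ := ⟨by linarith [ht.1, ht.2], by linarith [ht.1, ht.2]⟩
  have hsub : uIcc 0 t ⊆ Icc (-τ) τ := uIcc_subset_Icc h0 ht
  have hgr := norm_le_gronwallBound_of_hasDerivAt (s := 0) (r := t) (K := K)
    (δ := |velocityConst α| * (e₁ + e₂)) (f := fun s => g₁ s - g₂ s)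
    (fun s hs => (h₁.hasDerivAt s (hsub hs)).sub (h₂.hasDerivAt s (hsub hs))) (fun s hs => by
      have hs' := hsub hs
      have m₁ := h₁.measurePreserving hα hα' hε₁ h.integrable hs'
      have m₂ := h₂.measurePreserving hα hα' hε₂ h.integrable hs'
      have l₁ := h₁.lipschitzWith hα hα' hε₁ h hτ hs'
      have l₂ := h₂.lipschitzWith hα hα' hε₂ h hτ hs'
      rw [BoundedContinuousFunction.norm_le (by positivity)]
      intro x
      rw [BoundedContinuousFunction.coe_sub, Pi.sub_apply, h₁.eq_flowField s hs',
        h₂.eq_flowField s hs']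
      have b₁ := norm_flowField_sub_zero_le hα hα' h ε₁ m₁ x
      have b₂ := norm_flowField_sub_zero_le hα hα' h ε₂ m₂ x
      have b₃ := norm_flowField_sub_flowField_le hα hα' h 0 l₁ l₂ m₁ m₂ x
      rw [norm_sub_rev] at b₂
      have n := norm_add₃_le (a := flowField α ε₁ θ (g₁ s) x - flowField α 0 θ (g₁ s) x)
        (b := flowField α 0 θ (g₁ s) x - flowField α 0 θ (g₂ s) x)
        (c := flowField α 0 θ (g₂ s) x - flowField α ε₂ θ (g₂ s) x)
      rw [show flowField α ε₁ θ (g₁ s) x - flowField α 0 θ (g₁ s) x +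
        (flowField α 0 θ (g₁ s) x - flowField α 0 θ (g₂ s) x) +
        (flowField α 0 θ (g₂ s) x - flowField α ε₂ θ (g₂ s) x) =
        flowField α ε₁ θ (g₁ s) x - flowField α ε₂ θ (g₂ s) x by abel] at n
      have : K * ‖g₁ s - g₂ s‖ = |velocityConst α| * (64 * M) * ‖g₁ s - g₂ s‖ + ‖g₁ s - g₂ s‖ := by
        simp only [K]; ring
      linarith [norm_nonneg (g₁ s - g₂ s)])
  rw [h₁.zero, h₂.zero, sub_zero, norm_zero, gronwallBound_of_K_ne_0 (by linarith)] at hgr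
  refine hgr.trans ?_
  have ht' : |t - 0| ≤ τ := by rw [sub_zero]; exact abs_le.2 ht
  have hb : 0 ≤ |velocityConst α| * (e₁ + e₂) := by positivity
  simp only [zero_mul, zero_add]
  calc |velocityConst α| * (e₁ + e₂) / K * (Real.exp (K * |t - 0|) - 1)
      ≤ |velocityConst α| * (e₁ + e₂) * Real.exp (K * τ) := by
        refine mul_le_mul (div_le_self hb hK) ?_ ?_ hb
        · have : Real.exp (K * |t - 0|) ≤ Real.exp (K * τ) := by gcongr
          linarith
        · have : 0 ≤ K * |t - 0| := by positivity
          linarith [Real.one_le_exp this]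
    _ = _ := by ring

/-- The displacement of a flow on `(-τ, τ)`, for the velocity without regularization. -/
theorem exists_displacement (hα : 0 < α) (hα' : α < 1 / 2) (h : IsDiniDensity α θ A M) {τ : ℝ}
    (hτ0 : 0 < τ) (hτ : lipRate α M * τ ≤ 1 / 4) :
    ∃ g : ℝ → Plane → Plane, (∀ x, g 0 x = 0) ∧ (∀ t ∈ Ioo (-τ) τ, LipschitzWith (1 / 2) (g t)) ∧
      (∀ t ∈ Ioo (-τ) τ, MeasurePreserving fun y => y + g t y) ∧
      ∀ t ∈ Ioo (-τ) τ, ∀ x, HasDerivAt (fun s => g s x) (flowField α 0 θ (g t) x) t := by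
  set e : ℕ → ℝ := fun n => 1 / ((n : ℝ) + 1)
  have he0 : ∀ n, 0 < e n := fun n => by positivity
  have hlim : Tendsto e atTop (𝓝 0) := tendsto_one_div_add_atTop_nhds_zero_nat
  choose g g' hg using fun n => exists_isRegularizedSolution hα hα' (he0 n) h.integrable hτ0.le
  set r : ℕ → ℝ := fun n => regularizationError α (e n) θ A
  have hr : Tendsto r atTop (𝓝 0) := tendsto_regularizationError hα hα' θ A hlim
  set G := |velocityConst α| * Real.exp ((|velocityConst α| * (64 * M) + 1) * τ)
  have hdist : ∀ t ∈ Icc (-τ) τ, ∀ n m, ‖g n t - g m t‖ ≤ G * (r n + r m) := fun t ht n m =>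
    (hg n).norm_sub_regularizedSolution_le hα hα' h (he0 n) (he0 m) hτ (hg m) ht
  have hcauchy : ∀ t ∈ Icc (-τ) τ, CauchySeq fun n => g n t := fun t ht => by
    rw [cauchySeq_iff_tendsto_dist_atTop_0]
    have h1 : Tendsto (fun n : ℕ × ℕ => G * (r n.1 + r n.2)) atTop (𝓝 0) := by
      rw [← prod_atTop_atTop_eq]
      simpa using ((hr.comp tendsto_fst).add (hr.comp tendsto_snd)).const_mul G
    refine squeeze_zero (fun _ => dist_nonneg) (fun n => ?_) h1
    rw [dist_eq_norm]
    exact hdist t ht n.1 n.2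
  have hex : ∀ t, ∃ f : Plane →ᵇ Plane, t ∈ Icc (-τ) τ → Tendsto (fun n => g n t) atTop (𝓝 f) :=
    fun t => by
      by_cases ht : t ∈ Icc (-τ) τ
      · obtain ⟨f, hf⟩ := cauchySeq_tendsto_of_complete (hcauchy t ht)
        exact ⟨f, fun _ => hf⟩
      · exact ⟨0, fun h => absurd h ht⟩
  choose γ hγ using hex
  have hclose : ∀ t ∈ Icc (-τ) τ, ∀ n, ‖g n t - γ t‖ ≤ G * r n := fun t ht n => by
    have h1 : Tendsto (fun m => ‖g n t - g m t‖) atTop (𝓝 ‖g n t - γ t‖) :=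
      ((hγ t ht).const_sub _).norm
    have h2 : Tendsto (fun m => G * (r n + r m)) atTop (𝓝 (G * r n)) := by
      simpa using (hr.const_add (r n)).const_mul G
    exact le_of_tendsto_of_tendsto' h1 h2 (hdist t ht n)
  have hpt : ∀ t ∈ Icc (-τ) τ, ∀ x, Tendsto (fun n => g n t x) atTop (𝓝 (γ t x)) := fun t ht x =>
    ((BoundedContinuousFunction.evalCLM ℝ x).continuous.tendsto _).comp (hγ t ht)
  have hlip : ∀ t ∈ Icc (-τ) τ, LipschitzWith (1 / 2) (γ t) := fun t ht =>
    LipschitzWith.of_dist_le_mul fun x y =>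
      le_of_tendsto ((hpt t ht x).dist (hpt t ht y)) (Eventually.of_forall fun n =>
        ((hg n).lipschitzWith hα hα' (he0 n) h hτ ht).dist_le_mul x y)
  have hmp' : ∀ n, ∀ t ∈ Icc (-τ) τ, MeasurePreserving fun y => y + g n t y := fun n t ht =>
    (hg n).measurePreserving hα hα' (he0 n) h.integrable ht
  have hmp : ∀ t ∈ Icc (-τ) τ, MeasurePreserving fun y => y + γ t y := fun t ht => by
    obtain ⟨B, hB⟩ := (Metric.isBounded_range_of_tendsto _ (hγ t ht)).exists_norm_le
    refine measurePreserving_of_tendsto (E := fun n y => y + g n t y) (B := B)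
      (fun n => (hmp' n t ht).measurable) (fun x => (hpt t ht x).const_add x) (fun n x => ?_)
      fun f hf _ => ?_
    · rw [add_sub_cancel_left]
      exact ((g n t).norm_coe_le_norm x).trans (hB _ (mem_range_self n))
    · have : ∀ n, ∫⁻ x, (f (x + g n t x) : ℝ≥0∞) = ∫⁻ x, (f x : ℝ≥0∞) := fun n =>
        (hmp' n t ht).lintegral_comp (measurable_coe_nnreal_ennreal.comp hf.measurable)
      simp_rw [this]
      exact tendsto_const_nhds
  refine ⟨fun t => γ t, fun x => ?_, fun t ht => hlip t (Ioo_subset_Icc_self ht),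
    fun t ht => hmp t (Ioo_subset_Icc_self ht), fun t ht x => ?_⟩
  · have h0 : (0 : ℝ) ∈ Icc (-τ) τ := ⟨by linarith, hτ0.le⟩
    have := hpt 0 h0 x
    simp only [(hg _).zero, BoundedContinuousFunction.coe_zero, Pi.zero_apply] at this
    exact tendsto_nhds_unique this tendsto_const_nhds
  -- For each particle the velocities converge uniformly in time, so the limit of the trajectories
  -- may be differentiated term by term. This is done on the open interval.
  · refine hasDerivAt_of_tendstoUniformlyOn (s := Ioo (-τ) τ) isOpen_Ioo
      (f := fun n s => g n s x) (f' := fun n s => flowField α (e n) θ (g n s) x)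
      (g' := fun s => flowField α 0 θ (γ s) x) (l := atTop) ?_
      (Eventually.of_forall fun n s hs => (hg n).hasDerivAt_apply (Ioo_subset_Icc_self hs) x)
      (fun s hs => hpt s (Ioo_subset_Icc_self hs) x) ht
    have hb : Tendsto (fun n => |velocityConst α| * r n +
        |velocityConst α| * (64 * M) * (G * r n)) atTop (𝓝 0) := by
      simpa using (hr.const_mul |velocityConst α|).add
        ((hr.const_mul G).const_mul (|velocityConst α| * (64 * M)))
    rw [Metric.tendstoUniformlyOn_iff]
    intro η hη
    filter_upwards [hb.eventually_lt_const hη] with n hn s hs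
    have hs' := Ioo_subset_Icc_self hs
    have b₁ := norm_flowField_sub_zero_le hα hα' h (e n) (hmp' n s hs') x
    have b₂ := norm_flowField_sub_flowField_le hα hα' h 0
      ((hg n).lipschitzWith hα hα' (he0 n) h hτ hs') (hlip s hs') (hmp' n s hs') (hmp s hs') x
    have b₃ : |velocityConst α| * (64 * M) * ‖g n s - γ s‖ ≤
        |velocityConst α| * (64 * M) * (G * r n) := by
      have := h.nonneg
      gcongr
      exact hclose s hs' n
    rw [dist_comm, dist_eq_norm]
    refine lt_of_le_of_lt ?_ hn
    have := norm_sub_le_norm_sub_add_norm_sub (flowField α (e n) θ (g n s) x)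
      (flowField α 0 θ (g n s) x) (flowField α 0 θ (γ s) x)
    linarith

/-- A uniform bound for the velocity of a transported density. -/
theorem exists_norm_velocity_le (hα : 0 < α) (hα' : α < 1 / 2) {A : ℝ} (hθ : Integrable θ)
    (hA : ∀ x, |θ x| ≤ A) :
    ∃ V : ℝ, 0 ≤ V ∧ ∀ Φ : Plane ≃ₜ Plane, MeasurePreserving Φ → ∀ p,
      ‖velocity α (fun x => θ (Φ.symm x)) p‖ ≤ V := by
  refine ⟨|velocityConst α| * (A * (∫ w, (Metric.ball (0 : Plane) 1).indicator
    (fun x => ‖x‖ ^ (-(1 + 2 * α))) w) + ∫ y, |θ y|), ?_, fun Φ hΦ p => ?_⟩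
  · have : 0 ≤ A := (abs_nonneg _).trans (hA 0)
    have h1 : 0 ≤ ∫ w, (Metric.ball (0 : Plane) 1).indicator
        (fun x => ‖x‖ ^ (-(1 + 2 * α))) w :=
      integral_nonneg fun w => indicator_nonneg (fun _ _ => by positivity) w
    have h2 : 0 ≤ ∫ y, |θ y| := integral_nonneg fun y => abs_nonneg _
    positivity
  · rw [velocity_comp_symm α θ hΦ, norm_smul, Real.norm_eq_abs]
    gcongr
    exact norm_kernelIntegral_le hα hα' 0 hθ hA hΦ p

/-! ### Locally bi-Lipschitz flows -/

/-- The flow maps `Φ t`, `t ∈ I`, preserve measure, are bi-Lipschitz locally uniformly in time, and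
follow the velocity of the density `θ₀` that they transport. -/
structure IsLipschitzFlow (α : ℝ) (θ₀ : Plane → ℝ) (I : Set ℝ) (Φ : ℝ → Plane ≃ₜ Plane) : Prop where
  isOpen : IsOpen I
  ordConnected : I.OrdConnected
  measurePreserving : ∀ t ∈ I, MeasurePreserving (Φ t) volume volume
  lipschitz : ∀ t ∈ I, ∃ K : ℝ≥0, ∀ᶠ s in 𝓝 t, LipschitzWith K (Φ s) ∧ LipschitzWith K (Φ s).symm
  hasDerivAt : ∀ t ∈ I, ∀ x : Plane,
    HasDerivAt (fun s => Φ s x) (velocity α (fun y => θ₀ ((Φ t).symm y)) (Φ t x)) t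

theorem exists_local_flow (hα : 0 < α) (hα' : α < 1 / 2) (h : IsDiniDensity α θ A M) {τ : ℝ}
    (hτ0 : 0 < τ) (hτ : lipRate α M * τ ≤ 1 / 4) :
    ∃ Φ : ℝ → Plane ≃ₜ Plane,
      IsLipschitzFlow α θ (Ioo (-τ) τ) Φ ∧ (∀ x, Φ 0 x = x) ∧
      ∀ t ∈ Ioo (-τ) τ, LipschitzWith 2 (Φ t) ∧ LipschitzWith 2 (Φ t).symm := by
  obtain ⟨g, hg0, hlip, hmp, hd⟩ := exists_displacement hα hα' h hτ0 hτ
  -- Outside the time interval the displacement is set to zero, so that every time has a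
  -- homeomorphism.
  have hlip' : ∀ t, LipschitzWith (1 / 2) (if t ∈ Ioo (-τ) τ then g t else fun _ => 0) := fun t => by
    by_cases ht : t ∈ Ioo (-τ) τ
    · rw [if_pos ht]; exact hlip t ht
    · rw [if_neg ht]; exact LipschitzWith.const' 0
  set Φ : ℝ → Plane ≃ₜ Plane := fun t => idAddHomeomorph (hlip' t)
  have hΦ : ∀ t ∈ Ioo (-τ) τ, ∀ x, Φ t x = x + g t x := fun t ht x => by
    simp only [Φ, idAddHomeomorph_apply, if_pos ht]
  have hΦ' : ∀ t ∈ Ioo (-τ) τ, (Φ t : Plane → Plane) = fun x => x + g t x := fun t ht =>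
    funext (hΦ t ht)
  have hmpΦ : ∀ t ∈ Ioo (-τ) τ, MeasurePreserving (Φ t) := fun t ht => by
    rw [hΦ' t ht]; exact hmp t ht
  have h0 : (0 : ℝ) ∈ Ioo (-τ) τ := ⟨by linarith, hτ0⟩
  have hder : ∀ t ∈ Ioo (-τ) τ, ∀ x, HasDerivAt (fun s => Φ s x)
      (velocity α (fun x => θ ((Φ t).symm x)) (Φ t x)) t := fun t ht x => by
    have h1 : HasDerivAt (fun s => x + g s x) (flowField α 0 θ (g t) x) t :=
      (hd t ht x).const_add x
    rw [velocity_comp_symm α θ (hmpΦ t ht), hΦ' t ht]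
    refine h1.congr_of_eventuallyEq ?_
    filter_upwards [isOpen_Ioo.mem_nhds ht] with s hs
    exact hΦ s hs x
  have hl : ∀ t ∈ Ioo (-τ) τ, LipschitzWith 2 (Φ t) ∧ LipschitzWith 2 (Φ t).symm := by
    refine fun t ht => ⟨?_, ?_⟩
    · rw [hΦ' t ht]
      refine (LipschitzWith.id.add (hlip t ht)).weaken ?_
      rw [← NNReal.coe_le_coe]
      push_cast
      norm_num
    · refine LipschitzWith.of_dist_le_mul fun x y => ?_
      obtain ⟨a, rfl⟩ := (Φ t).surjective x
      obtain ⟨b, rfl⟩ := (Φ t).surjective y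
      rw [Homeomorph.symm_apply_apply, Homeomorph.symm_apply_apply, hΦ t ht, hΦ t ht, dist_eq_norm,
        dist_eq_norm]
      exact norm_sub_le_two_mul_of_lipschitz (hlip t ht) a b
  refine ⟨Φ, ⟨isOpen_Ioo, ordConnected_Ioo, hmpΦ, fun t ht => ⟨2, ?_⟩, hder⟩, fun x => ?_, hl⟩
  · filter_upwards [isOpen_Ioo.mem_nhds ht] with s hs
    exact hl s hs
  · rw [hΦ 0 h0, hg0, add_zero]

end

theorem norm_sub_le_mul_of_lipschitzWith_symm {Φ : Plane ≃ₜ Plane} {K : ℝ≥0}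
    (h : LipschitzWith K Φ.symm) (x y : Plane) : ‖x - y‖ ≤ K * ‖Φ x - Φ y‖ := by
  simpa using h.norm_sub_le (Φ x) (Φ y)

namespace IsLipschitzFlow

variable {α : ℝ} {θ₀ : Plane → ℝ} {I J : Set ℝ} {Φ Ψ : ℝ → Plane ≃ₜ Plane} {A M : ℝ}

theorem exists_lipschitzWith (h : IsLipschitzFlow α θ₀ I Φ) {S : Set ℝ} (hS : IsCompact S)
    (hSI : S ⊆ I) :
    ∃ K : ℝ≥0, 0 < K ∧ ∀ t ∈ S, LipschitzWith K (Φ t) ∧ LipschitzWith K (Φ t).symm := by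
  refine hS.induction_on (p := fun S => ∃ K : ℝ≥0, 0 < K ∧
    ∀ t ∈ S, LipschitzWith K (Φ t) ∧ LipschitzWith K (Φ t).symm) ⟨1, one_pos, by simp⟩ ?_ ?_ ?_
  · rintro s t hst ⟨K, hK, ht⟩
    exact ⟨K, hK, fun r hr => ht r (hst hr)⟩
  · rintro s t ⟨K, hK, hs⟩ ⟨K', hK', ht⟩
    refine ⟨max K K', lt_max_of_lt_left hK, fun r hr => ?_⟩
    rcases hr with hr | hr
    · exact ⟨(hs r hr).1.weaken (le_max_left _ _), (hs r hr).2.weaken (le_max_left _ _)⟩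
    · exact ⟨(ht r hr).1.weaken (le_max_right _ _), (ht r hr).2.weaken (le_max_right _ _)⟩
  · intro t ht
    obtain ⟨K, hK⟩ := h.lipschitz t (hSI ht)
    refine ⟨_, mem_nhdsWithin_of_mem_nhds hK, K + 1, by positivity, fun s hs => ?_⟩
    exact ⟨hs.1.weaken (by simp), hs.2.weaken (by simp)⟩

/-- On the compact interval between s and r both flows have inverses with a common Lipschitz
constant k, so a uniform bound on their distance controls the difference of their velocities.
Starting from the trivial bound by the maximal speed, each iteration halves the bound in the
exponentially weighted norm. -/
theorem eq_of_eq (hα : 0 < α) (hα' : α < 1 / 2) (hθ : IsDiniDensity α θ₀ A M)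
    (h : IsLipschitzFlow α θ₀ I Φ) (h' : IsLipschitzFlow α θ₀ J Ψ) {s r : ℝ} (hs : s ∈ I ∩ J)
    (hr : r ∈ I ∩ J) (heq : Φ s = Ψ s) : Φ r = Ψ r := by
  have hI : uIcc s r ⊆ I := h.ordConnected.uIcc_subset hs.1 hr.1
  have hJ : uIcc s r ⊆ J := h'.ordConnected.uIcc_subset hs.2 hr.2
  obtain ⟨K₁, hK₁, hl₁⟩ := h.exists_lipschitzWith isCompact_uIcc hI
  obtain ⟨K₂, hK₂, hl₂⟩ := h'.exists_lipschitzWith isCompact_uIcc hJ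
  obtain ⟨V, hV0, hV⟩ := exists_norm_velocity_le hα hα' hθ.integrable hθ.abs_le
  set k : ℝ≥0 := max K₁ K₂
  have hk : (0 : ℝ) < k := NNReal.coe_pos.2 (lt_max_of_lt_left hK₁)
  have hΦk : ∀ t ∈ uIcc s r, ∀ x y, ‖x - y‖ ≤ k * ‖Φ t x - Φ t y‖ := fun t ht =>
    norm_sub_le_mul_of_lipschitzWith_symm ((hl₁ t ht).2.weaken (le_max_left _ _))
  have hΨk : ∀ t ∈ uIcc s r, ∀ x y, ‖x - y‖ ≤ k * ‖Ψ t x - Ψ t y‖ := fun t ht =>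
    norm_sub_le_mul_of_lipschitzWith_symm ((hl₂ t ht).2.weaken (le_max_right _ _))
  set C := |velocityConst α| * (8 * (k : ℝ) ^ (2 + 2 * α) * M)
  have hd : ∀ x, ∀ t ∈ uIcc s r, HasDerivAt (fun t => Φ t x - Ψ t x)
      (velocity α (fun y => θ₀ ((Φ t).symm y)) (Φ t x) -
        velocity α (fun y => θ₀ ((Ψ t).symm y)) (Ψ t x)) t := fun x t ht =>
    (h.hasDerivAt t (hI ht) x).sub (h'.hasDerivAt t (hJ ht) x)
  have h0 : ∀ x, Φ s x - Ψ s x = 0 := fun x => by rw [heq, sub_self]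
  have key : ∀ n : ℕ, ∀ t ∈ uIcc s r, ∀ x,
      ‖Φ t x - Ψ t x‖ ≤ 2 * V * |r - s| / 2 ^ n * Real.exp (2 * C * |t - s|) := by
    intro n
    induction n with
    | zero =>
      intro t ht x
      have h1 := (convex_uIcc s r).norm_image_sub_le_of_norm_hasDerivWithin_le (C := 2 * V)
        (fun t ht => (hd x t ht).hasDerivWithinAt) (fun t ht => (norm_sub_le _ _).trans (by
          linarith [hV _ (h.measurePreserving t (hI ht)) (Φ t x),
            hV _ (h'.measurePreserving t (hJ ht)) (Ψ t x)])) left_mem_uIcc ht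
      rw [h0, sub_zero, Real.norm_eq_abs] at h1
      have h2 : |t - s| ≤ |r - s| := abs_sub_left_of_mem_uIcc ht
      have hC : 0 ≤ C := by
        have := hθ.nonneg
        positivity
      have h3 : 1 ≤ Real.exp (2 * C * |t - s|) := Real.one_le_exp (by positivity)
      calc ‖Φ t x - Ψ t x‖ ≤ 2 * V * |t - s| := h1
        _ ≤ 2 * V * |r - s| := by gcongr
        _ ≤ 2 * V * |r - s| / 2 ^ 0 * Real.exp (2 * C * |t - s|) := by
          rw [pow_zero, div_one]
          exact le_mul_of_one_le_right (by positivity) h3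
    | succ n ih =>
      intro t ht x
      rw [pow_succ, ← div_div]
      refine norm_le_half_mul_exp_of_hasDerivAt (f := fun t => Φ t x - Ψ t x) (by positivity) (h0 x)
        (fun q hq => hd x q (uIcc_subset_uIcc_left ht hq)) fun q hq => ?_
      have hq' := uIcc_subset_uIcc_left ht hq
      rw [velocity_comp_symm α θ₀ (h.measurePreserving q (hI hq')),
        velocity_comp_symm α θ₀ (h'.measurePreserving q (hJ hq')), ← smul_sub, norm_smul,
        Real.norm_eq_abs]
      have h1 := hθ.norm_kernelIntegral_flow_sub_le hα hα' 0 (h.measurePreserving q (hI hq'))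
        (h'.measurePreserving q (hJ hq')) (ih q hq') hk (hΦk q hq') (hΨk q hq') x
      refine (mul_le_mul_of_nonneg_left h1 (abs_nonneg _)).trans_eq ?_
      simp only [C]
      ring
  ext1 x
  have hlim : Tendsto (fun n : ℕ => 2 * V * |r - s| / 2 ^ n * Real.exp (2 * C * |r - s|)) atTop
      (𝓝 0) := by
    have h1 := (tendsto_pow_atTop_nhds_zero_of_lt_one (r := (1 / 2 : ℝ)) (by norm_num)
      (by norm_num)).const_mul (2 * V * |r - s| * Real.exp (2 * C * |r - s|))
    rw [mul_zero] at h1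
    refine h1.congr fun n => ?_
    rw [one_div, inv_pow]
    ring
  have := ge_of_tendsto' hlim fun n => key n r right_mem_uIcc x
  exact sub_eq_zero.1 (norm_le_zero_iff.1 this)

theorem isLagrangianSolution (hα : 0 < α) (hα' : α < 1 / 2) (hθ : IsDiniDensity α θ₀ A M)
    (h : IsLipschitzFlow α θ₀ I Φ) (h0 : (0 : ℝ) ∈ I) (hΦ : ∀ x, Φ 0 x = x) :
    IsLagrangianSolution α θ₀ I (fun t x => θ₀ ((Φ t).symm x)) Φ := by
  have hmemp : MemLp θ₀ ∞ volume :=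
    memLp_top_of_bound hθ.integrable.aestronglyMeasurable A (ae_of_all _ hθ.abs_le)
  obtain ⟨V, hV0, hV⟩ := exists_norm_velocity_le hα hα' hθ.integrable hθ.abs_le
  refine ⟨h.isOpen, h.ordConnected, h0, fun t ht => ?_, fun t ht => ?_, fun t _ x => rfl,
    h.measurePreserving, fun t ht => ?_, hΦ, h.hasDerivAt⟩
  · exact (memLp_one_iff_integrable.2 hθ.integrable).comp_measurePreserving
      (measurePreserving_symm (h.measurePreserving t ht))
  · exact hmemp.comp_measurePreserving (measurePreserving_symm (h.measurePreserving t ht))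
  · rw [Metric.tendstoUniformly_iff]
    intro η hη
    have hc : Tendsto (fun s => V * |s - t|) (𝓝[I] t) (𝓝 0) := by
      have : Continuous fun s => V * |s - t| := by fun_prop
      have h1 := (this.tendsto t).mono_left (nhdsWithin_le_nhds (s := I))
      simpa using h1
    filter_upwards [hc.eventually_lt_const hη, self_mem_nhdsWithin] with s hs hsI x
    rw [dist_comm, dist_eq_norm]
    refine lt_of_le_of_lt ?_ hs
    exact h.ordConnected.convex.norm_image_sub_le_of_norm_hasDerivWithin_le
      (fun r hr => (h.hasDerivAt r hr x).hasDerivWithinAt)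
      (fun r hr => hV _ (h.measurePreserving r hr) _) ht hsI

theorem of_locally_eq (hI : IsOpen I) (hI' : I.OrdConnected)
    (h : ∀ t ∈ I, ∃ J Ψ, IsLipschitzFlow α θ₀ J Ψ ∧ t ∈ J ∧ ∀ s ∈ J, Φ s = Ψ s) :
    IsLipschitzFlow α θ₀ I Φ := by
  refine ⟨hI, hI', fun t ht => ?_, fun t ht => ?_, fun t ht x => ?_⟩ <;>
    obtain ⟨J, Ψ, hΨ, htJ, heq⟩ := h t ht
  · rw [heq t htJ]; exact hΨ.measurePreserving t htJ
  · obtain ⟨K, hK⟩ := hΨ.lipschitz t htJ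
    refine ⟨K, ?_⟩
    filter_upwards [hK, hΨ.isOpen.mem_nhds htJ] with s hs hsJ
    rwa [heq s hsJ]
  · rw [heq t htJ]
    refine (hΨ.hasDerivAt t htJ x).congr_of_eventuallyEq ?_
    filter_upwards [hΨ.isOpen.mem_nhds htJ] with s hs
    rw [heq s hs]

theorem exists_union (hα : 0 < α) (hα' : α < 1 / 2) (hθ : IsDiniDensity α θ₀ A M)
    (h : IsLipschitzFlow α θ₀ I Φ) (h' : IsLipschitzFlow α θ₀ J Ψ) {s : ℝ} (hs : s ∈ I ∩ J)
    (heq : Φ s = Ψ s) :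
    ∃ Ξ : ℝ → Plane ≃ₜ Plane, IsLipschitzFlow α θ₀ (I ∪ J) Ξ ∧ ∀ t ∈ I, Ξ t = Φ t := by
  classical
  set Ξ : ℝ → Plane ≃ₜ Plane := fun t => if t ∈ I then Φ t else Ψ t
  have hI : ∀ t ∈ I, Ξ t = Φ t := fun t ht => if_pos ht
  have hJ : ∀ t ∈ J, Ξ t = Ψ t := fun t ht => by
    by_cases htI : t ∈ I
    · rw [hI t htI, h.eq_of_eq hα hα' hθ h' hs ⟨htI, ht⟩ heq]
    · exact if_neg htI
  have hord : (I ∪ J).OrdConnected :=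
    (h.ordConnected.isPreconnected.union s hs.1 hs.2 h'.ordConnected.isPreconnected).ordConnected
  refine ⟨Ξ, of_locally_eq (h.isOpen.union h'.isOpen) hord fun t ht => ?_, hI⟩
  rcases ht with ht | ht
  · exact ⟨I, Φ, h, ht, hI⟩
  · exact ⟨J, Ψ, h', ht, hJ⟩

/-- The local flow Ξ of the density already transported to time s is composed with Φ s. The same
particles are followed, so the density carried by Ξ (t - s) ∘ Φ s is again a transport of θ₀. -/
theorem exists_restart (hα : 0 < α) (hα' : α < 1 / 2) (h : IsLipschitzFlow α θ₀ I Φ) {s τ : ℝ}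
    (hs : s ∈ I) (hθ : IsDiniDensity α (fun x => θ₀ ((Φ s).symm x)) A M) (hτ0 : 0 < τ)
    (hτ : lipRate α M * τ ≤ 1 / 4) :
    ∃ Ψ : ℝ → Plane ≃ₜ Plane, IsLipschitzFlow α θ₀ (Ioo (s - τ) (s + τ)) Ψ ∧ Ψ s = Φ s := by
  obtain ⟨Ξ, hΞ, hΞ0, hl⟩ := exists_local_flow hα hα' hθ hτ0 hτ
  obtain ⟨K, -, hK⟩ := h.exists_lipschitzWith isCompact_singleton (singleton_subset_iff.2 hs)
  have hmem : ∀ t ∈ Ioo (s - τ) (s + τ), t - s ∈ Ioo (-τ) τ := fun t ht =>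
    ⟨by linarith [ht.1], by linarith [ht.2]⟩
  refine ⟨fun t => (Φ s).trans (Ξ (t - s)), ⟨isOpen_Ioo, ordConnected_Ioo, fun t ht => ?_,
    fun t ht => ⟨2 * K, ?_⟩, fun t ht x => ?_⟩, ?_⟩
  · exact (hΞ.measurePreserving _ (hmem t ht)).comp (h.measurePreserving s hs)
  · filter_upwards [isOpen_Ioo.mem_nhds ht] with r hr
    refine ⟨(hl _ (hmem r hr)).1.comp (hK s rfl).1, ?_⟩
    rw [mul_comm]
    exact (hK s rfl).2.comp (hl _ (hmem r hr)).2
  · exact HasDerivAt.comp_sub_const t s (hΞ.hasDerivAt _ (hmem t ht) (Φ s x))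
  · ext1 x
    show Ξ (s - s) (Φ s x) = Φ s x
    rw [sub_self]
    exact hΞ0 _

theorem layerCake_bounded (hα : 0 < α) {L : Type*} [MeasurableSpace L] {Θ : Set (Plane × L)}
    {μ : SigmaFiniteSignedMeasure L} (h : IsLipschitzFlow α θ₀ I Φ) (hL : layerCakeL α Θ μ < ∞)
    (a b : ℝ) (hab : Icc a b ⊆ I) :
    (⨆ t ∈ Icc a b, layerCakeL α (push (Φ t) Θ) μ) < ∞ := by
  obtain ⟨K, hK, hl⟩ := h.exists_lipschitzWith isCompact_Icc hab
  refine lt_of_le_of_lt (iSup₂_le fun t ht => layerCakeL_push_le hα Θ μ (NNReal.coe_pos.2 hK)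
    (norm_sub_le_mul_of_lipschitzWith_symm (hl t ht).2)) (ENNReal.mul_lt_top ENNReal.ofReal_lt_top hL)

end IsLipschitzFlow

/-! ### From layer cake representations to bi-Lipschitz flows -/

theorem IsLayerCake.isDiniDensity {α : ℝ} (hα : 0 < α) {θ : Plane → ℝ} {L : Type*}
    [MeasurableSpace L] {Θ : Set (Plane × L)} {μ : SigmaFiniteSignedMeasure L} {A M : ℝ}
    (h : IsLayerCake θ Θ μ) (hθ : Integrable θ) (hA : ∀ x, |θ x| ≤ A) (hM0 : 0 ≤ M)
    (hM : layerCakeL α Θ μ ≤ ENNReal.ofReal M) : IsDiniDensity α θ A (Real.pi / α * M) := by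
  have := Real.pi_pos
  refine ⟨hθ, hA, (dini_le_layerCakeL hα h).trans ?_, by positivity⟩
  rw [ENNReal.ofReal_mul (by positivity)]
  gcongr

/-- A finite Dini seminorm makes θ Hölder continuous, so its essential bound holds at every point.
-/
theorem IsLayerCake.exists_isDiniDensity {α : ℝ} (hα : 0 < α) (hα' : α < 1 / 2) {θ : Plane → ℝ}
    {L : Type*} [MeasurableSpace L] {Θ : Set (Plane × L)} {μ : SigmaFiniteSignedMeasure L}
    (h : IsLayerCake θ Θ μ) (hL : layerCakeL α Θ μ < ∞) (hθ₁ : MemLp θ 1 volume)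
    (hθ₂ : MemLp θ ∞ volume) : ∃ A M, IsDiniDensity α θ A M := by
  have hθ := memLp_one_iff_integrable.1 hθ₁
  have hd : dini α θ < ∞ := (dini_le_layerCakeL hα h).trans_lt
    (ENNReal.mul_lt_top ENNReal.ofReal_lt_top hL)
  obtain ⟨A, hA⟩ := exists_abs_le_of_continuous_of_memLp
    (continuous_of_dini_lt_top hα hα' hθ.aemeasurable hd) hθ₂
  exact ⟨A, _, h.isDiniDensity hα hθ hA ENNReal.toReal_nonneg (ENNReal.ofReal_toReal hL.ne).ge⟩

theorem exists_Icc_subset_of_isOpen {I : Set ℝ} (hI : IsOpen I) (hI' : I.OrdConnected) {s t : ℝ}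
    (hs : s ∈ I) (ht : t ∈ I) : ∃ a b, Icc a b ⊆ I ∧ s ∈ Icc a b ∧ t ∈ Ioo a b := by
  obtain ⟨δ, hδ, hball⟩ := Metric.isOpen_iff.1 hI t ht
  have h1 : t - δ / 2 ∈ I := hball (by
    rw [Metric.mem_ball, Real.dist_eq, abs_lt]; constructor <;> linarith)
  have h2 : t + δ / 2 ∈ I := hball (by
    rw [Metric.mem_ball, Real.dist_eq, abs_lt]; constructor <;> linarith)
  refine ⟨min s (t - δ / 2), max s (t + δ / 2), hI'.out ?_ ?_, ⟨min_le_left _ _, le_max_left _ _⟩,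
    (min_le_right _ _).trans_lt (by linarith), lt_of_lt_of_le (by linarith) (le_max_right _ _)⟩
  · rcases min_choice s (t - δ / 2) with h | h <;> rwa [h]
  · rcases max_choice s (t + δ / 2) with h | h <;> rwa [h]

/-- At each time the pushed sets represent the transported density, so the bound on L_μ over a
compact interval bounds the Lipschitz constant of the velocity there. Gronwall for the distance of
two trajectories, forward and backward between 0 and s, bounds the Lipschitz constants of Φ s and
its inverse. -/
theorem IsControlledSolution.isLipschitzFlow {α : ℝ} (hα : 0 < α) (hα' : α < 1 / 2)
    {θ₀ : Plane → ℝ} {L : Type*} [MeasurableSpace L] {Θ : Set (Plane × L)}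
    {μ : SigmaFiniteSignedMeasure L} {I : Set ℝ} {θ : ℝ → Plane → ℝ} {Φ : ℝ → Plane ≃ₜ Plane}
    {A M : ℝ} (hθ : IsDiniDensity α θ₀ A M) (hrep : IsLayerCake θ₀ Θ μ)
    (h : IsControlledSolution α θ₀ Θ μ I θ Φ) : IsLipschitzFlow α θ₀ I Φ := by
  have heq : ∀ t ∈ I, θ t = fun x => θ₀ ((Φ t).symm x) := fun t ht => funext (h.eq_comp t ht)
  refine ⟨h.isOpen, h.ordConnected, h.measurePreserving, fun t ht => ?_, fun t ht x => by
    rw [← heq t ht]; exact h.hasDerivAt t ht x⟩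
  -- The interval must contain time 0, where the flow is the identity, and a neighbourhood of t,
  -- since the Lipschitz bound is required for all times near t.
  obtain ⟨a, b, hab, h0, htab⟩ := exists_Icc_subset_of_isOpen h.isOpen h.ordConnected h.zero_mem ht
  set R := ⨆ t ∈ Icc a b, layerCakeL α (push (Φ t) Θ) μ
  have hR : R < ∞ := h.bounded a b hab
  set C := |velocityConst α| * lipConst α * (Real.pi / α * R.toReal)
  have hvel : ∀ s ∈ Icc a b, ∀ p q, ‖velocity α (θ s) p - velocity α (θ s) q‖ ≤ C * ‖p - q‖ := by
    intro s hs
    have hmp := h.measurePreserving s (hab hs)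
    rw [heq s (hab hs)]
    refine ((hrep.push hmp).isDiniDensity hα
      ((measurePreserving_symm hmp).integrable_comp_of_integrable hθ.integrable)
      (fun x => hθ.abs_le _) ENNReal.toReal_nonneg ?_).norm_velocity_sub_le hα hα'
    rw [ENNReal.ofReal_toReal hR.ne]
    exact le_iSup₂ (f := fun t _ => layerCakeL α (push (Φ t) Θ) μ) s hs
  have hC : 0 ≤ C := by
    have := lipConst_pos hα'
    have := Real.pi_pos
    positivity
  set K := Real.exp (C * (b - a))
  have hgr : ∀ s ∈ Icc a b, ∀ r ∈ Icc a b, ∀ x y,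
      ‖Φ r x - Φ r y‖ ≤ ‖Φ s x - Φ s y‖ * K := by
    intro s hs r hr x y
    have hsub : uIcc s r ⊆ Icc a b := ordConnected_Icc.uIcc_subset hs hr
    refine (norm_le_mul_exp_of_hasDerivAt (f := fun t => Φ t x - Φ t y) (K := C)
      (fun q hq => (h.hasDerivAt q (hab (hsub hq)) x).sub (h.hasDerivAt q (hab (hsub hq)) y))
      (fun q hq => hvel q (hsub hq) _ _)).trans ?_
    have : |r - s| ≤ b - a := abs_sub_le_iff.2 ⟨by linarith [hr.2, hs.1], by linarith [hs.2, hr.1]⟩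
    simp only [K]
    gcongr
  refine ⟨⟨K, (Real.exp_pos _).le⟩, ?_⟩
  filter_upwards [Ioo_mem_nhds htab.1 htab.2] with s hs
  have hs' := Ioo_subset_Icc_self hs
  refine ⟨LipschitzWith.of_dist_le_mul fun x y => ?_, LipschitzWith.of_dist_le_mul fun x y => ?_⟩
  · have := hgr 0 h0 s hs' x y
    rw [h.flow_zero, h.flow_zero] at this
    rw [dist_eq_norm, dist_eq_norm, mul_comm]
    exact this
  · have := hgr s hs' 0 h0 ((Φ s).symm x) ((Φ s).symm y)
    rw [h.flow_zero, h.flow_zero, Homeomorph.apply_symm_apply, Homeomorph.apply_symm_apply] at this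
    rw [dist_eq_norm, dist_eq_norm, mul_comm]
    exact this

/-! ### The maximal flow -/

theorem exists_maximal_isLipschitzFlow {α : ℝ} (hα : 0 < α) (hα' : α < 1 / 2)
    {θ₀ : Plane → ℝ} {A M : ℝ} (hθ : IsDiniDensity α θ₀ A M) :
    ∃ (I : Set ℝ) (Φ : ℝ → Plane ≃ₜ Plane), IsLipschitzFlow α θ₀ I Φ ∧ (0 : ℝ) ∈ I ∧
      (∀ x, Φ 0 x = x) ∧ ∀ J Ψ, IsLipschitzFlow α θ₀ J Ψ → (0 : ℝ) ∈ J → (∀ x, Ψ 0 x = x) →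
        J ⊆ I ∧ ∀ t ∈ J, Ψ t = Φ t := by
  classical
  set P : Set ℝ → (ℝ → Plane ≃ₜ Plane) → Prop := fun J Ψ =>
    IsLipschitzFlow α θ₀ J Ψ ∧ (0 : ℝ) ∈ J ∧ ∀ x, Ψ 0 x = x
  set I : Set ℝ := {t | ∃ J Ψ, P J Ψ ∧ t ∈ J}
  have hex : ∀ t, ∃ Ξ : Plane ≃ₜ Plane, t ∈ I → ∃ J Ψ, P J Ψ ∧ t ∈ J ∧ Ψ t = Ξ := fun t => by
    by_cases ht : t ∈ I
    · obtain ⟨J, Ψ, hP, htJ⟩ := ht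
      exact ⟨Ψ t, fun _ => ⟨J, Ψ, hP, htJ, rfl⟩⟩
    · exact ⟨Homeomorph.refl _, fun h => absurd h ht⟩
  choose Φ hΦ using hex
  have hsub : ∀ J Ψ, P J Ψ → J ⊆ I := fun J Ψ hP t ht => ⟨J, Ψ, hP, ht⟩
  -- By uniqueness from time 0 the choice made in defining Φ t does not matter, so Φ coincides with
  -- each flow on the whole interval of that flow.
  have hagree : ∀ J Ψ, P J Ψ → ∀ t ∈ J, Ψ t = Φ t := by
    intro J Ψ hP t ht
    obtain ⟨J', Ψ', hP', ht', heq⟩ := hΦ t (hsub J Ψ hP ht)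
    rw [← heq]
    exact hP.1.eq_of_eq hα hα' hθ hP'.1 ⟨hP.2.1, hP'.2.1⟩ ⟨ht, ht'⟩
      (Homeomorph.ext fun x => by rw [hP.2.2, hP'.2.2])
  have hI : I = ⋃₀ {J | ∃ Ψ, P J Ψ} := by
    ext t
    simp only [I, mem_sUnion, Set.mem_ofPred_eq]
    exact ⟨fun ⟨J, Ψ, hP, ht⟩ => ⟨J, ⟨Ψ, hP⟩, ht⟩, fun ⟨J, ⟨Ψ, hP⟩, ht⟩ => ⟨J, Ψ, hP, ht⟩⟩
  have hopen : IsOpen I := by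
    rw [hI]
    exact isOpen_sUnion fun J ⟨Ψ, hP⟩ => hP.1.isOpen
  have hord : I.OrdConnected := by
    rw [hI]
    refine (isPreconnected_sUnion 0 _ ?_ ?_).ordConnected
    · rintro J ⟨Ψ, hP⟩
      exact hP.2.1
    · rintro J ⟨Ψ, hP⟩
      exact hP.1.ordConnected.isPreconnected
  have h0 : ∃ J Ψ, P J Ψ := by
    have hrate : 0 ≤ lipRate α M := by
      have := lipConst_pos hα'
      have := hθ.nonneg
      unfold lipRate; positivity
    have hτ0 : 0 < 1 / (4 * (lipRate α M + 1)) := by positivity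
    obtain ⟨Ψ, hΨ, hΨ0, -⟩ := exists_local_flow hα hα' hθ hτ0 (by
      rw [mul_one_div, div_le_div_iff₀ (by positivity) (by norm_num)]
      linarith)
    exact ⟨_, Ψ, hΨ, by constructor <;> linarith, hΨ0⟩
  obtain ⟨J, Ψ, hP⟩ := h0
  refine ⟨I, Φ, IsLipschitzFlow.of_locally_eq hopen hord ?_, hsub J Ψ hP hP.2.1, fun x => ?_,
    fun J Ψ h h0 h1 => ⟨hsub J Ψ ⟨h, h0, h1⟩, hagree J Ψ ⟨h, h0, h1⟩⟩⟩
  · rintro t ⟨J, Ψ, hP, ht⟩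
    exact ⟨J, Ψ, hP.1, ht, fun s hs => (hagree J Ψ hP s hs).symm⟩
  · rw [← hagree J Ψ hP 0 hP.2.1, hP.2.2]

/-- A maximal flow continues beyond any time by an amount that depends only on the layer cake
seminorm at that time. -/
theorem exists_Ioo_subset_of_maximal {α : ℝ} (hα : 0 < α) (hα' : α < 1 / 2) {θ₀ : Plane → ℝ}
    {A M : ℝ} (hθ : IsDiniDensity α θ₀ A M) {L : Type*} [MeasurableSpace L] {Θ : Set (Plane × L)}
    {μ : SigmaFiniteSignedMeasure L} (hrep : IsLayerCake θ₀ Θ μ) {I : Set ℝ}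
    {Φ : ℝ → Plane ≃ₜ Plane} (h : IsLipschitzFlow α θ₀ I Φ) (h0 : (0 : ℝ) ∈ I)
    (hΦ0 : ∀ x, Φ 0 x = x)
    (hmax : ∀ J Ψ, IsLipschitzFlow α θ₀ J Ψ → (0 : ℝ) ∈ J → (∀ x, Ψ 0 x = x) → J ⊆ I)
    (N : ℝ≥0) : ∃ τ > 0, ∀ t ∈ I, layerCakeL α (push (Φ t) Θ) μ ≤ N → Ioo (t - τ) (t + τ) ⊆ I := by
  set M' := Real.pi / α * N
  have hrate : 0 ≤ lipRate α M' := by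
    have := lipConst_pos hα'
    have := Real.pi_pos
    unfold lipRate; positivity
  have hτ0 : 0 < 1 / (4 * (lipRate α M' + 1)) := by positivity
  refine ⟨_, hτ0, fun t ht htN => ?_⟩
  have hmp := h.measurePreserving t ht
  have hdd : IsDiniDensity α (fun x => θ₀ ((Φ t).symm x)) A M' :=
    (hrep.push hmp).isDiniDensity hα
      ((measurePreserving_symm hmp).integrable_comp_of_integrable hθ.integrable)
      (fun x => hθ.abs_le _) N.2 (by simpa using htN)
  obtain ⟨Ψ, hΨ, heq⟩ := h.exists_restart hα hα' ht hdd hτ0 (by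
    rw [mul_one_div, div_le_div_iff₀ (by positivity) (by norm_num)]
    linarith)
  -- Gluing the restarted flow to Φ gives a flow that still starts at the identity, so maximality
  -- places its interval inside I.
  obtain ⟨Ξ, hΞ, hΞΦ⟩ := h.exists_union hα hα' hθ hΨ
    (s := t) ⟨ht, by constructor <;> linarith⟩ heq.symm
  exact subset_union_right.trans (hmax _ Ξ hΞ (Or.inl h0) fun x => by rw [hΞΦ 0 h0, hΦ0])

/-! ### Blow-up at finite endpoints -/

theorem tendsto_nhds_top_of_isLUB {I : Set ℝ} (hI : IsOpen I) (hI' : I.OrdConnected)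
    (h0 : (0 : ℝ) ∈ I) {f : ℝ → ℝ≥0∞}
    (hf : ∀ N : ℝ≥0, ∃ τ > 0, ∀ t ∈ I, f t ≤ N → Ioo (t - τ) (t + τ) ⊆ I) {T : ℝ}
    (hT : IsLUB I T) : Tendsto f (𝓝[<] T) (𝓝 ∞) := by
  have hTI : T ∉ I := fun h => by
    obtain ⟨u, hu, hsub⟩ := exists_Ico_subset_of_mem_nhds (hI.mem_nhds h) ⟨T + 1, by linarith⟩
    obtain ⟨v, hv⟩ := exists_between hu
    exact absurd (hT.1 (hsub ⟨hv.1.le, hv.2⟩)) (not_le.2 hv.1)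
  refine ENNReal.tendsto_nhds_top_iff_nnreal.2 fun N => ?_
  obtain ⟨τ, hτ, hN⟩ := hf N
  have h0T : 0 < T := (hT.1 h0).lt_of_ne fun h => hTI (h ▸ h0)
  filter_upwards [Ioo_mem_nhdsLT (show max 0 (T - τ) < T from max_lt h0T (by linarith))] with t ht
  obtain ⟨h1, h2⟩ := max_lt_iff.1 ht.1
  obtain ⟨s, hs, hts⟩ := (lt_isLUB_iff hT).1 ht.2
  have htI : t ∈ I := hI'.out h0 hs ⟨h1.le, hts.le⟩
  by_contra! hle
  -- If f t ≤ N at a time t closer to T than τ, the continuation interval contains T, although the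
  -- open interval I cannot contain its supremum.
  exact hTI (hN t htI hle ⟨by linarith [ht.2], by linarith⟩)

theorem tendsto_nhds_top_of_isGLB {I : Set ℝ} (hI : IsOpen I) (hI' : I.OrdConnected)
    (h0 : (0 : ℝ) ∈ I) {f : ℝ → ℝ≥0∞}
    (hf : ∀ N : ℝ≥0, ∃ τ > 0, ∀ t ∈ I, f t ≤ N → Ioo (t - τ) (t + τ) ⊆ I) {T : ℝ}
    (hT : IsGLB I T) : Tendsto f (𝓝[>] T) (𝓝 ∞) := by
  have hTI : T ∉ I := fun h => by
    obtain ⟨u, hu, hsub⟩ := exists_Ioc_subset_of_mem_nhds (hI.mem_nhds h) ⟨T - 1, by linarith⟩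
    obtain ⟨v, hv⟩ := exists_between hu
    exact absurd (hT.1 (hsub ⟨hv.1, hv.2.le⟩)) (not_le.2 hv.2)
  refine ENNReal.tendsto_nhds_top_iff_nnreal.2 fun N => ?_
  obtain ⟨τ, hτ, hN⟩ := hf N
  have h0T : T < 0 := (hT.1 h0).lt_of_ne fun h => hTI (h ▸ h0)
  filter_upwards [Ioo_mem_nhdsGT (show T < min 0 (T + τ) from lt_min h0T (by linarith))] with t ht
  obtain ⟨h1, h2⟩ := lt_min_iff.1 ht.2
  obtain ⟨s, hs, hts⟩ := (isGLB_lt_iff hT).1 ht.1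
  have htI : t ∈ I := hI'.out hs h0 ⟨hts.le, h1.le⟩
  by_contra! hle
  exact hTI (hN t htI hle ⟨by linarith, by linarith [ht.1]⟩)

/-- The flow here is maximal among locally bi-Lipschitz flows, a property free of Θ and μ. The same
I and Φ therefore serve every representation with finite L_μ, which gives independence of the
representation. -/
theorem isControlledSolution_and_maximal {α : ℝ} (hα : 0 < α) (hα' : α < 1 / 2) {θ₀ : Plane → ℝ}
    {A M : ℝ} (hθ : IsDiniDensity α θ₀ A M) {L : Type*} [MeasurableSpace L] {Θ : Set (Plane × L)}
    {μ : SigmaFiniteSignedMeasure L} (hrep : IsLayerCake θ₀ Θ μ) (hL : layerCakeL α Θ μ < ∞)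
    {I : Set ℝ} {Φ : ℝ → Plane ≃ₜ Plane} (h : IsLipschitzFlow α θ₀ I Φ) (h0 : (0 : ℝ) ∈ I)
    (hΦ0 : ∀ x, Φ 0 x = x)
    (hmax : ∀ J Ψ, IsLipschitzFlow α θ₀ J Ψ → (0 : ℝ) ∈ J → (∀ x, Ψ 0 x = x) →
      J ⊆ I ∧ ∀ t ∈ J, Ψ t = Φ t) :
    IsControlledSolution α θ₀ Θ μ I (fun t x => θ₀ ((Φ t).symm x)) Φ ∧
      ∀ (I' : Set ℝ) (θ' : ℝ → Plane → ℝ) (Φ' : ℝ → Plane ≃ₜ Plane),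
        IsControlledSolution α θ₀ Θ μ I' θ' Φ' →
          I' ⊆ I ∧ ∀ t ∈ I', θ' t = (fun x => θ₀ ((Φ t).symm x)) ∧ Φ' t = Φ t := by
  refine ⟨⟨h.isLagrangianSolution hα hα' hθ h0 hΦ0, h.layerCake_bounded hα hL⟩,
    fun I' θ' Φ' h' => ?_⟩
  obtain ⟨hsub, heq⟩ := hmax I' Φ' (h'.isLipschitzFlow hα hα' hθ hrep) h'.zero_mem h'.flow_zero
  refine ⟨hsub, fun t ht => ⟨funext fun x => ?_, heq t ht⟩⟩
  rw [h'.eq_comp t ht, heq t ht]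

end GSQG

theorem theorem1p2 (α : ℝ) (hα₀ : 0 < α) (hα₁ : α < 1 / 2)
    (θ₀ : GSQG.Plane → ℝ) (hθ₁ : MemLp θ₀ 1 volume) (hθ₂ : MemLp θ₀ ∞ volume)
    {L : Type*} [MeasurableSpace L] (Θ : Set (GSQG.Plane × L))
    (μ : GSQG.SigmaFiniteSignedMeasure L) (hrep : GSQG.IsLayerCake θ₀ Θ μ)
    (hL : GSQG.layerCakeL α Θ μ < ∞) :
    ∃ (I : Set ℝ) (θ : ℝ → GSQG.Plane → ℝ) (Φ : ℝ → GSQG.Plane ≃ₜ GSQG.Plane),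
      -- a Lagrangian solution on `I`, with `L_μ(Φ^t_* Θ)` bounded on compact subintervals
      GSQG.IsControlledSolution α θ₀ Θ μ I θ Φ ∧
      -- `I` is the maximal such interval, and the solution is unique
      (∀ (I' : Set ℝ) (θ' : ℝ → GSQG.Plane → ℝ) (Φ' : ℝ → GSQG.Plane ≃ₜ GSQG.Plane),
        GSQG.IsControlledSolution α θ₀ Θ μ I' θ' Φ' →
          I' ⊆ I ∧ ∀ t ∈ I', θ' t = θ t ∧ Φ' t = Φ t) ∧
      -- the maximal interval and the solution are the same for any other representation
      (∀ (L' : Type*) [MeasurableSpace L'] (Θ' : Set (GSQG.Plane × L'))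
        (μ' : GSQG.SigmaFiniteSignedMeasure L'),
        GSQG.IsLayerCake θ₀ Θ' μ' → GSQG.layerCakeL α Θ' μ' < ∞ →
          GSQG.IsControlledSolution α θ₀ Θ' μ' I θ Φ ∧
          ∀ (I' : Set ℝ) (θ' : ℝ → GSQG.Plane → ℝ) (Φ' : ℝ → GSQG.Plane ≃ₜ GSQG.Plane),
            GSQG.IsControlledSolution α θ₀ Θ' μ' I' θ' Φ' →
              I' ⊆ I ∧ ∀ t ∈ I', θ' t = θ t ∧ Φ' t = Φ t) ∧
      -- the flow maps and their inverses are Lipschitz, locally uniformly in time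
      (∀ a b : ℝ, Icc a b ⊆ I →
        ∃ K : ℝ≥0, ∀ t ∈ Icc a b, LipschitzWith K (Φ t) ∧ LipschitzWith K (Φ t).symm) ∧
      -- blow-up at finite endpoints
      (∀ T : ℝ, IsLUB I T →
        Tendsto (fun t => GSQG.layerCakeL α (GSQG.push (Φ t) Θ) μ) (𝓝[<] T) (𝓝 ∞)) ∧
      (∀ T : ℝ, IsGLB I T →
        Tendsto (fun t => GSQG.layerCakeL α (GSQG.push (Φ t) Θ) μ) (𝓝[>] T) (𝓝 ∞)) := by
  obtain ⟨A, M, hθ⟩ := hrep.exists_isDiniDensity hα₀ hα₁ hL hθ₁ hθ₂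
  obtain ⟨I, Φ, h, h0, hΦ0, hmax⟩ := GSQG.exists_maximal_isLipschitzFlow hα₀ hα₁ hθ
  have hcont := GSQG.exists_Ioo_subset_of_maximal hα₀ hα₁ hθ hrep h h0 hΦ0
    fun J Ψ h h0 h1 => (hmax J Ψ h h0 h1).1
  have hsol := GSQG.isControlledSolution_and_maximal hα₀ hα₁ hθ hrep hL h h0 hΦ0 hmax
  refine ⟨I, fun t x => θ₀ ((Φ t).symm x), Φ, hsol.1, hsol.2,
    fun L' _ Θ' μ' hrep' hL' =>
      GSQG.isControlledSolution_and_maximal hα₀ hα₁ hθ hrep' hL' h h0 hΦ0 hmax,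
    fun a b hab => ?_,
    fun T hT => GSQG.tendsto_nhds_top_of_isLUB h.isOpen h.ordConnected h0 hcont hT,
    fun T hT => GSQG.tendsto_nhds_top_of_isGLB h.isOpen h.ordConnected h0 hcont hT⟩
  obtain ⟨K, -, hK⟩ := h.exists_lipschitzWith isCompact_Icc hab
  exact ⟨K, hK⟩
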